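/- Let $n\ge 0$ and let $V=\mathbb C^{1|2n}$, with standard basis $e_0$ (even), $e_1,\dots,e_{2n}$ (odd). Let $B$ be the even supersymmetric bilinear form on $V$ with matrix $\begin{bmatrix}1&0&0\\0&0&I_n\\0&-I_n&0\end{bmatrix}$, let $\mathfrak{osp}(1|2n)$ be the Lie superalgebra spanned by the homogeneous matrices $X$ with $B(Xu,v)+(-1)^{|X||u|}B(u,Xv)=0$ for all homogeneous $u$ and all $v$, and let $\mathfrak g=\mathfrak{gosp}(1|2n)=\mathbb CZ\oplus\mathfrak{osp}(1|2n)$ with $Z$ even and central. Let $\mathfrak U(\mathfrak g)$ be its enveloping algebra and $\mathcal Z(\mathfrak g)$ the centre of $\mathfrak U(\mathfrak g)$ as a superalgebra (the span of the homogeneous $z$ with $zw=(-1)^{|z||w|}wz$ for all homogeneous $w$). Let $\mathcal P(V)=\mathbb C[y]\otimes\Lambda(x_1,\dots,x_{2n})$ with degree-$k$ part $\mathcal P^k(V)$, let $\partial_y,\partial_1,\dots,\partial_{2n}$ be the left superderivations dual to $y,x_1,\dots,x_{2n}$, let $\mathcal D^k(V)$ be the constant-coefficient operators of degree $k$, $\mathcal{PD}(V)\subset\operatorname{End}\mathcal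 P(V)$ the algebra generated by the multiplications by $y,x_i$ and by $\partial_y,\partial_i$, and $\mathcal{PD}^k(V)\cong\mathcal P^k(V)\otimes\mathcal D^k(V)$ the span of the products $f\partial$ with $f\in\mathcal P^k(V)$, $\partial\in\mathcal D^k(V)$. Put $x_0=y$ and $\partial_0=\partial_y$. The Lie superalgebra $\mathfrak g$ acts on $\mathcal P(V)$ by $E_{ij}\mapsto x_i\partial_j$ ($0\le i,j\le 2n$, restricted to $\mathfrak{osp}(1|2n)$) and $Z\mapsto E=y\partial_y+\sum_i x_i\partial_i$. This gives an algebra map $\mathfrak U(\mathfrak g)\to\mathcal{PD}(V)$. Let $\mathcal{PD}(V)^{\mathfrak g}$ be the span of the homogeneous $D\in\mathcal{PD}(V)$ with $Dx=(-1)^{|D||x|}xD$ for all homogeneous $x\in\mathfrak g$. Let $R^2$ be multiplication by $y^2+2\sum_{i=1}^n x_{i+n}x_i$, let $\nabla^2=\partial_y^2+2\sum_{i=1}^n\partial_{i+n}\partial_i$ and $\mathcal H_k=\mathcal P^k(V)\cap\ker\nabla^2$. Let $\Lambda^*_{d,n}$ be the set of pairs of integers $\nu=(\nu_1,\nu_2)$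 with $\nu_1\ge\nu_2\ge0$, $|\nu|:=\nu_1+\nu_2\le d$ and $\nu_2\ge\lfloor|\nu|/2\rfloor-n$, and for such $\nu$ let $V_\nu=R^{2\nu_2}\mathcal H_{\nu_1-\nu_2}$, so that $\mathcal P^k(V)=\bigoplus_{|\nu|=k}V_\nu$. The Capelli operator $D_\nu$, with $k=|\nu|$, is the element of $\mathcal{PD}^k(V)\cong\mathcal P^k(V)\otimes\mathcal D^k(V)\cong\operatorname{Hom}(\mathcal P^k(V),\mathcal P^k(V))$ corresponding to the identity of $V_\nu$: it is the unique element of $\mathcal{PD}^k(V)$ that acts as the identity on $V_\nu$ and as $0$ on $V_{\nu'}$ for all $\nu'\ne\nu$ with $|\nu'|=k$. Let $C\in\mathfrak U(\mathfrak g)$ be the Casimir element of $\mathfrak{osp}(1|2n)$, normalized by the invariant form $\kappa(X,Y)=-\tfrac12\operatorname{str}(XY)$: $C=\sum_a b_ab^a$ for a homogeneous basis $(b_a)$ of $\mathfrak{osp}(1|2n)$ and the basis $(b^a)$ with $\kappa(b^a,b_c)=\delta_{ac}$. Let $\Lambda_{d,n}$ be the set of pairs of integers $\mu_1\ge\mu_2\ge0$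 with $\mu_1+\mu_2\le d$ and $\mu_2\le n$, and let $B_{d,n}=\{C^{\mu_2}Z^{\mu_1-\mu_2}:\mu\in\Lambda_{d,n}\}$. **Theorem.** For every $d\ge0$ we have $B_{d,n}\subset\mathcal Z(\mathfrak g)$, and for every $\nu\in\Lambda^*_{d,n}$ the Capelli operator $D_\nu$ exists, is unique, lies in $\mathcal{PD}(V)^{\mathfrak g}$, and is a complex linear combination of the images of the elements of $B_{d,n}$ in $\mathcal{PD}(V)$. Moreover, the image of $\mathcal Z(\mathfrak g)$ in $\mathcal{PD}(V)$ is exactly $\mathcal{PD}(V)^{\mathfrak g}$; that is, the map $\mathcal Z(\mathfrak g)\to\mathcal{PD}(V)^{\mathfrak g}$ is well defined and surjective. -/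

import Mathlib

open scoped TensorProduct Polynomial

noncomputable section

namespace CapelliOsp

/-! ### Signs, indices and parities -/

/-- The sign `(-1)^{pq}` for parities `p, q ∈ ℤ/2`. -/
def koszul (p q : ZMod 2) : ℂ := if p = 1 ∧ q = 1 then -1 else 1

/-- Indices of the odd basis vectors: `inl i` is the index `i` and `inr i` is the index `i + n`. -/
abbrev OddIdx (n : ℕ) : Type := Fin n ⊕ Fin n

/-- Indices of the standard basis of `ℂ^{1|2n}`: one even vector and `2n` odd vectors. -/
abbrev Idx (n : ℕ) : Type := Unit ⊕ OddIdx n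

/-- The parity of a standard basis vector. -/
def par {n : ℕ} : Idx n → ZMod 2 := Sum.elim (fun _ => 0) (fun _ => 1)

theorem koszul_comm (p q : ZMod 2) : koszul p q = koszul q p := by
  simp only [koszul, and_comm]

theorem zmod_two_cases (p : ZMod 2) : p = 0 ∨ p = 1 := by
  revert p; decide

theorem koszul_add_left (p q r : ZMod 2) : koszul (p + q) r = koszul p r * koszul q r := by
  have h2 : (1 : ZMod 2) + 1 = 0 := by decide
  rcases zmod_two_cases p with rfl | rfl <;> rcases zmod_two_cases q with rfl | rfl <;>
    rcases zmod_two_cases r with rfl | rfl <;> simp [koszul, h2]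

theorem koszul_add_right (p q r : ZMod 2) : koszul p (q + r) = koszul p q * koszul p r := by
  rw [koszul_comm, koszul_add_left, koszul_comm q, koszul_comm r]

theorem koszul_mul_self (p q : ZMod 2) : koszul p q * koszul p q = 1 := by
  unfold koszul; split_ifs <;> norm_num

theorem koszul_zero_left (q : ZMod 2) : koszul 0 q = 1 := by
  simp [koszul]

theorem koszul_zero_right (q : ZMod 2) : koszul q 0 = 1 := by
  simp [koszul]

/-! ### The Lie superalgebra `gl(1|2n)` -/

/-- `(1|2n) × (1|2n)` complex matrices. -/
abbrev Mat (n : ℕ) : Type := Matrix (Idx n) (Idx n) ℂ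

/-- The homogeneous component of parity `p` of a matrix. A matrix `X` is homogeneous of
parity `p` iff `comp n p X = X`. -/
def comp (n : ℕ) (p : ZMod 2) : Mat n →ₗ[ℂ] Mat n where
  toFun X := Matrix.of fun i j => if par i + par j = p then X i j else 0
  map_add' X Y := by ext i j; simp only [Matrix.of_apply, Matrix.add_apply]; split_ifs <;> simp
  map_smul' c X := by ext i j; simp

/-- The super commutator: `[X, Y] = XY - (-1)^{|X||Y|} YX` for homogeneous `X, Y`,
extended bilinearly. -/
def superBracket {n : ℕ} (X Y : Mat n) : Mat n :=
  ∑ p : ZMod 2, ∑ q : ZMod 2,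
    (comp n p X * comp n q Y - koszul p q • (comp n q Y * comp n p X))

/-! ### The Lie superalgebra `osp(1|2n)` -/

/-- The block matrix `[[1, 0, 0], [0, 0, I], [0, -I, 0]]`. -/
def formMatrix (n : ℕ) : Mat n :=
  Matrix.fromBlocks 1 0 0 (Matrix.fromBlocks 0 1 (-1) 0)

/-- The even supersymmetric bilinear form `B` on `ℂ^{1|2n}`. -/
def form {n : ℕ} (u v : Idx n → ℂ) : ℂ := dotProduct u ((formMatrix n).mulVec v)

/-- The homogeneous part of parity `q` of `ℂ^{1|2n}`. -/
def vecPart (n : ℕ) (q : ZMod 2) : Submodule ℂ (Idx n → ℂ) where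
  carrier := {u | ∀ i, par i ≠ q → u i = 0}
  zero_mem' := fun _ _ => rfl
  add_mem' := fun hu hv i hi => by simp [hu i hi, hv i hi]
  smul_mem' := fun c u hu i hi => by simp [hu i hi]

/-- `osp(1|2n)`: the matrices all of whose homogeneous components `X_p` satisfy
`B(X_p u, v) + (-1)^{p|u|} B(u, X_p v) = 0` for all homogeneous `u` and all `v`. -/
def osp (n : ℕ) : Submodule ℂ (Mat n) where
  carrier := {X | ∀ p q : ZMod 2, ∀ u ∈ vecPart n q, ∀ v : Idx n → ℂ,
    form ((comp n p X).mulVec u) v + koszul p q * form u ((comp n p X).mulVec v) = 0}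
  zero_mem' := by intro p q u _ v; simp [form]
  add_mem' := by
    intro X Y hX hY p q u hu v
    have h1 := hX p q u hu v
    have h2 := hY p q u hu v
    simp only [form, map_add, Matrix.add_mulVec, Matrix.mulVec_add, add_dotProduct,
      dotProduct_add] at h1 h2 ⊢
    linear_combination h1 + h2
  smul_mem' := by
    intro c X hX p q u hu v
    have h1 := hX p q u hu v
    simp only [form, map_smul, Matrix.smul_mulVec, Matrix.mulVec_smul, smul_dotProduct,
      dotProduct_smul, smul_eq_mul] at h1 ⊢
    linear_combination c * h1

theorem comp_apply {n : ℕ} (p : ZMod 2) (X : Mat n) (i j : Idx n) :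
    comp n p X i j = if par i + par j = p then X i j else 0 := rfl

theorem comp_mulVec_mem {n : ℕ} (p q : ZMod 2) (X : Mat n) {u : Idx n → ℂ}
    (hu : u ∈ vecPart n q) : (comp n p X).mulVec u ∈ vecPart n (p + q) := by
  intro i hi
  show ∑ j, comp n p X i j * u j = 0
  refine Finset.sum_eq_zero fun j _ => ?_
  rw [comp_apply]
  by_cases hj : par j = q
  · rw [if_neg, zero_mul]
    rintro rfl
    apply hi
    rw [hj, add_assoc, CharTwo.add_self_eq_zero, add_zero]
  · rw [hu j hj, mul_zero]

theorem comp_mul_comp {n : ℕ} (p q r : ZMod 2) (X Y : Mat n) :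
    comp n r (comp n p X * comp n q Y) =
      if p + q = r then comp n p X * comp n q Y else 0 := by
  ext i j
  rw [comp_apply]
  have key : par i + par j ≠ p + q → (comp n p X * comp n q Y) i j = 0 := by
    intro h
    rw [Matrix.mul_apply]
    refine Finset.sum_eq_zero fun k _ => ?_
    rw [comp_apply, comp_apply]
    split_ifs with h1 h2
    · exfalso; apply h
      rw [← h1, ← h2]
      linear_combination (-1 : ZMod 2) * (CharTwo.add_self_eq_zero (par k))
    · simp
    · simp
    · simp
  by_cases h1 : par i + par j = p + q
  · by_cases h2 : p + q = r
    · rw [if_pos (h1.trans h2), if_pos h2]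
    · rw [if_neg (fun h => h2 (h1.symm.trans h)), if_neg h2]; rfl
  · have := key h1
    split_ifs <;> simp [this]

/-- `osp(1|2n)` is closed under the super commutator. -/
theorem superBracket_mem {n : ℕ} {X Y : Mat n} (hX : X ∈ osp n) (hY : Y ∈ osp n) :
    superBracket X Y ∈ osp n := by
  refine Submodule.sum_mem _ fun p _ => Submodule.sum_mem _ fun q _ => ?_
  intro s r u hu v
  rw [map_sub, map_smul, comp_mul_comp, comp_mul_comp, add_comm q p]
  by_cases hs : p + q = s
  · subst hs
    rw [if_pos rfl, if_pos rfl]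
    have e1 := hX p (q + r) _ (comp_mulVec_mem q r Y hu) v
    have e2 := hY q r u hu ((comp n p X).mulVec v)
    have e3 := hY q (p + r) _ (comp_mulVec_mem p r X hu) v
    have e4 := hX p r u hu ((comp n q Y).mulVec v)
    have hk : koszul p q * koszul p q = 1 := koszul_mul_self p q
    simp only [Matrix.mulVec_mulVec] at e1 e2 e3 e4
    simp only [form, Matrix.sub_mulVec, Matrix.smul_mulVec, Matrix.mulVec_sub,
      Matrix.mulVec_smul, sub_dotProduct, smul_dotProduct, dotProduct_sub, dotProduct_smul,
      smul_eq_mul, koszul_add_left, koszul_add_right, koszul_comm q p] at e1 e2 e3 e4 ⊢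
    linear_combination e1 - koszul p q * koszul p r * e2 - koszul p q * e3
      + koszul q r * (koszul p q * koszul p q) * e4
      - koszul p r * koszul q r * dotProduct u
          ((formMatrix n).mulVec ((comp n p X * comp n q Y).mulVec v)) * hk
  · rw [if_neg hs, if_neg hs]
    simp [form]

/-! ### The Lie superalgebra `gosp(1|2n)` and its enveloping algebra -/

/-- The underlying space of `gosp(1|2n) = ℂ Z ⊕ osp(1|2n)`; the pair `(c, X)` is `c Z + X`. -/
abbrev Gosp (n : ℕ) : Type := ℂ × osp n

/-- The homogeneous part of parity `p` of `gosp(1|2n)`; the element `Z` is even. -/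
def gospPart (n : ℕ) (p : ZMod 2) : Submodule ℂ (Gosp n) where
  carrier := {x | (p = 1 → x.1 = 0) ∧ comp n p (x.2 : Mat n) = x.2}
  zero_mem' := by simp
  add_mem' := by
    rintro x y ⟨h1, h2⟩ ⟨h3, h4⟩
    exact ⟨fun h => by simp [h1 h, h3 h], by simp [h2, h4]⟩
  smul_mem' := by
    rintro c x ⟨h1, h2⟩
    exact ⟨fun h => by simp [h1 h], by simp [h2]⟩

/-- The super bracket of `gosp(1|2n)`; the element `Z` is central. -/
def gospBracket {n : ℕ} (x y : Gosp n) : Gosp n :=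
  (0, ⟨superBracket (x.2 : Mat n) (y.2 : Mat n), superBracket_mem x.2.2 y.2.2⟩)

/-- The relations `x y - (-1)^{|x||y|} y x = [x, y]`, for homogeneous `x, y`, which define the
enveloping algebra as a quotient of the tensor algebra. -/
inductive EnvRel (n : ℕ) : TensorAlgebra ℂ (Gosp n) → TensorAlgebra ℂ (Gosp n) → Prop
  | bracket (p q : ZMod 2) (x y : Gosp n) (hx : x ∈ gospPart n p) (hy : y ∈ gospPart n q) :
      EnvRel n (TensorAlgebra.ι ℂ x * TensorAlgebra.ι ℂ y)
        (koszul p q • (TensorAlgebra.ι ℂ y * TensorAlgebra.ι ℂ x) +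
          TensorAlgebra.ι ℂ (gospBracket x y))

/-- The universal enveloping algebra of the Lie superalgebra `gosp(1|2n)`. -/
abbrev Env (n : ℕ) : Type := RingQuot (EnvRel n)

/-- The canonical map from `gosp(1|2n)` to its enveloping algebra. -/
def envι (n : ℕ) : Gosp n →ₗ[ℂ] Env n :=
  (RingQuot.mkAlgHom ℂ (EnvRel n)).toLinearMap ∘ₗ TensorAlgebra.ι ℂ

/-- The homogeneous part of parity `p` of the enveloping algebra, spanned by the products of
homogeneous elements of `gosp(1|2n)` whose parities add up to `p`. -/
def envPart (n : ℕ) (p : ZMod 2) : Submodule ℂ (Env n) :=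
  Submodule.span ℂ {u | ∃ l : List (ZMod 2 × Gosp n),
    (∀ a ∈ l, a.2 ∈ gospPart n a.1) ∧ (l.map Prod.fst).sum = p ∧
      u = (l.map fun a => envι n a.2).prod}

/-- The homogeneous elements of parity `p` of the centre of the superalgebra `Env n`: those `z`
with `z w = (-1)^{|z||w|} w z` for all homogeneous `w`. -/
def envCenterPart (n : ℕ) (p : ZMod 2) : Submodule ℂ (Env n) where
  carrier := {z | z ∈ envPart n p ∧
    ∀ q : ZMod 2, ∀ w ∈ envPart n q, z * w = koszul p q • (w * z)}
  zero_mem' := ⟨Submodule.zero_mem _, by simp⟩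
  add_mem' := by
    rintro a b ⟨ha, ha'⟩ ⟨hb, hb'⟩
    refine ⟨Submodule.add_mem _ ha hb, fun q w hw => ?_⟩
    rw [add_mul, mul_add, smul_add, ha' q w hw, hb' q w hw]
  smul_mem' := by
    rintro c a ⟨ha, ha'⟩
    refine ⟨Submodule.smul_mem _ c ha, fun q w hw => ?_⟩
    rw [smul_mul_assoc, mul_smul_comm, ha' q w hw, smul_comm]

/-- The centre of the enveloping algebra of `gosp(1|2n)`. -/
def envCenter (n : ℕ) : Submodule ℂ (Env n) := ⨆ p : ZMod 2, envCenterPart n p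

/-- The central element `Z`. -/
def envZ (n : ℕ) : Env n := envι n (1, 0)

/-! ### The Casimir element of `osp(1|2n)` -/

/-- The index `i'` dual to `i` for the form: `B(e_i, e_j) ≠ 0` iff `j = i'`. -/
def dualIdx {n : ℕ} : Idx n → Idx n := Sum.map id Sum.swap

/-- The sign `B(e_i, e_{i'})`. -/
def dualSign {n : ℕ} : Idx n → ℂ := Sum.elim (fun _ => 1) (Sum.elim (fun _ => 1) fun _ => -1)

/-- The matrix `F_{ij} = E_{ij} - E_{ij}^†`, where `†` is the super adjoint for the form `B`,
defined by `B(X u, v) = (-1)^{|X||u|} B(u, X^† v)`. -/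
def ospMatrix {n : ℕ} (i j : Idx n) : Mat n :=
  Matrix.single i j 1 -
    (koszul (par i + par j) (par j) * dualSign i * dualSign j) •
      Matrix.single (dualIdx j) (dualIdx i) 1

theorem dualIdx_dualIdx {n : ℕ} (i : Idx n) : dualIdx (dualIdx i) = i := by
  rcases i with _ | _ | _ <;> rfl

theorem par_dualIdx {n : ℕ} (i : Idx n) : par (dualIdx i) = par i := by
  rcases i with _ | _ | _ <;> rfl

theorem dualSign_mul_self {n : ℕ} (i : Idx n) : dualSign i * dualSign i = 1 := by
  rcases i with _ | _ | _ <;> simp [dualSign]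

theorem dualSign_dualIdx {n : ℕ} (i : Idx n) :
    dualSign (dualIdx i) = koszul (par i) (par i) * dualSign i := by
  rcases i with _ | _ | _ <;> simp [dualSign, dualIdx, koszul, par]

theorem dualIdx_eq_iff {n : ℕ} (i j : Idx n) : dualIdx i = j ↔ i = dualIdx j :=
  ⟨fun h => by rw [← h, dualIdx_dualIdx], fun h => by rw [h, dualIdx_dualIdx]⟩

theorem formMatrix_apply {n : ℕ} (i j : Idx n) :
    formMatrix n i j = if j = dualIdx i then dualSign i else 0 := by
  rcases i with _ | i | i <;> rcases j with _ | j | j <;>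
    simp [formMatrix, dualIdx, dualSign, Matrix.one_apply, eq_comm]
  split_ifs <;> simp

theorem form_eq {n : ℕ} (u v : Idx n → ℂ) :
    form u v = ∑ i, dualSign i * u i * v (dualIdx i) := by
  simp only [form, dotProduct, Matrix.mulVec, formMatrix_apply]
  refine Finset.sum_congr rfl fun i _ => ?_
  simp
  ring

theorem sum_dualIdx {n : ℕ} (f : Idx n → ℂ) : ∑ i, f (dualIdx i) = ∑ i, f i :=
  Fintype.sum_equiv ⟨dualIdx, dualIdx, dualIdx_dualIdx, dualIdx_dualIdx⟩ _ _ fun _ => rfl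

theorem form_mulVec_add {n : ℕ} (M : Mat n) (c : ℂ) (u v : Idx n → ℂ) :
    form (M.mulVec u) v + c * form u (M.mulVec v) =
      ∑ i, ∑ k, (dualSign (dualIdx i) * M (dualIdx i) k + c * (dualSign k * M (dualIdx k) i)) *
        (u k * v i) := by
  have h1 : form (M.mulVec u) v =
      ∑ i, ∑ k, dualSign (dualIdx i) * M (dualIdx i) k * (u k * v i) := by
    rw [form_eq, ← sum_dualIdx]
    refine Finset.sum_congr rfl fun i _ => ?_
    simp only [Matrix.mulVec, dotProduct, dualIdx_dualIdx, Finset.mul_sum, Finset.sum_mul]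
    exact Finset.sum_congr rfl fun k _ => by ring
  have h2 : form u (M.mulVec v) =
      ∑ i, ∑ k, dualSign k * M (dualIdx k) i * (u k * v i) := by
    rw [form_eq, Finset.sum_comm]
    refine Finset.sum_congr rfl fun k _ => ?_
    simp only [Matrix.mulVec, dotProduct, Finset.mul_sum]
    exact Finset.sum_congr rfl fun i _ => by ring
  rw [h1, h2, Finset.mul_sum, ← Finset.sum_add_distrib]
  refine Finset.sum_congr rfl fun i _ => ?_
  rw [Finset.mul_sum, ← Finset.sum_add_distrib]
  exact Finset.sum_congr rfl fun k _ => by ring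

theorem single_mem_vecPart {n : ℕ} (a : Idx n) : Pi.single a 1 ∈ vecPart n (par a) := by
  intro i hi
  rw [Pi.single_apply, if_neg]
  rintro rfl
  exact hi rfl

/-- The entries of an element of `osp(1|2n)`. -/
theorem mem_osp_iff {n : ℕ} (X : Mat n) : X ∈ osp n ↔ ∀ i j,
    X (dualIdx j) (dualIdx i) =
      -(koszul (par i + par j) (par j) * dualSign i * dualSign j * X i j) := by
  constructor
  · intro h i j
    have h1 := h (par i + par j) (par i) (Pi.single (dualIdx i) 1)
      (by simpa only [par_dualIdx] using single_mem_vecPart (dualIdx i)) (Pi.single j 1)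
    rw [form_mulVec_add, Finset.sum_eq_single j, Finset.sum_eq_single (dualIdx i)] at h1
    · simp only [comp_apply, par_dualIdx, dualIdx_dualIdx, Pi.single_eq_same, add_comm (par j),
        if_true, mul_one, dualSign_dualIdx] at h1
      have e1 := dualSign_mul_self j
      have e2 := koszul_mul_self (par i) (par i)
      have e3 := koszul_mul_self (par j) (par j)
      rw [koszul_add_left] at h1 ⊢
      rw [koszul_comm (par j) (par i)] at h1
      linear_combination (koszul (par j) (par j) * dualSign j) * h1 -
        (X (dualIdx j) (dualIdx i)) * e3 -
        (koszul (par j) (par j) * koszul (par j) (par j) * X (dualIdx j) (dualIdx i)) * e1 -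
        (koszul (par i) (par j) * koszul (par j) (par j) * dualSign i * dualSign j * X i j) * e2
    · intro k _ hk
      simp [hk]
    · simp
    · intro b _ hb
      refine Finset.sum_eq_zero fun k _ => ?_
      simp [Pi.single_apply, hb]
    · simp
  · intro h p q u hu v
    rw [form_mulVec_add]
    refine Finset.sum_eq_zero fun i _ => Finset.sum_eq_zero fun k _ => ?_
    by_cases hk : par k = q
    · subst hk
      simp only [comp_apply, par_dualIdx, add_comm (par k)]
      split_ifs with hp
      · subst hp
        have h1 := h (dualIdx k) i
        simp only [dualIdx_dualIdx, par_dualIdx, dualSign_dualIdx] at h1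
        rw [h1, dualSign_dualIdx]
        have e1 := dualSign_mul_self i
        have e2 := koszul_mul_self (par i) (par i)
        rw [koszul_add_left, koszul_add_left, koszul_comm (par k) (par i)]
        linear_combination (-koszul (par i) (par k) * koszul (par k) (par k) * dualSign k *
          X (dualIdx k) i * u k * v i) * (e2 + koszul (par i) (par i) *
            koszul (par i) (par i) * e1)
      · simp
    · simp [hu k hk]

theorem ospMatrix_mem {n : ℕ} (i j : Idx n) : ospMatrix i j ∈ osp n := by
  rw [mem_osp_iff]
  intro a b
  simp only [ospMatrix, Matrix.sub_apply, Matrix.smul_apply, Matrix.single_apply, smul_eq_mul]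
  have hk : koszul (par i + par j) (par i) * koszul (par i + par j) (par j) =
      koszul (par i) (par i) * koszul (par j) (par j) := by
    rw [koszul_add_left, koszul_add_left, koszul_comm (par j) (par i)]
    linear_combination (koszul (par i) (par i) * koszul (par j) (par j)) *
      koszul_mul_self (par i) (par j)
  have inj : ∀ a b : Idx n, dualIdx a = dualIdx b ↔ a = b := fun a b => by
    rw [dualIdx_eq_iff, dualIdx_dualIdx]
  have c1 : (i = dualIdx b ∧ j = dualIdx a) ↔ (dualIdx j = a ∧ dualIdx i = b) := by
    rw [dualIdx_eq_iff, dualIdx_eq_iff, and_comm]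
  have c2 : (dualIdx j = dualIdx b ∧ dualIdx i = dualIdx a) ↔ (i = a ∧ j = b) := by
    rw [inj, inj, and_comm]
  simp only [c1, c2]
  have e1 := dualSign_mul_self i
  have e2 := dualSign_mul_self j
  have e3 := koszul_mul_self (par i) (par i)
  have e4 := koszul_mul_self (par j) (par j)
  by_cases h1 : dualIdx j = a ∧ dualIdx i = b
  · rw [if_pos h1]
    obtain ⟨rfl, rfl⟩ := h1
    have hε : koszul (par j + par i) (par i) * dualSign (dualIdx j) * dualSign (dualIdx i) =
        koszul (par i + par j) (par j) * dualSign i * dualSign j := by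
      rw [dualSign_dualIdx, dualSign_dualIdx, koszul_add_left, koszul_add_left,
        koszul_comm (par j) (par i)]
      linear_combination (koszul (par i) (par j) * koszul (par j) (par j) * dualSign i *
        dualSign j) * e3
    have hη : (koszul (par i + par j) (par j) * dualSign i * dualSign j) *
        (koszul (par i + par j) (par j) * dualSign i * dualSign j) = 1 := by
      have e5 := koszul_mul_self (par i + par j) (par j)
      linear_combination (dualSign i * dualSign i * (dualSign j * dualSign j)) * e5 +
        (dualSign j * dualSign j) * e1 + e2
    rw [par_dualIdx, par_dualIdx, hε]
    linear_combination -hη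
  · rw [if_neg h1]
    by_cases h2 : i = a ∧ j = b
    · rw [if_pos h2]
      obtain ⟨rfl, rfl⟩ := h2
      ring
    · rw [if_neg h2]
      ring

/-- The matrices `F_{ij}` as elements of `osp(1|2n)`. -/
def ospGen {n : ℕ} (i j : Idx n) : osp n := ⟨ospMatrix i j, ospMatrix_mem i j⟩

/-- The invariant form `κ(X, Y) = -½ str(XY)` on `osp(1|2n)`. -/
def invForm {n : ℕ} (X Y : Mat n) : ℂ :=
  -(1 / 2) * ∑ i, koszul (par i) (par i) * (X * Y) i i

/-- The tensor `-½ ∑ (-1)^{|j|} F_{ij} ⊗ F_{ji}` is the canonical (Casimir) tensor `∑ x_a ⊗ x^a` of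
`osp(1|2n)` for the form `κ`: it satisfies `∑ κ(x^a, X) x_a = X` for all `X`. -/
theorem casimir_tensor {n : ℕ} (X : osp n) :
    -(1 / 2 : ℂ) • ∑ i : Idx n, ∑ j : Idx n,
      (koszul (par j) (par j) * invForm (ospGen j i : Mat n) (X : Mat n)) • ospGen i j = X := by
  obtain ⟨X, hX⟩ := X
  have hX' := (mem_osp_iff X).1 hX
  have hκ : ∀ i j : Idx n, koszul (par j) (par j) * invForm (ospMatrix j i) X = -X i j := by
    intro i j
    have tr : ∀ a b : Idx n, ∑ k, koszul (par k) (par k) *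
        ((Matrix.single a b (1 : ℂ) : Mat n) * X) k k = koszul (par a) (par a) * X b a := by
      intro a b
      rw [Finset.sum_eq_single a]
      · simp
      · intro k _ hk
        rw [Matrix.single_mul_apply_of_ne _ _ _ _ _ hk, mul_zero]
      · simp
    have e1 := dualSign_mul_self i
    have e2 := dualSign_mul_self j
    have e3 := koszul_mul_self (par i) (par i)
    have e4 := koszul_mul_self (par j) (par j)
    have e5 := koszul_mul_self (par i) (par j)
    simp only [invForm, ospMatrix, Matrix.sub_mul, Matrix.smul_mul, Matrix.sub_apply,
      Matrix.smul_apply, smul_eq_mul, mul_sub, Finset.sum_sub_distrib]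
    rw [tr j i]
    have : ∑ x, koszul (par x) (par x) *
        (koszul (par j + par i) (par i) * dualSign j * dualSign i *
          ((Matrix.single (dualIdx i) (dualIdx j) (1 : ℂ) : Mat n) * X) x x) =
        koszul (par j + par i) (par i) * dualSign j * dualSign i *
          (koszul (par i) (par i) * X (dualIdx j) (dualIdx i)) := by
      rw [← par_dualIdx i, ← tr (dualIdx i) (dualIdx j), Finset.mul_sum]
      simp only [par_dualIdx]
      exact Finset.sum_congr rfl fun x _ => by ring
    rw [this, hX' i j, koszul_add_left, koszul_add_left, koszul_comm (par j) (par i)]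
    linear_combination (-(1 / 2) * X i j) * e4 -
      (1 / 2 * koszul (par i) (par j) * koszul (par i) (par j) *
        (koszul (par i) (par i) * koszul (par i) (par i)) *
        (koszul (par j) (par j) * koszul (par j) (par j)) *
        (dualSign i * dualSign i) * X i j) * e2 -
      (1 / 2 * koszul (par i) (par j) * koszul (par i) (par j) *
        (koszul (par i) (par i) * koszul (par i) (par i)) *
        (koszul (par j) (par j) * koszul (par j) (par j)) * X i j) * e1 -
      (1 / 2 * koszul (par i) (par j) * koszul (par i) (par j) *
        (koszul (par i) (par i) * koszul (par i) (par i)) * X i j) * e4 -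
      (1 / 2 * koszul (par i) (par j) * koszul (par i) (par j) * X i j) * e3 -
      (1 / 2 * X i j) * e5
  have hsum : ∀ i j : Idx n, ((koszul (par j) (par j) * invForm (ospMatrix j i) X) •
      ospGen i j : osp n) = -(X i j • ospGen i j) := fun i j => by
    rw [hκ]; exact neg_smul (X i j) (ospGen i j)
  have hF : ∑ i, ∑ j, X i j • (ospMatrix i j : Mat n) = (2 : ℂ) • X := by
    have h1 : ∑ i, ∑ j, X i j • (Matrix.single i j (1 : ℂ) : Mat n) = X := by
      conv_rhs => rw [Matrix.matrix_eq_sum_single X]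
      simp [Matrix.smul_single]
    have h2 : ∑ i, ∑ j, (X i j * (koszul (par i + par j) (par j) * dualSign i * dualSign j)) •
        (Matrix.single (dualIdx j) (dualIdx i) (1 : ℂ) : Mat n) = -X := by
      ext a b
      rw [Matrix.sum_apply, Finset.sum_eq_single (dualIdx b), Matrix.sum_apply,
        Finset.sum_eq_single (dualIdx a)]
      · have h3 := hX' (dualIdx b) (dualIdx a)
        simp only [dualIdx_dualIdx] at h3
        rw [Matrix.smul_apply, dualIdx_dualIdx, dualIdx_dualIdx, Matrix.single_apply_same,
          Matrix.neg_apply, h3, smul_eq_mul]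
        ring
      · intro k _ hk
        rw [Matrix.smul_apply, Matrix.single_apply, if_neg, smul_zero]
        rintro ⟨h, _⟩
        exact hk ((dualIdx_eq_iff _ _).1 h)
      · simp
      · intro k _ hk
        rw [Matrix.sum_apply]
        refine Finset.sum_eq_zero fun l _ => ?_
        rw [Matrix.smul_apply, Matrix.single_apply, if_neg, smul_zero]
        rintro ⟨_, h⟩
        exact hk ((dualIdx_eq_iff _ _).1 h)
      · simp
    simp only [ospMatrix, smul_sub, smul_smul, Finset.sum_sub_distrib]
    rw [h1, h2, two_smul, sub_neg_eq_add]
  have hF' : ((∑ i, ∑ j, X i j • ospGen i j : osp n) : Mat n) = (2 : ℂ) • X := by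
    rw [← hF]
    simp [ospGen]
  apply Subtype.ext
  have hs : ∑ i : Idx n, ∑ j : Idx n,
      (koszul (par j) (par j) * invForm (ospGen j i : Mat n) X) • ospGen i j =
      -∑ i : Idx n, ∑ j : Idx n, X i j • ospGen i j := by
    rw [← Finset.sum_neg_distrib]
    refine Finset.sum_congr rfl fun i _ => ?_
    rw [← Finset.sum_neg_distrib]
    exact Finset.sum_congr rfl fun j _ => hsum i j
  rw [hs, Submodule.coe_smul, Submodule.coe_neg, hF', smul_neg, smul_smul]
  norm_num

/-- The Casimir element `C = ∑ x_a x^a` of `osp(1|2n)` for the form `κ(X, Y) = -½ str(XY)`, as an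
element of the enveloping algebra of `gosp(1|2n)`. -/
def envC (n : ℕ) : Env n :=
  -(1 / 2 : ℂ) • ∑ i : Idx n, ∑ j : Idx n,
    koszul (par j) (par j) • (envι n (0, ospGen i j) * envι n (0, ospGen j i))

/-! ### Superpolynomials and differential operators -/

/-- The superalgebra `P(V) = ℂ[y] ⊗ Λ(x_1, …, x_{2n})` of superpolynomials on `V = ℂ^{1|2n}`. -/
abbrev SPoly (n : ℕ) : Type := ℂ[X] ⊗[ℂ] ExteriorAlgebra ℂ (OddIdx n → ℂ)

/-- The coordinates: `y` (even) and `x_1, …, x_{2n}` (odd). -/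
def coord {n : ℕ} : Idx n → SPoly n :=
  Sum.elim (fun _ => Polynomial.X ⊗ₜ 1) fun j => 1 ⊗ₜ ExteriorAlgebra.ι ℂ (Pi.single j 1)

/-- Left multiplication by a coordinate. -/
def mulOp {n : ℕ} (i : Idx n) : Module.End ℂ (SPoly n) := LinearMap.mulLeft ℂ (coord i)

/-- The superderivations `∂_y, ∂_1, …, ∂_{2n}`; on the exterior algebra `∂_j` is the left
contraction with the `j`-th coordinate functional, the odd derivation with
`∂_j (u v) = ∂_j(u) v + (-1)^{|u|} u ∂_j(v)` and `∂_j x_k = δ_{jk}`. -/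
def der {n : ℕ} : Idx n → Module.End ℂ (SPoly n) :=
  Sum.elim
    (fun _ => LinearMap.rTensor (ExteriorAlgebra ℂ (OddIdx n → ℂ))
      (Polynomial.derivative : ℂ[X] →ₗ[ℂ] ℂ[X]))
    fun j => LinearMap.lTensor ℂ[X]
      (CliffordAlgebra.contractLeft (Q := (0 : QuadraticForm ℂ (OddIdx n → ℂ)))
        (LinearMap.proj j : Module.Dual ℂ (OddIdx n → ℂ)))

/-- The homogeneous part `P^k(V)` of degree `k`. -/
def polyDeg (n k : ℕ) : Submodule ℂ (SPoly n) := Submodule.span ℂ (Set.range coord) ^ k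

/-- The homogeneous part of parity `p` of `P(V)`. -/
def polyPart (n : ℕ) (p : ZMod 2) : Submodule ℂ (SPoly n) :=
  LinearMap.range (LinearMap.lTensor ℂ[X]
    (CliffordAlgebra.evenOdd (0 : QuadraticForm ℂ (OddIdx n → ℂ)) p).subtype)

/-- The constant coefficient operators `D^k(V)` of degree `k`. -/
def diffDeg (n k : ℕ) : Submodule ℂ (Module.End ℂ (SPoly n)) :=
  Submodule.span ℂ (Set.range der) ^ k

/-- The superalgebra `PD(V)` of polynomial coefficient differential operators. -/
def polyDiff (n : ℕ) : Subalgebra ℂ (Module.End ℂ (SPoly n)) :=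
  Algebra.adjoin ℂ (Set.range mulOp ∪ Set.range der)

/-- `PD^k(V)`: the image of `P^k(V) ⊗ D^k(V)`, spanned by the operators `f ∂` with `f ∈ P^k(V)`
(acting by left multiplication) and `∂ ∈ D^k(V)`. -/
def polyDiffDeg (n k : ℕ) : Submodule ℂ (Module.End ℂ (SPoly n)) :=
  (polyDeg n k).map (LinearMap.mul ℂ (SPoly n)) * diffDeg n k

/-! ### The action of `gosp(1|2n)` -/

/-- The action `E_{ij} ↦ x_i ∂_j` of `gl(1|2n)` on `P(V)`. -/
def glAction (n : ℕ) : Mat n →ₗ[ℂ] Module.End ℂ (SPoly n) where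
  toFun X := ∑ i, ∑ j, X i j • (mulOp i * der j)
  map_add' X Y := by simp [add_smul, Finset.sum_add_distrib]
  map_smul' c X := by simp [Finset.smul_sum, smul_smul]

/-- The degree operator `E = y ∂_y + ∑ x_i ∂_i`. -/
def euler (n : ℕ) : Module.End ℂ (SPoly n) := ∑ i, mulOp i * der i

/-- The action of `gosp(1|2n)` on `P(V)`, in which `Z` acts by the degree operator. -/
def gospAction (n : ℕ) : Gosp n →ₗ[ℂ] Module.End ℂ (SPoly n) where
  toFun x := x.1 • euler n + glAction n x.2
  map_add' x y := by simp [add_smul]; abel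
  map_smul' c x := by simp [smul_smul]

theorem mulOp_mulOp {n : ℕ} (i k : Idx n) :
    mulOp k * mulOp i = koszul (par i) (par k) • (mulOp i * mulOp k) := by
  have h : coord k * coord i = koszul (par i) (par k) • (coord (n := n) i * coord k) := by
    rcases i with _ | i <;> rcases k with _ | k
    · simp [coord, koszul, par]
    · simp [coord, koszul, par]
    · simp [coord, koszul, par]
    · have h1 := ExteriorAlgebra.ι_add_mul_swap (R := ℂ)
        (Pi.single k 1 : OddIdx n → ℂ) (Pi.single i 1)
      simp only [coord, koszul, par, Sum.elim_inr, Algebra.TensorProduct.tmul_mul_tmul, mul_one,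
        and_self, if_true]
      rw [eq_neg_of_add_eq_zero_left h1, TensorProduct.tmul_neg]
      exact (neg_one_smul ℂ _).symm
  refine LinearMap.ext fun u => ?_
  simp only [mulOp, Module.End.mul_apply, LinearMap.smul_apply, LinearMap.mulLeft_apply,
    ← mul_assoc, h, smul_mul_assoc]

theorem der_der {n : ℕ} (j l : Idx n) :
    der l * der j = koszul (par j) (par l) • (der (n := n) j * der l) := by
  refine TensorProduct.ext' fun f w => ?_
  rcases j with _ | j <;> rcases l with _ | l
  · simp [der, koszul, par]
  · simp [der, koszul, par]
  · simp [der, koszul, par]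
  · simp only [der, koszul, par, Sum.elim_inr, Module.End.mul_apply, LinearMap.smul_apply,
      LinearMap.lTensor_tmul, and_self, if_true, neg_smul, one_smul, ← TensorProduct.tmul_neg]
    rw [CliffordAlgebra.contractLeft_comm]

theorem der_mulOp {n : ℕ} (j k : Idx n) :
    der j * mulOp k = koszul (par j) (par k) • (mulOp k * der j) +
      (if j = k then 1 else 0 : ℂ) • 1 := by
  refine TensorProduct.ext' fun f w => ?_
  rcases j with _ | j <;> rcases k with _ | k
  · simp [der, mulOp, coord, koszul, par, TensorProduct.add_tmul, add_comm]
  · simp [der, mulOp, coord, koszul, par]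
  · simp [der, mulOp, coord, koszul, par]
  · have h := CliffordAlgebra.contractLeft_ι_mul (Q := (0 : QuadraticForm ℂ (OddIdx n → ℂ)))
      (d := (LinearMap.proj j : Module.Dual ℂ (OddIdx n → ℂ))) (Pi.single k 1) w
    have h' : (if (Sum.inr j : Idx n) = Sum.inr k then (1 : ℂ) else 0) =
        (Pi.single k 1 : OddIdx n → ℂ) j := by
      simp [Pi.single_apply]
    rw [h']
    simp only [der, mulOp, coord, koszul, par, Sum.elim_inr, Module.End.mul_apply,
      LinearMap.smul_apply, LinearMap.add_apply, LinearMap.lTensor_tmul, LinearMap.mulLeft_apply,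
      Algebra.TensorProduct.tmul_mul_tmul, one_mul, and_self, if_true, neg_smul, one_smul,
      Module.End.one_apply, ← TensorProduct.tmul_neg, ← TensorProduct.tmul_smul,
      ← TensorProduct.tmul_add]
    congr 1
    rw [ExteriorAlgebra.ι, h, LinearMap.proj_apply, sub_eq_neg_add]

/-- The super commutator of `E_{ij}` and `E_{kl}` acting on `P(V)`. -/
theorem glAction_comm {n : ℕ} (i j k l : Idx n) :
    mulOp i * der j * (mulOp k * der l) =
      koszul (par i + par j) (par k + par l) • (mulOp k * der l * (mulOp i * der j)) +
        ((if j = k then 1 else 0 : ℂ) • (mulOp i * der l) -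
          koszul (par i + par j) (par k + par l) •
            (if l = i then 1 else 0 : ℂ) • (mulOp k * der j)) := by
  have h1 : mulOp i * der j * (mulOp k * der l) =
      koszul (par j) (par k) • (mulOp i * mulOp k * (der j * der l)) +
        (if j = k then 1 else 0 : ℂ) • (mulOp (n := n) i * der l) := by
    rw [mul_assoc, ← mul_assoc (der j), der_mulOp]
    simp only [add_mul, mul_add, smul_mul_assoc, mul_smul_comm, one_mul, mul_assoc]
  have h2 : mulOp k * der l * (mulOp i * der j) =
      (koszul (par l) (par i) * koszul (par i) (par k) * koszul (par j) (par l)) •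
        (mulOp i * mulOp k * (der j * der l)) +
        (if l = i then 1 else 0 : ℂ) • (mulOp (n := n) k * der j) := by
    rw [mul_assoc, ← mul_assoc (der l), der_mulOp]
    simp only [add_mul, mul_add, smul_mul_assoc, mul_smul_comm, one_mul]
    rw [mul_assoc (mulOp i), ← mul_assoc (mulOp k), mulOp_mulOp, der_der]
    simp only [smul_mul_assoc, mul_smul_comm, smul_smul]
    congr 2
    ring
  have hk : koszul (par i + par j) (par k + par l) *
      (koszul (par l) (par i) * koszul (par i) (par k) * koszul (par j) (par l)) =
      koszul (par j) (par k) := by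
    simp only [koszul_add_left, koszul_add_right, koszul_comm (par l) (par i)]
    have e1 := koszul_mul_self (par i) (par k)
    have e2 := koszul_mul_self (par i) (par l)
    have e3 := koszul_mul_self (par j) (par l)
    linear_combination (koszul (par j) (par k)) * (e1 + koszul (par i) (par k) *
      koszul (par i) (par k) * (e2 + koszul (par i) (par l) * koszul (par i) (par l) * e3))
  rw [h1, h2, smul_add, smul_smul, hk]
  abel

theorem superBracket_eq {n : ℕ} {p q : ZMod 2} {X Y : Mat n} (hX : comp n p X = X)
    (hY : comp n q Y = Y) : superBracket X Y = X * Y - koszul p q • (Y * X) := by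
  have h0 : ∀ {p : ZMod 2} {X : Mat n}, comp n p X = X → ∀ r, r ≠ p → comp n r X = 0 := by
    intro p X hX r hr
    ext i j
    rw [← hX, comp_apply, comp_apply]
    split_ifs with h1 h2
    · exact absurd (h1.symm.trans h2) hr
    · rfl
    · rfl
  rw [superBracket, Finset.sum_eq_single p, Finset.sum_eq_single q, hX, hY]
  · intro r _ hr
    simp [h0 hY r hr]
  · simp
  · intro r _ hr
    simp [h0 hX r hr]
  · simp

theorem sum_four_swap {n : ℕ} {M : Type*} [AddCommMonoid M]
    (f : Idx n → Idx n → Idx n → Idx n → M) :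
    ∑ k, ∑ l, ∑ i, ∑ j, f i j k l = ∑ i, ∑ j, ∑ k, ∑ l, f i j k l := by
  have h1 := fun k => Finset.sum_comm (s := Finset.univ) (t := Finset.univ)
    (f := fun l i => ∑ j, f i j k l)
  have h2 := fun k i => Finset.sum_comm (s := Finset.univ) (t := Finset.univ)
    (f := fun l j => f i j k l)
  simp only [h1, h2]
  rw [Finset.sum_comm]
  exact Finset.sum_congr rfl fun i _ => Finset.sum_comm

theorem sum_four {n : ℕ} {M : Type*} [AddCommGroup M] [Module ℂ M] (c : ℂ)
    (f g h e : Idx n → Idx n → Idx n → Idx n → M)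
    (H : ∀ i j k l, f i j k l = c • g i j k l + (h i j k l - c • e i j k l)) :
    ∑ i, ∑ j, ∑ k, ∑ l, f i j k l = c • (∑ i, ∑ j, ∑ k, ∑ l, g i j k l) +
      (∑ i, ∑ j, ∑ k, ∑ l, h i j k l - c • ∑ i, ∑ j, ∑ k, ∑ l, e i j k l) := by
  simp only [H, Finset.smul_sum, Finset.sum_add_distrib, Finset.sum_sub_distrib]

/-- Operators `e i j` with the super commutation relations of matrix units give a representation
of the super commutator of matrices. -/
theorem sum_units_comm {n : ℕ} {A : Type*} [Ring A] [Algebra ℂ A] (e : Idx n → Idx n → A)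
    (he : ∀ i j k l, e i j * e k l =
      koszul (par i + par j) (par k + par l) • (e k l * e i j) +
        ((if j = k then 1 else 0 : ℂ) • e i l -
          koszul (par i + par j) (par k + par l) • (if l = i then 1 else 0 : ℂ) • e k j))
    {p q : ZMod 2} {X Y : Mat n} (hX : comp n p X = X) (hY : comp n q Y = Y) :
    (∑ i, ∑ j, X i j • e i j) * (∑ i, ∑ j, Y i j • e i j) =
      koszul p q • ((∑ i, ∑ j, Y i j • e i j) * (∑ i, ∑ j, X i j • e i j)) +
        ((∑ i, ∑ j, (X * Y) i j • e i j) - koszul p q • ∑ i, ∑ j, (Y * X) i j • e i j) := by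
  have hk : ∀ i j k l : Idx n, X i j * Y k l * koszul (par i + par j) (par k + par l) =
      koszul p q * (X i j * Y k l) := by
    intro i j k l
    rw [← hX, ← hY, comp_apply, comp_apply]
    split_ifs with h1 h2
    · rw [h1, h2, mul_comm]
    all_goals simp
  have h0 : ∀ X Y : Mat n, (∑ i, ∑ j, X i j • e i j) * (∑ i, ∑ j, Y i j • e i j) =
      ∑ i, ∑ j, ∑ k, ∑ l, (X i j * Y k l) • (e i j * e k l) := by
    intro X Y
    simp only [Finset.sum_mul]
    refine Finset.sum_congr rfl fun i _ => Finset.sum_congr rfl fun j _ => ?_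
    simp only [Finset.mul_sum, smul_mul_smul_comm]
  have h1 : (∑ i, ∑ j, Y i j • e i j) * (∑ i, ∑ j, X i j • e i j) =
      ∑ i, ∑ j, ∑ k, ∑ l, (X i j * Y k l) • (e k l * e i j) := by
    rw [h0, ← sum_four_swap]
    simp only [mul_comm]
  have h2 : ∑ i, ∑ j, (X * Y) i j • e i j =
      ∑ i, ∑ j, ∑ k, ∑ l, (X i j * Y k l) • (if j = k then 1 else 0 : ℂ) • e i l := by
    refine Finset.sum_congr rfl fun i _ => ?_
    have : ∀ j : Idx n, ∑ k, ∑ l, (X i j * Y k l) • (if j = k then 1 else 0 : ℂ) • e i l =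
        ∑ l, (X i j * Y j l) • e i l := by
      intro j
      rw [Finset.sum_eq_single j]
      · simp
      · intro k _ hk
        simp [hk.symm]
      · simp
    simp only [this]
    rw [Finset.sum_comm]
    refine Finset.sum_congr rfl fun l _ => ?_
    rw [Matrix.mul_apply, Finset.sum_smul]
  have h3 : ∑ i, ∑ j, (Y * X) i j • e i j =
      ∑ i, ∑ j, ∑ k, ∑ l, (X i j * Y k l) • (if l = i then 1 else 0 : ℂ) • e k j := by
    rw [← sum_four_swap]
    refine Finset.sum_congr rfl fun k _ => ?_
    have : ∀ l : Idx n, ∑ i, ∑ j, (X i j * Y k l) • (if l = i then 1 else 0 : ℂ) • e k j =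
        ∑ j, (X l j * Y k l) • e k j := by
      intro l
      rw [Finset.sum_eq_single l]
      · simp
      · intro i _ hi
        simp [hi.symm]
      · simp
    simp only [this]
    rw [Finset.sum_comm]
    refine Finset.sum_congr rfl fun j _ => ?_
    rw [Matrix.mul_apply, Finset.sum_smul]
    exact Finset.sum_congr rfl fun l _ => by rw [mul_comm]
  rw [h1, h2, h3, h0]
  refine sum_four _ _ _ _ _ fun i j k l => ?_
  rw [he i j k l, smul_add, smul_sub, smul_smul, hk, smul_smul _ (koszul _ _), hk]
  simp only [mul_smul]

theorem glAction_mul_comm {n : ℕ} {p q : ZMod 2} {X Y : Mat n} (hX : comp n p X = X)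
    (hY : comp n q Y = Y) :
    glAction n X * glAction n Y =
      koszul p q • (glAction n Y * glAction n X) + glAction n (X * Y - koszul p q • (Y * X)) := by
  rw [map_sub, map_smul]
  exact sum_units_comm (fun i j => mulOp i * der j) glAction_comm hX hY

theorem gospAction_rel {n : ℕ} (p q : ZMod 2) (x y : Gosp n) (hx : x ∈ gospPart n p)
    (hy : y ∈ gospPart n q) :
    gospAction n x * gospAction n y =
      koszul p q • (gospAction n y * gospAction n x) + gospAction n (gospBracket x y) := by
  obtain ⟨hx1, hx2⟩ := hx
  obtain ⟨hy1, hy2⟩ := hy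
  have hE : euler n = glAction n 1 := by
    simp only [euler, glAction, LinearMap.coe_mk, AddHom.coe_mk, Matrix.one_apply, ite_smul,
      one_smul, zero_smul, Finset.sum_ite_eq, Finset.mem_univ, if_true]
  have h1 : comp n 0 1 = (1 : Mat n) := by
    ext i j
    rw [comp_apply, Matrix.one_apply]
    by_cases h : i = j
    · subst h
      simp [CharTwo.add_self_eq_zero]
    · simp [h]
  have hc : ∀ z : Gosp n, gospAction n z = glAction n (z.1 • (1 : Mat n) + z.2) := by
    intro z
    rw [map_add, map_smul, ← hE]
    rfl
  have hp : ∀ {r : ZMod 2} {z : Gosp n}, (r = 1 → z.1 = 0) → comp n r (z.2 : Mat n) = z.2 →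
      comp n r (z.1 • (1 : Mat n) + z.2) = z.1 • (1 : Mat n) + z.2 := by
    intro r z hz1 hz2
    rw [map_add, map_smul, hz2]
    rcases zmod_two_cases r with rfl | rfl
    · rw [h1]
    · rw [hz1 rfl, zero_smul, zero_smul]
  rw [hc x, hc y, hc (gospBracket x y), glAction_mul_comm (hp hx1 hx2) (hp hy1 hy2)]
  congr 2
  simp only [gospBracket, zero_smul, zero_add]
  rw [superBracket_eq hx2 hy2]
  rcases zmod_two_cases p with rfl | rfl
  · simp only [koszul_zero_left, one_smul, add_mul, mul_add, smul_mul_assoc, mul_smul_comm,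
      one_mul, mul_one]
    rw [smul_add, smul_add, smul_comm x.1 y.1]
    abel
  · rcases zmod_two_cases q with rfl | rfl
    · simp only [koszul_zero_right, one_smul, add_mul, mul_add, smul_mul_assoc, mul_smul_comm,
        one_mul, mul_one]
      rw [smul_add, smul_add, smul_comm x.1 y.1]
      abel
    · rw [hx1 rfl, hy1 rfl]
      simp only [zero_smul, zero_add]

/-- The algebra map from the enveloping algebra of `gosp(1|2n)` to operators on `P(V)` given by
the action of `gosp(1|2n)`. -/
def envAction (n : ℕ) : Env n →ₐ[ℂ] Module.End ℂ (SPoly n) :=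
  RingQuot.liftAlgHom ℂ ⟨TensorAlgebra.lift ℂ (gospAction n), by
    rintro _ _ ⟨p, q, x, y, hx, hy⟩
    simpa using gospAction_rel p q x y hx hy⟩

/-- The homogeneous invariant operators of parity `p` in `PD(V)`: those `D` with
`D x = (-1)^{|D||x|} x D` for all homogeneous `x` in `gosp(1|2n)`. -/
def invariantPart (n : ℕ) (p : ZMod 2) : Submodule ℂ (Module.End ℂ (SPoly n)) where
  carrier := {D | D ∈ polyDiff n ∧
    (∀ q : ZMod 2, ∀ u ∈ polyPart n q, D u ∈ polyPart n (p + q)) ∧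
    ∀ q : ZMod 2, ∀ x ∈ gospPart n q,
      D * gospAction n x = koszul p q • (gospAction n x * D)}
  zero_mem' := ⟨Subalgebra.zero_mem _, fun _ _ _ => Submodule.zero_mem _, by simp⟩
  add_mem' := by
    rintro a b ⟨ha, ha1, ha2⟩ ⟨hb, hb1, hb2⟩
    refine ⟨Subalgebra.add_mem _ ha hb,
      fun q u hu => Submodule.add_mem _ (ha1 q u hu) (hb1 q u hu), fun q x hx => ?_⟩
    rw [add_mul, mul_add, smul_add, ha2 q x hx, hb2 q x hx]
  smul_mem' := by
    rintro c a ⟨ha, ha1, ha2⟩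
    refine ⟨Subalgebra.smul_mem _ ha c,
      fun q u hu => Submodule.smul_mem _ c (ha1 q u hu), fun q x hx => ?_⟩
    rw [smul_mul_assoc, mul_smul_comm, ha2 q x hx, smul_comm]

/-- The space `PD(V)^g` of `gosp(1|2n)`-invariant polynomial coefficient differential operators. -/
def invariants (n : ℕ) : Submodule ℂ (Module.End ℂ (SPoly n)) := ⨆ p : ZMod 2, invariantPart n p

/-! ### Harmonic superpolynomials and Capelli operators -/

/-- The operator `R²`: multiplication by `y² + 2 ∑ x_{i+n} x_i`, the quadratic form whose sign is the
one for which `R²` commutes with the action of `osp(1|2n)`. -/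
def rSq (n : ℕ) : Module.End ℂ (SPoly n) :=
  mulOp (Sum.inl ()) ^ 2 +
    2 • ∑ i : Fin n, mulOp (Sum.inr (Sum.inr i)) * mulOp (Sum.inr (Sum.inl i))

/-- The super Laplace operator `∇² = ∂_y² + 2 ∑ ∂_{i+n} ∂_i`, which commutes with `osp(1|2n)`. -/
def laplace (n : ℕ) : Module.End ℂ (SPoly n) :=
  der (Sum.inl ()) ^ 2 +
    2 • ∑ i : Fin n, der (Sum.inr (Sum.inr i)) * der (Sum.inr (Sum.inl i))

/-- The harmonic superpolynomials `H_k` of degree `k`. -/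
def harmonic (n k : ℕ) : Submodule ℂ (SPoly n) := polyDeg n k ⊓ LinearMap.ker (laplace n)

/-- The set of pairs `ν₁ ≥ ν₂ ≥ 0` with `|ν| = k` and `ν₂ ≥ ⌊k/2⌋ - n`. -/
def starIndex (n k : ℕ) : Set (ℕ × ℕ) :=
  {ν | ν.2 ≤ ν.1 ∧ ν.1 + ν.2 = k ∧ k / 2 ≤ ν.2 + n}

/-- `Λ*_{d,n}`, the union of the sets `starIndex n k` for `k ≤ d`. -/
def lambdaStar (d n : ℕ) : Set (ℕ × ℕ) := {ν | ∃ k ≤ d, ν ∈ starIndex n k}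

/-- `Λ_{d,n}`: the pairs `μ₁ ≥ μ₂ ≥ 0` with `|μ| ≤ d` and `μ₂ ≤ n`. -/
def lambdaIndex (d n : ℕ) : Set (ℕ × ℕ) := {μ | μ.2 ≤ μ.1 ∧ μ.1 + μ.2 ≤ d ∧ μ.2 ≤ n}

/-- The submodule `V_ν = R^{2ν₂} H_{ν₁-ν₂}` of `P(V)`. -/
def summand (n : ℕ) (ν : ℕ × ℕ) : Submodule ℂ (SPoly n) :=
  (harmonic n (ν.1 - ν.2)).map (rSq n ^ ν.2)

/-- `D` is the Capelli operator `D_ν`. For `k = |ν|`, the space `PD^k(V) ≅ P^k(V) ⊗ D^k(V)` is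
identified with `Hom(P^k(V), P^k(V))` by letting operators act on `P^k(V)` (so that `f ∂` becomes
`u ↦ ∂(u) f`, where `∂(u)` is the pairing of `D^k(V)` with `P^k(V)`), and
`P^k(V) = ⨁ V_ν'` over `ν'` with `|ν'| = k`; the operator `D_ν` is the element of `PD^k(V)` that
corresponds to the identity of `V_ν`. -/
def IsCapelli (n : ℕ) (ν : ℕ × ℕ) (D : Module.End ℂ (SPoly n)) : Prop :=
  D ∈ polyDiffDeg n (ν.1 + ν.2) ∧
    (∀ u ∈ summand n ν, D u = u) ∧
    ∀ ν' ∈ starIndex n (ν.1 + ν.2), ν' ≠ ν → ∀ u ∈ summand n ν', D u = 0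

/-- The set `B_{d,n} = {C^{μ₂} Z^{μ₁-μ₂} : μ ∈ Λ_{d,n}}`. -/
def casimirSet (d n : ℕ) : Set (Env n) :=
  (fun μ : ℕ × ℕ => envC n ^ μ.2 * envZ n ^ (μ.1 - μ.2)) '' lambdaIndex d n

end CapelliOsp
end

/-! The partner of osp(1|2n) in Howe duality on P(V) is the sl(2) spanned by R², ∇² and a shift of
E. The Casimir element acts through it: `sum_ospOp_mul_ospOp` gives C = R²∇² − E² − (sdim V − 2)E
with sdim V = 1 − 2n, so C acts on R^{2j}H_m by the scalar m(2n+1−m).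

Invariant operators are controlled by the powers of y. The odd part of osp(1|2n) generates P^k(V)
from y^k (`degPart_le_of_odd_stable`), so an operator that commutes with g, possibly up to sign, is
determined in degree k by its value on y^k. This value is sp(2n)-invariant, hence a combination of
the vectors y^{k−2i}R'^i with i ≤ n, where R' is the part of the quadratic form in the odd variables
(`mem_span_of_invariant`). Moreover, an operator of order at most b that vanishes in degrees at most
b is zero (`eq_zero_of_orderLE`). So the operators of order at most b that commute with g embed,
through their values on y^0, …, y^b, into a space spanned by vectors indexed by the pairs (a,i) with
a + 2i ≤ b and i ≤ n. The same pairs index the operators C^iE^a, which have order at most b and are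
linearly independent: the leading term of C^i y^k is a nonzero multiple of y^{k−2i}R'^i when k ≥ 2n,
and E acts on y^k by k. Counting dimensions, these operators are all the even invariants
(`mem_casimirSpan`). An odd invariant would send y^k to an odd vector, but the sp(2n)-invariants are
even, so it is zero (`odd_eq_zero`).

The count also shows that every family of sp(2n)-invariant values on y^0, …, y^k is attained by a
combination of the C^iE^a (`span_invariantVector_le`). The eigenvalues m(2n+1−m) are distinct for m
of fixed parity, so a Lagrange polynomial in C projects P^k(V) onto V_ν. The combination with the
same value on y^k and value 0 on lower powers kills all lower degrees, hence lies in PD^k(V), and is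
the Capelli operator. Uniqueness holds because PD^k(V) acts faithfully on P^k(V) and the V_ν span
P^k(V).

Finally C is central already in the enveloping algebra, by invariance of the Casimir tensor
(`commute_casimir`), and central elements act by invariant operators. The operator arguments use
only the properties collected in `Fock`. -/

namespace CapelliOsp

/-! ### The parity involution -/

/-- The parity involution of `P(V)`. -/
noncomputable def parityOp (n : ℕ) : Module.End ℂ (SPoly n) :=
  LinearMap.lTensor ℂ[X]
    (CliffordAlgebra.involute (Q := (0 : QuadraticForm ℂ (OddIdx n → ℂ)))).toLinearMap

theorem spoly_neg_one_smul {n : ℕ} (u : SPoly n) : (-1 : ℂ) • u = -u := neg_one_smul ℂ u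

theorem spoly_eq_zero_of_eq_neg {n : ℕ} {u : SPoly n} (h : u = -u) : u = 0 := by
  have h2 : (2 : ℂ) • u = 0 := by
    rw [two_smul]
    exact add_eq_zero_iff_eq_neg.2 h
  exact (smul_eq_zero.1 h2).resolve_left two_ne_zero

theorem koszul_one_one : koszul 1 1 = -1 := by simp [koszul]

/-- A submodule of `P(V)` that contains `1` and is stable under multiplication by the coordinates
is everything. -/
theorem eq_top_of_mulOp {n : ℕ} (N : Submodule ℂ (SPoly n)) (h1 : 1 ∈ N)
    (hN : ∀ i, ∀ u ∈ N, mulOp i u ∈ N) : N = ⊤ := by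
  have hw : ∀ w : ExteriorAlgebra ℂ (OddIdx n → ℂ), (1 : ℂ[X]) ⊗ₜ[ℂ] w ∈ N := by
    intro w
    induction w using CliffordAlgebra.left_induction with
    | algebraMap r =>
      rw [Algebra.algebraMap_eq_smul_one, TensorProduct.tmul_smul]
      exact N.smul_mem _ h1
    | add x y hx hy => rw [TensorProduct.tmul_add]; exact N.add_mem hx hy
    | ι_mul x m hx =>
      have hm : m = ∑ j, m j • (Pi.single j 1 : OddIdx n → ℂ) := by
        ext k
        simp [Finset.sum_apply, Pi.single_apply]
      have hs : (1 : ℂ[X]) ⊗ₜ[ℂ] (CliffordAlgebra.ι 0 m * x) =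
          ∑ j, m j • mulOp (Sum.inr j) ((1 : ℂ[X]) ⊗ₜ[ℂ] x) := by
        conv_lhs => rw [hm]
        simp only [map_sum, map_smul, Finset.sum_mul, TensorProduct.tmul_sum, smul_mul_assoc,
          TensorProduct.tmul_smul, mulOp, coord, Sum.elim_inr, LinearMap.mulLeft_apply,
          Algebra.TensorProduct.tmul_mul_tmul, one_mul]
      rw [hs]
      exact N.sum_mem fun j _ => N.smul_mem _ (hN _ _ hx)
  have hp : ∀ (k : ℕ) (w : ExteriorAlgebra ℂ (OddIdx n → ℂ)),
      (Polynomial.X ^ k : ℂ[X]) ⊗ₜ[ℂ] w ∈ N := by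
    intro k w
    induction k with
    | zero => rw [pow_zero]; exact hw w
    | succ k ih =>
      have := hN (Sum.inl ()) _ ih
      simpa [mulOp, coord, pow_succ'] using this
  rw [eq_top_iff]
  rintro u -
  induction u using TensorProduct.induction_on with
  | zero => exact N.zero_mem
  | add x y hx hy => exact N.add_mem hx hy
  | tmul p w =>
    induction p using Polynomial.induction_on' with
    | add p q hp hq => rw [TensorProduct.add_tmul]; exact N.add_mem hp hq
    | monomial k a =>
      rw [← Polynomial.C_mul_X_pow_eq_monomial, ← Polynomial.smul_eq_C_mul,
        ← TensorProduct.smul_tmul']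
      exact N.smul_mem _ (hp k w)

/-- Two operators on `P(V)` with the same commutation rule with the coordinates agree as soon as
they agree on `1`. -/
theorem end_ext {n : ℕ} {S T : Module.End ℂ (SPoly n)} (h1 : S 1 = T 1)
    (h : ∀ i u, S u = T u → S (mulOp i u) = T (mulOp i u)) : S = T := by
  have := eq_top_of_mulOp (LinearMap.eqLocus S T) h1 h
  exact LinearMap.ext fun u => LinearMap.mem_eqLocus.1 (this ▸ Submodule.mem_top)

theorem parityOp_one {n : ℕ} : parityOp n 1 = 1 := by
  rw [Algebra.TensorProduct.one_def]
  simp [parityOp]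

theorem der_one {n : ℕ} (i : Idx n) : der i (1 : SPoly n) = 0 := by
  rw [Algebra.TensorProduct.one_def]
  rcases i with _ | i
  · simp [der]
  · simp only [der, Sum.elim_inr, LinearMap.lTensor_tmul]
    rw [CliffordAlgebra.contractLeft_one, TensorProduct.tmul_zero]

theorem parityOp_mulOp {n : ℕ} (i : Idx n) :
    parityOp n * mulOp i = koszul 1 (par i) • (mulOp i * parityOp n) := by
  refine TensorProduct.ext' fun f w => ?_
  rcases i with _ | i
  · simp [parityOp, mulOp, coord, koszul, par]
  · simp [parityOp, mulOp, coord, koszul, par, ExteriorAlgebra.ι, TensorProduct.tmul_neg]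

theorem parityOp_mulOp_apply {n : ℕ} (i : Idx n) (u : SPoly n) :
    parityOp n (mulOp i u) = koszul 1 (par i) • mulOp i (parityOp n u) :=
  LinearMap.congr_fun (parityOp_mulOp i) u

theorem der_mulOp_apply {n : ℕ} (j k : Idx n) (u : SPoly n) :
    der j (mulOp k u) = koszul (par j) (par k) • mulOp k (der j u) +
      (if j = k then 1 else 0 : ℂ) • u :=
  LinearMap.congr_fun (der_mulOp j k) u

theorem parityOp_der {n : ℕ} (i : Idx n) :
    parityOp n * der i = koszul 1 (par i) • (der i * parityOp n) := by
  refine end_ext ?_ fun k u hu => ?_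
  · simp [der_one, parityOp_one]
  · simp only [Module.End.mul_apply, LinearMap.smul_apply] at hu ⊢
    rw [parityOp_mulOp_apply, map_smul, der_mulOp_apply, der_mulOp_apply, map_add, map_smul,
      parityOp_mulOp_apply, hu]
    simp only [map_smul, smul_add, smul_smul]
    have h1 := koszul_mul_self 1 (par k)
    congr 1
    · congr 1; ring
    · split_ifs with h
      · subst h; rw [mul_one, h1]
      · simp

theorem parityOp_parityOp {n : ℕ} : parityOp n * parityOp n = 1 := by
  refine end_ext ?_ fun k u hu => ?_
  · simp [parityOp_one]
  · simp only [Module.End.mul_apply, Module.End.one_apply] at hu ⊢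
    rw [parityOp_mulOp_apply, map_smul, parityOp_mulOp_apply, hu, smul_smul, koszul_mul_self,
      one_smul]

theorem parityOp_eq_of_mem {n : ℕ} {p : ZMod 2} {u : SPoly n} (hu : u ∈ polyPart n p) :
    parityOp n u = koszul 1 p • u := by
  obtain ⟨v, rfl⟩ := hu
  induction v using TensorProduct.induction_on with
  | zero => simp
  | add x y hx hy => rw [map_add, map_add, hx, hy, smul_add]
  | tmul f w =>
    obtain ⟨w, hw⟩ := w
    rcases zmod_two_cases p with rfl | rfl
    · simp only [parityOp, LinearMap.lTensor_tmul, Submodule.subtype_apply, koszul_zero_right,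
        one_smul, AlgHom.toLinearMap_apply]
      rw [CliffordAlgebra.involute_eq_of_mem_even hw]
    · simp only [parityOp, LinearMap.lTensor_tmul, Submodule.subtype_apply, koszul_one_one,
        AlgHom.toLinearMap_apply]
      rw [CliffordAlgebra.involute_eq_of_mem_odd hw, TensorProduct.tmul_neg]
      exact (spoly_neg_one_smul _).symm

theorem polyPart_sup {n : ℕ} : polyPart n 0 ⊔ polyPart n 1 = ⊤ := by
  rw [eq_top_iff]
  rintro u -
  induction u using TensorProduct.induction_on with
  | zero => exact Submodule.zero_mem _
  | add x y hx hy => exact Submodule.add_mem _ hx hy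
  | tmul f w =>
    have hw : w ∈ CliffordAlgebra.evenOdd (0 : QuadraticForm ℂ (OddIdx n → ℂ)) 0 ⊔
        CliffordAlgebra.evenOdd (0 : QuadraticForm ℂ (OddIdx n → ℂ)) 1 := by
      rw [(CliffordAlgebra.evenOdd_isCompl _).sup_eq_top]
      exact Submodule.mem_top
    obtain ⟨a, ha, b, hb, rfl⟩ := Submodule.mem_sup.1 hw
    rw [TensorProduct.tmul_add]
    exact Submodule.add_mem_sup ⟨f ⊗ₜ ⟨a, ha⟩, rfl⟩ ⟨f ⊗ₜ ⟨b, hb⟩, rfl⟩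

/-- The homogeneous parts are the eigenspaces of the parity involution, so statements about parity
become commutation rules with `parityOp`. -/
theorem mem_polyPart_iff {n : ℕ} {p : ZMod 2} {u : SPoly n} :
    u ∈ polyPart n p ↔ parityOp n u = koszul 1 p • u := by
  refine ⟨parityOp_eq_of_mem, fun h => ?_⟩
  obtain ⟨a, ha, b, hb, rfl⟩ :=
    Submodule.mem_sup.1 (polyPart_sup (n := n) ▸ Submodule.mem_top : u ∈ _)
  rw [map_add, parityOp_eq_of_mem ha, parityOp_eq_of_mem hb, koszul_zero_right, one_smul,
    koszul_one_one] at h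
  rcases zmod_two_cases p with rfl | rfl
  · rw [koszul_zero_right, one_smul, add_right_inj, spoly_neg_one_smul] at h
    rwa [spoly_eq_zero_of_eq_neg h.symm, add_zero]
  · rw [koszul_one_one, spoly_neg_one_smul, spoly_neg_one_smul, neg_add, add_left_inj]
      at h
    rwa [spoly_eq_zero_of_eq_neg h, zero_add]

theorem mem_polyPart_of_parityOp_comm {n : ℕ} {p q : ZMod 2} {T : Module.End ℂ (SPoly n)}
    (hT : parityOp n * T = koszul 1 p • (T * parityOp n)) {u : SPoly n} (hu : u ∈ polyPart n q) :
    T u ∈ polyPart n (p + q) := by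
  rw [mem_polyPart_iff] at hu ⊢
  have := LinearMap.congr_fun hT u
  simp only [Module.End.mul_apply, LinearMap.smul_apply] at this
  rw [this, hu, map_smul, smul_smul, koszul_add_right]

theorem mulOp_mem_polyPart {n : ℕ} (i : Idx n) {q : ZMod 2} {u : SPoly n}
    (hu : u ∈ polyPart n q) : mulOp i u ∈ polyPart n (par i + q) :=
  mem_polyPart_of_parityOp_comm (parityOp_mulOp i) hu

theorem der_mem_polyPart {n : ℕ} (i : Idx n) {q : ZMod 2} {u : SPoly n}
    (hu : u ∈ polyPart n q) : der i u ∈ polyPart n (par i + q) :=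
  mem_polyPart_of_parityOp_comm (parityOp_der i) hu

/-! ### The Weyl superalgebra -/

/-- The relations of the Weyl superalgebra for coordinates `x` and derivations `d`. -/
structure WeylRel {n : ℕ} {A : Type*} [Ring A] [Algebra ℂ A] (x d : Idx n → A) : Prop where
  x_x : ∀ i k, x k * x i = koszul (par i) (par k) • (x i * x k)
  d_d : ∀ j l, d l * d j = koszul (par j) (par l) • (d j * d l)
  d_x : ∀ j k, d j * x k = koszul (par j) (par k) • (x k * d j) + (if j = k then 1 else 0 : ℂ) • 1

theorem weylRel (n : ℕ) : WeylRel (n := n) mulOp der := ⟨mulOp_mulOp, der_der, der_mulOp⟩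

section Weyl

variable {n : ℕ} {A : Type*} [Ring A] [Algebra ℂ A]

/-- The degree operator in the variables with index in `S`. -/
def eulerOn (x d : Idx n → A) (S : Finset (Idx n)) : A := ∑ i ∈ S, x i * d i

/-- The quadratic form `∑ B(e_i, e_{i'}) (-1)^{|i|} x_i x_{i'}` in the variables with index in `S`. -/
noncomputable def quadOn (x : Idx n → A) (S : Finset (Idx n)) : A :=
  ∑ i ∈ S, (koszul (par i) (par i) * dualSign i) • (x i * x (dualIdx i))

/-- The superdimension of the space with basis indexed by `S`. -/
noncomputable def sdimOn (S : Finset (Idx n)) : ℂ := ∑ i ∈ S, koszul (par i) (par i)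

/-- The sign in `F_{ij} = E_{ij} - θ_{ij} E_{j'i'}`. -/
noncomputable def ospSign (i j : Idx n) : ℂ :=
  koszul (par i + par j) (par j) * dualSign i * dualSign j

/-- The operator by which `F_{ij}` acts. -/
noncomputable def ospOp (x d : Idx n → A) (i j : Idx n) : A :=
  x i * d j - ospSign i j • (x (dualIdx j) * d (dualIdx i))

theorem sum_dualIdx_of_mem {M : Type*} [AddCommMonoid M] {S : Finset (Idx n)}
    (hS : ∀ i ∈ S, dualIdx i ∈ S) (f : Idx n → M) :
    ∑ i ∈ S, f (dualIdx i) = ∑ i ∈ S, f i :=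
  Finset.sum_nbij' dualIdx dualIdx hS hS (fun i _ => dualIdx_dualIdx i)
    (fun i _ => dualIdx_dualIdx i) fun _ _ => rfl

theorem one_add_one_zmod_two : (1 : ZMod 2) + 1 = 0 := by decide

theorem ospSign_sign (i j : Idx n) : koszul (par j) (par j) * (ospSign i j *
    ospSign (dualIdx i) (dualIdx j)) = koszul (par i) (par i) := by
  rcases i with _ | _ | _ <;> rcases j with _ | _ | _ <;>
    simp [ospSign, koszul, par, dualSign, dualIdx, one_add_one_zmod_two]

theorem ospSign_comm (i j : Idx n) : ospSign (dualIdx j) (dualIdx i) = ospSign i j := by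
  rcases i with _ | _ | _ <;> rcases j with _ | _ | _ <;>
    simp [ospSign, koszul, par, dualSign, dualIdx, one_add_one_zmod_two]

theorem ospSign_mul_self (i j : Idx n) : ospSign i j * ospSign i j = 1 := by
  rcases i with _ | _ | _ <;> rcases j with _ | _ | _ <;>
    simp [ospSign, koszul, par, dualSign, one_add_one_zmod_two]

/-- Reflects F = E − E^†: passing to the adjoint changes F by a sign. Each element of osp is thus
listed twice, up to sign, among the F_{ij}. -/
theorem ospOp_dualIdx (x d : Idx n → A) (i j : Idx n) :
    ospOp x d (dualIdx j) (dualIdx i) = -(ospSign i j • ospOp x d i j) := by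
  rw [ospOp, ospOp, ospSign_comm, dualIdx_dualIdx, dualIdx_dualIdx, smul_sub, smul_smul,
    ospSign_mul_self, one_smul, neg_sub]

variable {x d : Idx n → A} (h : WeylRel x d) {S : Finset (Idx n)}

include h

omit h in
theorem sum_ite_smul_eq {M : Type*} [AddCommMonoid M] [Module ℂ M] (S : Finset (Idx n))
    (k : Idx n) (f : Idx n → M) :
    ∑ i ∈ S, (if i = k then 1 else 0 : ℂ) • f i = if k ∈ S then f k else 0 := by
  simp [ite_smul]

/-- The set S is kept general: it is the set of all indices for osp(1|2n), the set of odd indices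
for sp(2n), and a singleton for the idempotents x_i d_i. -/
theorem eulerOn_mul_x (k : Idx n) :
    eulerOn x d S * x k = x k * eulerOn x d S + if k ∈ S then x k else 0 := by
  rw [eulerOn, ← sum_ite_smul_eq S k x, Finset.sum_mul, Finset.mul_sum, ← Finset.sum_add_distrib]
  refine Finset.sum_congr rfl fun i _ => ?_
  rw [mul_assoc, h.d_x, mul_add, mul_smul_comm, ← mul_assoc, h.x_x k i, smul_mul_assoc, smul_smul,
    koszul_comm (par i), koszul_mul_self, one_smul, mul_smul_comm, mul_one, mul_assoc]

theorem d_mul_eulerOn (k : Idx n) :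
    d k * eulerOn x d S = eulerOn x d S * d k + if k ∈ S then d k else 0 := by
  rw [eulerOn, ← sum_ite_smul_eq S k d, Finset.sum_mul, Finset.mul_sum, ← Finset.sum_add_distrib]
  refine Finset.sum_congr rfl fun i _ => ?_
  rw [← mul_assoc, h.d_x, add_mul, smul_mul_assoc, mul_assoc, h.d_d i k, mul_smul_comm, smul_smul,
    koszul_comm (par k), koszul_mul_self, one_smul, smul_mul_assoc, one_mul, mul_assoc]
  simp only [eq_comm]

theorem eulerOn_mul_quadOn (hS : ∀ i ∈ S, dualIdx i ∈ S) :
    eulerOn x d S * quadOn x S = quadOn x S * eulerOn x d S + (2 : ℂ) • quadOn x S := by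
  rw [quadOn, Finset.mul_sum, Finset.sum_mul, Finset.smul_sum, ← Finset.sum_add_distrib]
  refine Finset.sum_congr rfl fun i hi => ?_
  rw [mul_smul_comm, ← mul_assoc, eulerOn_mul_x h, if_pos hi, add_mul, mul_assoc,
    eulerOn_mul_x h, if_pos (hS i hi), mul_add, smul_mul_assoc, ← mul_assoc, two_smul]
  simp only [smul_add]
  abel

theorem quadOn_mul_eulerOn (hS : ∀ i ∈ S, dualIdx i ∈ S) :
    quadOn d S * eulerOn x d S = eulerOn x d S * quadOn d S + (2 : ℂ) • quadOn d S := by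
  rw [quadOn, Finset.mul_sum, Finset.sum_mul, Finset.smul_sum, ← Finset.sum_add_distrib]
  refine Finset.sum_congr rfl fun i hi => ?_
  rw [smul_mul_assoc, mul_assoc, d_mul_eulerOn h, if_pos (hS i hi), mul_add, ← mul_assoc,
    d_mul_eulerOn h, if_pos hi, add_mul, mul_smul_comm, ← mul_assoc, two_smul]
  simp only [smul_add]
  abel

/-- The variable x_j occurs in the summands i = j and i = j'; supersymmetry of the form makes their
derivatives equal, whence the factor 2. -/
theorem d_mul_quadOn (hS : ∀ i ∈ S, dualIdx i ∈ S) (j : Idx n) :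
    d j * quadOn x S = quadOn x S * d j +
      if j ∈ S then (2 * (koszul (par j) (par j) * dualSign j)) • x (dualIdx j) else 0 := by
  have e : ∀ i, d j * (x i * x (dualIdx i)) = x i * x (dualIdx i) * d j +
      ((if i = j then 1 else 0 : ℂ) • x (dualIdx i) + (if i = dualIdx j then 1 else 0 : ℂ) •
        (koszul (par j) (par i) • x i)) := by
    intro i
    rw [← mul_assoc, h.d_x, add_mul, smul_mul_assoc, mul_assoc, h.d_x, par_dualIdx, mul_add,
      mul_smul_comm, smul_add, smul_smul, koszul_mul_self, one_smul, smul_mul_assoc, one_mul,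
      mul_smul_comm, mul_one, smul_comm, mul_assoc]
    have e1 : (j = dualIdx i) = (i = dualIdx j) := propext (by rw [eq_comm, dualIdx_eq_iff])
    have e2 : (j = i) = (i = j) := propext eq_comm
    simp only [e1, e2]
    abel
  have e2 : ∀ i, (koszul (par i) (par i) * dualSign i) • (d j * (x i * x (dualIdx i))) =
      (koszul (par i) (par i) * dualSign i) • (x i * x (dualIdx i)) * d j +
      ((if i = j then 1 else 0 : ℂ) • ((koszul (par i) (par i) * dualSign i) • x (dualIdx i)) +
       (if i = dualIdx j then 1 else 0 : ℂ) •
        ((koszul (par i) (par i) * dualSign i * koszul (par j) (par i)) • x i)) := by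
    intro i
    rw [e, smul_add, smul_add, smul_mul_assoc, smul_comm _ (ite _ _ _ : ℂ),
      smul_comm _ (ite _ _ _ : ℂ), smul_smul (_ * _)]
  rw [quadOn, Finset.mul_sum, Finset.sum_mul]
  simp only [mul_smul_comm, e2]
  rw [Finset.sum_add_distrib, Finset.sum_add_distrib, sum_ite_smul_eq S j,
    sum_ite_smul_eq S (dualIdx j)]
  congr 1
  by_cases hj : j ∈ S
  · rw [if_pos hj, if_pos hj, if_pos (hS j hj), ← add_smul, par_dualIdx, dualSign_dualIdx]
    congr 1
    linear_combination (koszul (par j) (par j) * dualSign j) * koszul_mul_self (par j) (par j)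
  · have : dualIdx j ∉ S := fun h' => hj (dualIdx_dualIdx j ▸ hS _ h')
    rw [if_neg hj, if_neg hj, if_neg this, add_zero]

/-- With the two preceding commutators with the degree operator, this is the sl(2) relation: the
commutator is 4(E + sdim/2). -/
theorem quadOn_mul_quadOn (hS : ∀ i ∈ S, dualIdx i ∈ S) :
    quadOn d S * quadOn x S = quadOn x S * quadOn d S + (4 : ℂ) • eulerOn x d S +
      (2 * sdimOn S) • 1 := by
  have e : ∀ i ∈ S, (koszul (par i) (par i) * dualSign i) • (d i * d (dualIdx i)) * quadOn x S =
      quadOn x S * ((koszul (par i) (par i) * dualSign i) • (d i * d (dualIdx i))) +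
      ((2 : ℂ) • (x (dualIdx i) * d (dualIdx i)) + (2 : ℂ) • (x i * d i) +
        (2 * koszul (par i) (par i)) • 1) := by
    intro i hi
    rw [smul_mul_assoc, mul_assoc, d_mul_quadOn h hS, if_pos (hS i hi), par_dualIdx,
      dualIdx_dualIdx, mul_add, ← mul_assoc, d_mul_quadOn h hS, if_pos hi, add_mul, mul_smul_comm,
      h.d_x, if_pos rfl, mul_smul_comm, dualSign_dualIdx, mul_assoc]
    simp only [smul_add, smul_smul, smul_mul_assoc, one_smul]
    have k1 := koszul_mul_self (par i) (par i)
    have k2 := dualSign_mul_self i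
    rw [add_assoc, add_assoc]
    congr 2
    · congr 1
      linear_combination (2 * (koszul (par i) (par i) * koszul (par i) (par i))) * k2 + 2 * k1
    congr 1
    · congr 1
      linear_combination (2 * (koszul (par i) (par i) * koszul (par i) (par i) *
        (koszul (par i) (par i) * koszul (par i) (par i)))) * k2 +
        (2 * (koszul (par i) (par i) * koszul (par i) (par i)) + 2) * k1
    · congr 1
      linear_combination (2 * (koszul (par i) (par i) * koszul (par i) (par i) *
        (koszul (par i) (par i)))) * k2 + (2 * koszul (par i) (par i)) * k1
  rw [quadOn, Finset.sum_mul, Finset.sum_congr rfl e, Finset.sum_add_distrib,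
    Finset.sum_add_distrib, Finset.sum_add_distrib, ← Finset.mul_sum, ← Finset.smul_sum,
    sum_dualIdx_of_mem hS (fun i => x i * d i), ← Finset.smul_sum, ← Finset.sum_smul,
    ← Finset.mul_sum, ← add_smul, ← add_assoc]
  rw [show (2 : ℂ) + 2 = 4 by norm_num]
  rfl

/-- The Casimir tensor of the orthosymplectic algebra acts through the dual pair `sl(2)`. -/
theorem sum_ospOp_mul_ospOp (hS : ∀ i ∈ S, dualIdx i ∈ S) :
    -(1 / 2 : ℂ) • ∑ i ∈ S, ∑ j ∈ S, koszul (par j) (par j) • (ospOp x d i j * ospOp x d j i) =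
      quadOn x S * quadOn d S - eulerOn x d S * eulerOn x d S -
        (sdimOn S - 2) • eulerOn x d S := by
  -- Reindexing by (i,j) ↦ (j',i') and applying `ospOp_dualIdx` to the second factor shows that the
  -- two terms of F_{ij} contribute equally to the Casimir sum.
  have s1 : ∑ i ∈ S, ∑ j ∈ S, koszul (par j) (par j) •
      (ospSign i j • (x (dualIdx j) * d (dualIdx i)) * ospOp x d j i) =
      -∑ i ∈ S, ∑ j ∈ S, koszul (par j) (par j) • (x i * d j * ospOp x d j i) := by
    rw [Finset.sum_comm, ← sum_dualIdx_of_mem hS, ← Finset.sum_neg_distrib]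
    refine Finset.sum_congr rfl fun i _ => ?_
    rw [← sum_dualIdx_of_mem hS, ← Finset.sum_neg_distrib]
    refine Finset.sum_congr rfl fun j _ => ?_
    have e := ospOp_dualIdx x d j i
    rw [e, dualIdx_dualIdx, dualIdx_dualIdx, smul_mul_assoc, mul_neg, mul_smul_comm, smul_neg,
      smul_neg, smul_smul, smul_smul, par_dualIdx]
    have := ospSign_sign j i
    rw [mul_assoc, mul_comm (ospSign (dualIdx j) (dualIdx i)), this]
  have s2 : ∑ i ∈ S, ∑ j ∈ S, koszul (par j) (par j) • (ospOp x d i j * ospOp x d j i) =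
      (2 : ℂ) • ∑ i ∈ S, ∑ j ∈ S, koszul (par j) (par j) • (x i * d j * ospOp x d j i) := by
    have : ∀ i j, koszul (par j) (par j) • (ospOp x d i j * ospOp x d j i) =
        koszul (par j) (par j) • (x i * d j * ospOp x d j i) - koszul (par j) (par j) •
      (ospSign i j • (x (dualIdx j) * d (dualIdx i)) * ospOp x d j i) := by
      intro i j
      conv_lhs => rw [ospOp, sub_mul, smul_sub]
    simp only [this, Finset.sum_sub_distrib]
    rw [s1, sub_neg_eq_add, two_smul]
  -- The part coming from gl: normal ordering leaves E² − E, and the contractions d_j x_j add up to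
  -- the superdimension.
  have s3 : ∑ i ∈ S, ∑ j ∈ S, koszul (par j) (par j) • (x i * d j * (x j * d i)) =
      eulerOn x d S * eulerOn x d S - eulerOn x d S + sdimOn S • eulerOn x d S := by
    have e1 : ∀ i j, koszul (par j) (par j) • (x i * d j * (x j * d i)) =
        x i * (x j * d j * d i) + koszul (par j) (par j) • (x i * d i) := by
      intro i j
      rw [mul_assoc, ← mul_assoc (d j), h.d_x, if_pos rfl, one_smul, add_mul, mul_add, smul_add,
        smul_mul_assoc, mul_smul_comm, smul_smul, koszul_mul_self, one_smul, one_mul]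
    simp only [e1, Finset.sum_add_distrib]
    congr 1
    · have e2 : ∀ i ∈ S, ∑ j ∈ S, x i * (x j * d j * d i) =
          x i * d i * eulerOn x d S - x i * d i := by
        intro i hi
        rw [← Finset.mul_sum, ← Finset.sum_mul, mul_assoc, d_mul_eulerOn h, if_pos hi, mul_add,
          add_sub_cancel_right]
        rfl
      rw [Finset.sum_congr rfl e2, Finset.sum_sub_distrib, ← Finset.sum_mul]
      rfl
    · rw [Finset.sum_comm, sdimOn, Finset.sum_smul]
      refine Finset.sum_congr rfl fun j _ => ?_
      rw [← Finset.smul_sum]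
      rfl
  -- The adjoint part: after normal ordering the signs factor into one depending on i and one
  -- depending on j, which gives the product of the two quadratic forms; the contractions j = i'
  -- give E.
  have s4 : ∑ i ∈ S, ∑ j ∈ S, koszul (par j) (par j) •
      (x i * d j * (ospSign j i • (x (dualIdx i) * d (dualIdx j)))) =
      quadOn x S * quadOn d S + eulerOn x d S := by
    have e1 : ∀ i j, koszul (par j) (par j) •
        (x i * d j * (ospSign j i • (x (dualIdx i) * d (dualIdx j)))) =
        ((koszul (par i) (par i) * dualSign i) • (x i * x (dualIdx i))) *
          ((koszul (par j) (par j) * dualSign j) • (d j * d (dualIdx j))) +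
        (if j = dualIdx i then 1 else 0 : ℂ) • (x i * d (dualIdx j)) := by
      intro i j
      rw [mul_smul_comm, mul_assoc, ← mul_assoc (d j), h.d_x, par_dualIdx, add_mul, mul_add,
        smul_mul_assoc, mul_smul_comm, smul_mul_assoc, one_mul, mul_smul_comm, smul_add, smul_add,
        smul_mul_smul_comm]
      simp only [smul_smul, ← mul_assoc]
      congr 1
      · congr 1
        rcases i with _ | _ | _ <;> rcases j with _ | _ | _ <;>
          simp [ospSign, koszul, par, dualSign, one_add_one_zmod_two]
      · by_cases hj : j = dualIdx i
        · subst hj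
          congr 1
          rcases i with _ | _ | _ <;>
            simp [ospSign, koszul, par, dualSign, dualIdx, one_add_one_zmod_two]
        · simp [hj]
    simp only [e1, Finset.sum_add_distrib]
    congr 1
    · rw [quadOn, quadOn, Finset.sum_mul_sum]
    · refine Finset.sum_congr rfl fun i hi => ?_
      rw [sum_ite_smul_eq S (dualIdx i) (fun j => x i * d (dualIdx j)), if_pos (hS i hi),
        dualIdx_dualIdx]
  have s5 : ∑ i ∈ S, ∑ j ∈ S, koszul (par j) (par j) • (x i * d j * ospOp x d j i) =
      (eulerOn x d S * eulerOn x d S - eulerOn x d S + sdimOn S • eulerOn x d S) -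
        (quadOn x S * quadOn d S + eulerOn x d S) := by
    rw [← s3, ← s4, ← Finset.sum_sub_distrib]
    refine Finset.sum_congr rfl fun i _ => ?_
    rw [← Finset.sum_sub_distrib]
    refine Finset.sum_congr rfl fun j _ => ?_
    rw [ospOp, mul_sub, smul_sub]
  rw [s2, s5, smul_smul, sub_smul, two_smul ℂ (eulerOn x d S)]
  norm_num
  abel

end Weyl

/-! ### Fock representations of the Weyl superalgebra -/

/-- A faithful representation of the Weyl superalgebra on `P`, generated by a vacuum vector `v`,
with a parity involution `σ` and an operator `ρ` that sets the even variable to zero. -/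
structure Fock {n : ℕ} {A P : Type*} [Ring A] [Algebra ℂ A] [AddCommGroup P] [Module ℂ P]
    [Module A P] (x d : Idx n → A) (σ ρ : A) (v : P) : Prop extends WeylRel x d where
  σ_x : ∀ i, σ * x i = koszul 1 (par i) • (x i * σ)
  σ_d : ∀ i, σ * d i = koszul 1 (par i) • (d i * σ)
  σ_σ : σ * σ = 1
  σ_v : σ • v = v
  d_v : ∀ i, d i • v = 0
  ρ_y : ρ * x (Sum.inl ()) = 0
  ρ_x : ∀ j, ρ * x (Sum.inr j) = x (Sum.inr j) * ρ
  d_ρ : d (Sum.inl ()) * ρ = 0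
  ρ_d : ∀ j, ρ * d (Sum.inr j) = d (Sum.inr j) * ρ
  ρ_v : ρ • v = v
  v_ne : v ≠ 0
  gen : ∀ N : Submodule ℂ P, v ∈ N → (∀ i, ∀ u ∈ N, x i • u ∈ N) → N = ⊤
  faithful : ∀ T : A, (∀ u : P, T • u = 0) → T = 0

/-! ### Order of differential operators and the degree filtration. -/

section Order

variable {n : ℕ} {A P : Type*} [Ring A] [Algebra ℂ A] [AddCommGroup P] [Module ℂ P]
  [Module A P] [IsScalarTower ℂ A P]

/-- The span of a family of operators. -/
abbrev linSpan (x : Idx n → A) : Submodule ℂ A := Submodule.span ℂ (Set.range x)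

/-- The algebra of multiplications by superpolynomials. -/
abbrev multiplications (x : Idx n → A) : Submodule ℂ A :=
  Subalgebra.toSubmodule (Algebra.adjoin ℂ (Set.range x))

/-- The differential operators of order at most `b`. -/
noncomputable def orderLE (x d : Idx n → A) (b : ℕ) : Submodule ℂ A :=
  multiplications x * (1 ⊔ linSpan d) ^ b

/-- The vectors of degree `k` in a Fock representation with vacuum `v`. -/
noncomputable def degPart (x : Idx n → A) (v : P) : ℕ → Submodule ℂ P
  | 0 => Submodule.span ℂ {v}
  | k + 1 => ⨆ i, (degPart x v k).map (Algebra.lsmul ℂ ℂ P (x i))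

/-- Conjugation by the `p`-th power of the parity involution. -/
noncomputable def parityConj (σ : A) (p : ZMod 2) : A →ₗ[ℂ] A :=
  if p = 1 then LinearMap.mulLeft ℂ σ ∘ₗ LinearMap.mulRight ℂ σ else LinearMap.id

/-- The super commutator `T x_i - (-1)^{|T||x_i|} x_i T`. -/
noncomputable def coordComm (σ : A) (x : Idx n → A) (i : Idx n) : A →ₗ[ℂ] A :=
  LinearMap.mulRight ℂ (x i) - LinearMap.mulLeft ℂ (x i) ∘ₗ parityConj σ (par i)

theorem parityConj_zero (σ T : A) : parityConj σ 0 T = T := by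
  simp [parityConj]

theorem parityConj_one (σ T : A) : parityConj σ 1 T = σ * T * σ := by
  simp [parityConj, mul_assoc]

variable {x d : Idx n → A} {σ ρ : A} {v : P}

theorem smul_mem_degPart {k : ℕ} (i : Idx n) {u : P} (hu : u ∈ degPart x v k) :
    x i • u ∈ degPart x v (k + 1) :=
  Submodule.mem_iSup_of_mem i ⟨u, hu, rfl⟩

theorem vacuum_mem_degPart : v ∈ degPart x v 0 := Submodule.mem_span_singleton_self v

/-- Induction on the degree. -/
theorem degPart_le (N : ℕ → Submodule ℂ P) (h0 : v ∈ N 0)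
    (hN : ∀ k, ∀ u ∈ degPart x v k, u ∈ N k → ∀ i, x i • u ∈ N (k + 1)) (k : ℕ) :
    degPart x v k ≤ N k := by
  induction k with
  | zero => exact (Submodule.span_singleton_le_iff_mem _ _).2 h0
  | succ k ih =>
    refine iSup_le fun i => ?_
    rw [Submodule.map_le_iff_le_comap]
    exact fun u hu => hN k u hu (ih hu) i

namespace Fock

variable (h : Fock x d σ ρ v)

include h

omit [IsScalarTower ℂ A P] in
theorem parityConj_mul (p : ZMod 2) (S T : A) :
    parityConj σ p (S * T) = parityConj σ p S * parityConj σ p T := by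
  rcases zmod_two_cases p with rfl | rfl
  · simp only [parityConj_zero]
  · have : σ * S * σ * (σ * T * σ) = σ * S * (σ * σ) * T * σ := by simp only [mul_assoc]
    rw [parityConj_one, parityConj_one, parityConj_one, this, h.σ_σ, mul_one]
    simp only [mul_assoc]

omit [IsScalarTower ℂ A P] in
theorem parityConj_id (p : ZMod 2) : parityConj σ p (1 : A) = 1 := by
  rcases zmod_two_cases p with rfl | rfl
  · rw [parityConj_zero]
  · rw [parityConj_one, mul_one, h.σ_σ]

omit [IsScalarTower ℂ A P] in
theorem parityConj_of_comm (p q : ZMod 2) {T : A} (hT : σ * T = koszul 1 q • (T * σ)) :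
    parityConj σ p T = koszul p q • T := by
  rcases zmod_two_cases p with rfl | rfl
  · rw [parityConj_zero, koszul_zero_left, one_smul]
  · rw [parityConj_one, hT, smul_mul_assoc, mul_assoc, h.σ_σ, mul_one]

omit [IsScalarTower ℂ A P] in
-- The super commutator with x_i is a skew derivation. Since `parityConj` inserts the sign on each
-- homogeneous component, no homogeneity of the operators is needed.
theorem coordComm_mul (i : Idx n) (S T : A) :
    coordComm σ x i (S * T) = S * coordComm σ x i T +
      coordComm σ x i S * parityConj σ (par i) T := by
  simp only [coordComm, LinearMap.sub_apply, LinearMap.mulRight_apply, LinearMap.comp_apply,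
    LinearMap.mulLeft_apply, h.parityConj_mul, mul_sub, sub_mul, mul_assoc]
  abel

omit [IsScalarTower ℂ A P] in
theorem coordComm_one (i : Idx n) : coordComm σ x i (1 : A) = 0 := by
  simp [coordComm, h.parityConj_id]

omit [IsScalarTower ℂ A P] in
theorem coordComm_x (i k : Idx n) : coordComm σ x i (x k) = 0 := by
  simp [coordComm, h.parityConj_of_comm _ _ (h.σ_x k), h.x_x i k]

omit [IsScalarTower ℂ A P] in
theorem coordComm_d (i j : Idx n) :
    coordComm σ x i (d j) = (if j = i then 1 else 0 : ℂ) • 1 := by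
  simp only [coordComm, LinearMap.sub_apply, LinearMap.mulRight_apply, LinearMap.comp_apply,
    LinearMap.mulLeft_apply, h.parityConj_of_comm _ _ (h.σ_d j), h.d_x, mul_smul_comm,
    koszul_comm (par i), add_sub_cancel_left]

omit [IsScalarTower ℂ A P] in
theorem coordComm_multiplications (i : Idx n) {T : A} (hT : T ∈ multiplications x) :
    coordComm σ x i T = 0 := by
  have hT : T ∈ Algebra.adjoin ℂ (Set.range x) := hT
  induction hT using Algebra.adjoin_induction with
  | mem y hy => obtain ⟨k, rfl⟩ := hy; exact h.coordComm_x i k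
  | algebraMap r => rw [Algebra.algebraMap_eq_smul_one, map_smul, h.coordComm_one, smul_zero]
  | add a b _ _ ha hb => rw [map_add, ha ‹_›, hb ‹_›, add_zero]
  | mul a b ha' hb' ha hb => rw [h.coordComm_mul, ha ha', hb hb', mul_zero, zero_mul, add_zero]

omit [IsScalarTower ℂ A P] in
theorem parityConj_mem_pow {D : Submodule ℂ A} (hD : ∀ p, ∀ T ∈ D, parityConj σ p T ∈ D)
    (p : ZMod 2) (b : ℕ) : ∀ T ∈ D ^ b, parityConj σ p T ∈ D ^ b := by
  induction b with
  | zero =>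
    intro T hT
    rw [pow_zero, Submodule.mem_one] at hT ⊢
    obtain ⟨c, rfl⟩ := hT
    refine ⟨c, ?_⟩
    rw [Algebra.algebraMap_eq_smul_one, map_smul, h.parityConj_id]
  | succ b ih =>
    intro T hT
    rw [pow_succ'] at hT ⊢
    induction hT using Submodule.mul_induction_on' with
    | mem_mul_mem S hS T hT =>
      rw [h.parityConj_mul]
      exact Submodule.mul_mem_mul (hD p S hS) (ih T hT)
    | add x _ y _ hx hy => rw [map_add]; exact Submodule.add_mem _ hx hy

omit [IsScalarTower ℂ A P] in
-- By the Leibniz rule one factor is contracted to a scalar. It serves for D the span of the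
-- derivations (bidegree) and for D the same span with the constants added (order).
theorem coordComm_mem_pow {D : Submodule ℂ A} (hD : ∀ p, ∀ T ∈ D, parityConj σ p T ∈ D)
    (i : Idx n) (hi : ∀ T ∈ D, coordComm σ x i T ∈ (1 : Submodule ℂ A)) (b : ℕ) :
    ∀ T ∈ D ^ (b + 1), coordComm σ x i T ∈ D ^ b := by
  induction b with
  | zero => intro T hT; rw [zero_add, pow_one] at hT; rw [pow_zero]; exact hi T hT
  | succ b ih =>
    intro T hT
    rw [pow_succ'] at hT
    induction hT using Submodule.mul_induction_on' with
    | mem_mul_mem S hS T hT =>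
      rw [h.coordComm_mul]
      refine Submodule.add_mem _ ?_ ?_
      · rw [pow_succ']
        exact Submodule.mul_mem_mul hS (ih T hT)
      · have := Submodule.mul_mem_mul (hi S hS) (h.parityConj_mem_pow hD (par i) _ T hT)
        rwa [one_mul] at this
    | add x _ y _ hx hy => rw [map_add]; exact Submodule.add_mem _ hx hy

omit [IsScalarTower ℂ A P] in
theorem parityConj_mem_linSpan (p : ZMod 2) :
    ∀ T ∈ linSpan d, parityConj σ p T ∈ linSpan d := by
  intro T hT
  refine (Submodule.span_le (p := (linSpan d).comap (parityConj σ p))).2 ?_ hT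
  rintro _ ⟨j, rfl⟩
  change parityConj σ p (d j) ∈ linSpan d
  rw [h.parityConj_of_comm _ _ (h.σ_d j)]
  exact Submodule.smul_mem _ _ (Submodule.subset_span ⟨j, rfl⟩)

omit [IsScalarTower ℂ A P] in
theorem coordComm_mem_linSpan (i : Idx n) :
    ∀ T ∈ linSpan d, coordComm σ x i T ∈ (1 : Submodule ℂ A) := by
  intro T hT
  refine (Submodule.span_le (p := (1 : Submodule ℂ A).comap (coordComm σ x i))).2 ?_ hT
  rintro _ ⟨j, rfl⟩
  change coordComm σ x i (d j) ∈ (1 : Submodule ℂ A)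
  rw [h.coordComm_d]
  exact Submodule.smul_mem _ _ (Submodule.mem_one.2 ⟨1, map_one _⟩)

omit [IsScalarTower ℂ A P] in
theorem parityConj_mem_one_sup (p : ZMod 2) :
    ∀ T ∈ 1 ⊔ linSpan d, parityConj σ p T ∈ 1 ⊔ linSpan d := by
  intro T hT
  obtain ⟨a, ha, b, hb, rfl⟩ := Submodule.mem_sup.1 hT
  rw [map_add]
  refine Submodule.add_mem_sup ?_ (h.parityConj_mem_linSpan p b hb)
  obtain ⟨c, rfl⟩ := Submodule.mem_one.1 ha
  refine Submodule.mem_one.2 ⟨c, ?_⟩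
  rw [Algebra.algebraMap_eq_smul_one, map_smul, h.parityConj_id]

omit [IsScalarTower ℂ A P] in
theorem coordComm_mem_one_sup (i : Idx n) :
    ∀ T ∈ 1 ⊔ linSpan d, coordComm σ x i T ∈ (1 : Submodule ℂ A) := by
  intro T hT
  obtain ⟨a, ha, b, hb, rfl⟩ := Submodule.mem_sup.1 hT
  obtain ⟨c, rfl⟩ := Submodule.mem_one.1 ha
  rw [map_add, Algebra.algebraMap_eq_smul_one, map_smul, h.coordComm_one, smul_zero, zero_add]
  exact h.coordComm_mem_linSpan i b hb

omit [IsScalarTower ℂ A P] in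
-- This drop of the order by one drives the induction in `eq_zero_of_orderLE`: multiplications super
-- commute with x_i, so only the derivations are affected.
theorem coordComm_mem_orderLE (i : Idx n) (b : ℕ) :
    ∀ T ∈ orderLE x d (b + 1), coordComm σ x i T ∈ orderLE x d b := by
  intro T hT
  induction hT using Submodule.mul_induction_on' with
  | mem_mul_mem S hS T hT =>
    rw [h.coordComm_mul, h.coordComm_multiplications i hS, zero_mul, add_zero]
    exact Submodule.mul_mem_mul hS
      (h.coordComm_mem_pow h.parityConj_mem_one_sup i (h.coordComm_mem_one_sup i) b T hT)
  | add x _ y _ hx hy => rw [map_add]; exact Submodule.add_mem _ hx hy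

theorem σ_x_smul (i : Idx n) (u : P) : σ • x i • u = koszul 1 (par i) • x i • σ • u := by
  rw [← mul_smul, h.σ_x, smul_assoc, mul_smul]

omit [IsScalarTower ℂ A P] in
theorem σ_σ_smul (u : P) : σ • σ • u = u := by
  rw [← mul_smul, h.σ_σ, one_smul]

theorem d_x_smul (j k : Idx n) (u : P) : d j • x k • u =
    koszul (par j) (par k) • x k • d j • u + (if j = k then 1 else 0 : ℂ) • u := by
  rw [← mul_smul, h.d_x, add_smul, smul_assoc, smul_assoc, one_smul, mul_smul]

theorem σ_mem_degPart {k : ℕ} {u : P} (hu : u ∈ degPart x v k) : σ • u ∈ degPart x v k := by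
  refine degPart_le (fun k => (degPart x v k).comap (Algebra.lsmul ℂ ℂ P σ)) ?_ ?_ k hu
  · change σ • v ∈ degPart x v 0
    rw [h.σ_v]
    exact vacuum_mem_degPart
  · intro k u _ hu i
    change σ • u ∈ degPart x v k at hu
    change σ • x i • u ∈ degPart x v (k + 1)
    rw [h.σ_x_smul]
    exact Submodule.smul_mem _ _ (smul_mem_degPart i hu)

/-- Such an operator can be moved past every coordinate down to the vacuum, which generates P. -/
theorem eq_zero_of_coordComm {T : A} (h1 : T • v = 0) (hT : ∀ i, coordComm σ x i T = 0) :
    T = 0 := by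
  have hi : ∀ i (u : P), T • x i • u = x i • parityConj σ (par i) T • u := fun i u => by
    have : T * x i = x i * parityConj σ (par i) T := sub_eq_zero.1 (hT i)
    rw [← mul_smul, this, mul_smul]
  have h0 : ∀ i (u : P), T • u = 0 → T • σ • u = 0 → T • x i • u = 0 := by
    intro i u hu hu'
    rw [hi]
    rcases zmod_two_cases (par i) with hp | hp
    · rw [hp, parityConj_zero, hu, smul_zero]
    · rw [hp, parityConj_one, mul_smul, mul_smul, hu', smul_zero, smul_zero]
  -- Passing an odd coordinate turns T into σTσ, so the kernel of T alone need not be visibly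
  -- stable; its intersection with the kernel of Tσ is.
  have := h.gen (LinearMap.ker (Algebra.lsmul ℂ ℂ P T) ⊓ LinearMap.ker (Algebra.lsmul ℂ ℂ P (T * σ)))
    (by
      constructor
      · exact h1
      · change (T * σ) • v = 0
        rw [mul_smul, h.σ_v, h1])
    (by
      rintro i u ⟨hu, hu'⟩
      change T • u = 0 at hu
      change (T * σ) • u = 0 at hu'
      rw [mul_smul] at hu'
      refine ⟨h0 i u hu hu', ?_⟩
      change (T * σ) • x i • u = 0
      rw [mul_smul, h.σ_x_smul, ← algebraMap_smul A, ← mul_smul, ← Algebra.commutes, mul_smul,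
        h0 i _ hu' (by rw [h.σ_σ_smul, hu]), smul_zero])
  refine h.faithful T fun u => ?_
  have hu : u ∈ LinearMap.ker (Algebra.lsmul ℂ ℂ P T) ⊓ LinearMap.ker (Algebra.lsmul ℂ ℂ P (T * σ)) := by
    rw [this]; exact Submodule.mem_top
  exact hu.1

/-- A differential operator of order at most `b` that vanishes on the vectors of degree at most
`b` is zero. -/
theorem eq_zero_of_orderLE (b : ℕ) : ∀ T ∈ orderLE x d b,
    (∀ j ≤ b, ∀ u ∈ degPart x v j, T • u = 0) → T = 0 := by
  induction b with
  | zero =>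
    intro T hT hv
    rw [orderLE, pow_zero, mul_one] at hT
    exact h.eq_zero_of_coordComm (hv 0 le_rfl v vacuum_mem_degPart)
      fun i => h.coordComm_multiplications i hT
  | succ b ih =>
    intro T hT hv
    -- The super commutator with x_i has order at most b, and it kills degrees at most b because T
    -- kills degrees at most b + 1.
    refine h.eq_zero_of_coordComm (hv 0 (Nat.zero_le _) v vacuum_mem_degPart) fun i => ?_
    refine ih _ (h.coordComm_mem_orderLE i b T hT) fun j hj u hu => ?_
    change (T * x i - x i * parityConj σ (par i) T) • u = 0
    rw [sub_smul, mul_smul, mul_smul, hv (j + 1) (by omega) _ (smul_mem_degPart i hu)]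
    have : parityConj σ (par i) T • u = 0 := by
      rcases zmod_two_cases (par i) with hp | hp
      · rw [hp, parityConj_zero, hv j (by omega) u hu]
      · rw [hp, parityConj_one, mul_smul, mul_smul, hv j (by omega) _ (h.σ_mem_degPart hu),
          smul_zero]
    rw [this, smul_zero, sub_zero]

end Fock

theorem multiplications_mul : multiplications x * multiplications x ≤ multiplications x :=
  Submodule.mul_le.2 fun _ hS _ hT => (Algebra.adjoin ℂ (Set.range x)).mul_mem hS hT

theorem one_mem_multiplications : (1 : A) ∈ multiplications x :=
  (Algebra.adjoin ℂ (Set.range x)).one_mem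

theorem x_mem_multiplications (i : Idx n) : x i ∈ multiplications x :=
  Algebra.subset_adjoin ⟨i, rfl⟩

theorem orderLE_mono {a b : ℕ} (hab : a ≤ b) : orderLE x d a ≤ orderLE x d b :=
  mul_le_mul' le_rfl (pow_le_pow_right' le_sup_left hab)

theorem multiplications_le_orderLE (b : ℕ) : multiplications x ≤ orderLE x d b := by
  refine le_trans ?_ (orderLE_mono (Nat.zero_le b))
  rw [orderLE, pow_zero, mul_one]

theorem mul_mem_orderLE {b : ℕ} {S T : A} (hS : S ∈ multiplications x)
    (hT : T ∈ orderLE x d b) : S * T ∈ orderLE x d b := by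
  have := Submodule.mul_mem_mul hS hT
  rw [orderLE, ← mul_assoc] at this
  exact mul_le_mul' multiplications_mul le_rfl this

theorem one_sup_le_orderLE : 1 ⊔ linSpan d ≤ orderLE x d 1 := by
  intro T hT
  have := Submodule.mul_mem_mul (one_mem_multiplications (x := x)) hT
  rwa [one_mul, ← pow_one (1 ⊔ linSpan d)] at this

theorem WeylRel.one_sup_mul_mem (h : WeylRel x d) {T : A} (hT : T ∈ multiplications x) :
    ∀ D ∈ 1 ⊔ linSpan d, D * T ∈ orderLE x d 1 := by
  have hT : T ∈ Algebra.adjoin ℂ (Set.range x) := hT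
  induction hT using Algebra.adjoin_induction with
  | mem y hy =>
    obtain ⟨k, rfl⟩ := hy
    intro D hD
    obtain ⟨a, ha, b, hb, rfl⟩ := Submodule.mem_sup.1 hD
    rw [add_mul]
    refine Submodule.add_mem _ ?_ ?_
    · obtain ⟨c, rfl⟩ := Submodule.mem_one.1 ha
      rw [Algebra.algebraMap_eq_smul_one, smul_mul_assoc, one_mul]
      exact Submodule.smul_mem _ _ (multiplications_le_orderLE 1 (x_mem_multiplications k))
    · refine (Submodule.span_le (p := (orderLE x d 1).comap (LinearMap.mulRight ℂ (x k)))).2 ?_ hb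
      rintro _ ⟨j, rfl⟩
      change d j * x k ∈ orderLE x d 1
      rw [h.d_x]
      refine Submodule.add_mem _ (Submodule.smul_mem _ _ ?_) (Submodule.smul_mem _ _ ?_)
      · exact mul_mem_orderLE (x_mem_multiplications k)
          (one_sup_le_orderLE (Submodule.mem_sup_right (Submodule.subset_span ⟨j, rfl⟩)))
      · exact multiplications_le_orderLE 1 one_mem_multiplications
  | algebraMap r =>
    intro D hD
    rw [← Algebra.commutes, ← Algebra.smul_def]
    exact Submodule.smul_mem _ _ (one_sup_le_orderLE hD)
  | add a b _ _ ha hb =>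
    intro D hD
    rw [mul_add]
    exact Submodule.add_mem _ (ha ‹_› D hD) (hb ‹_› D hD)
  | mul a b ha' hb' ha hb =>
    intro D hD
    have h1 := ha ha' D hD
    rw [← mul_assoc]
    rw [orderLE, pow_one] at h1
    generalize D * a = c at h1 ⊢
    induction h1 using Submodule.mul_induction_on' with
    | mem_mul_mem S hS E hE =>
      rw [mul_assoc]
      exact mul_mem_orderLE hS (hb hb' E hE)
    | add x _ y _ hx hy => rw [add_mul]; exact Submodule.add_mem _ hx hy

/-- Normal ordering: moving derivations to the right of multiplications never increases their
number. -/
theorem WeylRel.pow_mul_multiplications (h : WeylRel x d) (b : ℕ) :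
    (1 ⊔ linSpan d) ^ b * multiplications x ≤ orderLE x d b := by
  induction b with
  | zero => rw [orderLE, pow_zero, mul_one, one_mul]
  | succ b ih =>
    have h1 : (1 ⊔ linSpan d) * multiplications x ≤ orderLE x d 1 :=
      Submodule.mul_le.2 fun D hD T hT => h.one_sup_mul_mem hT D hD
    calc _ = (1 ⊔ linSpan d) ^ b * ((1 ⊔ linSpan d) * multiplications x) := by
            rw [pow_succ, mul_assoc]
      _ ≤ (1 ⊔ linSpan d) ^ b * orderLE x d 1 := mul_le_mul' le_rfl h1
      _ = (1 ⊔ linSpan d) ^ b * multiplications x * (1 ⊔ linSpan d) := by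
            rw [orderLE, pow_one, mul_assoc]
      _ ≤ orderLE x d b * (1 ⊔ linSpan d) := mul_le_mul' ih le_rfl
      _ = orderLE x d (b + 1) := by rw [orderLE, orderLE, pow_succ, mul_assoc]

theorem WeylRel.orderLE_mul (h : WeylRel x d) (a b : ℕ) :
    orderLE x d a * orderLE x d b ≤ orderLE x d (a + b) := by
  calc orderLE x d a * orderLE x d b = multiplications x *
        ((1 ⊔ linSpan d) ^ a * multiplications x) * (1 ⊔ linSpan d) ^ b := by
        rw [orderLE, orderLE]; simp only [mul_assoc]
    _ ≤ multiplications x * orderLE x d a * (1 ⊔ linSpan d) ^ b :=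
        mul_le_mul' (mul_le_mul' le_rfl (h.pow_mul_multiplications a)) le_rfl
    _ = multiplications x * multiplications x * (1 ⊔ linSpan d) ^ (a + b) := by
        rw [orderLE, pow_add]; simp only [mul_assoc]
    _ ≤ orderLE x d (a + b) := mul_le_mul' multiplications_mul le_rfl

theorem WeylRel.exists_mem_orderLE (h : WeylRel x d) {T : A}
    (hT : T ∈ Algebra.adjoin ℂ (Set.range x ∪ Set.range d)) : ∃ b, T ∈ orderLE x d b := by
  induction hT using Algebra.adjoin_induction with
  | mem y hy =>
    rcases hy with ⟨i, rfl⟩ | ⟨i, rfl⟩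
    · exact ⟨0, multiplications_le_orderLE 0 (x_mem_multiplications i)⟩
    · exact ⟨1, one_sup_le_orderLE (Submodule.mem_sup_right (Submodule.subset_span ⟨i, rfl⟩))⟩
  | algebraMap r =>
    refine ⟨0, ?_⟩
    rw [Algebra.algebraMap_eq_smul_one]
    exact Submodule.smul_mem _ _ (multiplications_le_orderLE 0 one_mem_multiplications)
  | add x y _ _ hx hy =>
    obtain ⟨a, ha⟩ := hx
    obtain ⟨b, hb⟩ := hy
    exact ⟨max a b, Submodule.add_mem _ (orderLE_mono (le_max_left _ _) ha)
      (orderLE_mono (le_max_right _ _) hb)⟩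
  | mul x y _ _ hx hy =>
    obtain ⟨a, ha⟩ := hx
    obtain ⟨b, hb⟩ := hy
    exact ⟨a + b, h.orderLE_mul a b (Submodule.mul_mem_mul ha hb)⟩

/-! ### The operators of bidegree `(k, k)` -/

theorem linSpan_le_multiplications : linSpan x ≤ multiplications x :=
  Algebra.span_le_adjoin _ _

theorem pow_linSpan_le_multiplications (k : ℕ) : linSpan x ^ k ≤ multiplications x := by
  induction k with
  | zero =>
    rw [pow_zero, Submodule.one_le]
    exact one_mem_multiplications
  | succ k ih =>
    rw [pow_succ]
    exact (mul_le_mul' ih linSpan_le_multiplications).trans multiplications_mul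

/-- The operators of bidegree `(k, k)`. -/
noncomputable def bideg (x d : Idx n → A) (k : ℕ) : Submodule ℂ A := linSpan x ^ k * linSpan d ^ k

theorem bideg_le_orderLE {k : ℕ} : bideg x d k ≤ orderLE x d k :=
  mul_le_mul' (pow_linSpan_le_multiplications k) (pow_le_pow_left' le_sup_right k)

namespace Fock

variable (h : Fock x d σ ρ v)

include h

theorem d_degPart_zero (j : Idx n) {u : P} (hu : u ∈ degPart x v 0) : d j • u = 0 := by
  obtain ⟨c, rfl⟩ := Submodule.mem_span_singleton.1 hu
  rw [← algebraMap_smul A, ← mul_smul, ← Algebra.commutes, mul_smul, h.d_v, smul_zero]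

theorem d_degPart (j : Idx n) (k : ℕ) :
    ∀ u ∈ degPart x v (k + 1), d j • u ∈ degPart x v k := by
  -- Degree −1 has to be read as zero, since k − 1 is truncated; the case distinction makes the
  -- induction start.
  have hk : ∀ k, degPart x v k ≤ ((if k = 0 then ⊥ else degPart x v (k - 1) :
      Submodule ℂ P)).comap (Algebra.lsmul ℂ ℂ P (d j)) := by
    refine degPart_le _ ?_ ?_
    · change d j • v ∈ (if 0 = 0 then ⊥ else degPart x v (0 - 1) : Submodule ℂ P)
      rw [h.d_v]
      exact Submodule.zero_mem _
    · intro k u hu hu' i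
      change d j • u ∈ (if k = 0 then ⊥ else degPart x v (k - 1) : Submodule ℂ P) at hu'
      change d j • x i • u ∈ (if k + 1 = 0 then ⊥ else degPart x v (k + 1 - 1) : Submodule ℂ P)
      rw [if_neg (Nat.succ_ne_zero k), Nat.add_sub_cancel, h.d_x_smul]
      refine Submodule.add_mem _ (Submodule.smul_mem _ _ ?_) (Submodule.smul_mem _ _ hu)
      rcases k with _ | k
      · rw [if_pos rfl, Submodule.mem_bot] at hu'
        rw [hu', smul_zero]
        exact Submodule.zero_mem _
      · rw [if_neg (Nat.succ_ne_zero k), Nat.add_sub_cancel] at hu'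
        exact smul_mem_degPart i hu'
  intro u hu
  have := hk (k + 1) hu
  rwa [Submodule.mem_comap, if_neg (Nat.succ_ne_zero k)] at this

theorem pow_linSpan_eq_zero (k : ℕ) : ∀ T ∈ linSpan d ^ k, ∀ j < k, ∀ u ∈ degPart x v j,
    T • u = 0 := by
  induction k with
  | zero => intro T _ j hj; omega
  | succ k ih =>
    intro T hT
    rw [pow_succ] at hT
    induction hT using Submodule.mul_induction_on' with
    | mem_mul_mem S hS T hT =>
      intro j hj u hu
      refine (Submodule.span_le (p := LinearMap.ker
        ((Algebra.lsmul ℂ ℂ P).toLinearMap.flip u ∘ₗ LinearMap.mulLeft ℂ S))).2 ?_ hT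
      rintro _ ⟨i, rfl⟩
      change (S * d i) • u = 0
      rw [mul_smul]
      rcases j with _ | j
      · rw [h.d_degPart_zero i hu, smul_zero]
      · exact ih S hS j (by omega) _ (h.d_degPart i j u hu)
    | add x _ y _ hx hy =>
      intro j hj u hu
      rw [add_smul, hx j hj u hu, hy j hj u hu, add_zero]

theorem bideg_eq_zero {k : ℕ} : ∀ T ∈ bideg x d k, ∀ j < k, ∀ u ∈ degPart x v j,
    T • u = 0 := by
  intro T hT j hj u hu
  induction hT using Submodule.mul_induction_on' with
  | mem_mul_mem S hS T hT =>
    rw [mul_smul, h.pow_linSpan_eq_zero k T hT j hj u hu, smul_zero]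
  | add x _ y _ hx hy => rw [add_smul, hx, hy, add_zero]

/-- The operators of bidegree `(k, k)` act faithfully in degree `k`. -/
theorem eq_zero_of_bideg {k : ℕ} {T : A} (hT : T ∈ bideg x d k)
    (hv : ∀ u ∈ degPart x v k, T • u = 0) : T = 0 := by
  refine h.eq_zero_of_orderLE k T (bideg_le_orderLE hT) fun j hj u hu => ?_
  rcases hj.lt_or_eq with hj | rfl
  · exact h.bideg_eq_zero T hT j hj u hu
  · exact hv u hu

end Fock

/-- The sum of the spaces of operators of bidegree `(k, k)` for `k ≤ d`. -/
noncomputable def bidegLE (x d : Idx n → A) (r : ℕ) : Submodule ℂ A :=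
  ⨆ k : Fin (r + 1), bideg x d k

theorem bideg_le_bidegLE {k r : ℕ} (hk : k ≤ r) : bideg x d k ≤ bidegLE x d r :=
  le_iSup (fun k : Fin (r + 1) => bideg x d k) ⟨k, by omega⟩

theorem bidegLE_mono {r s : ℕ} (hr : r ≤ s) : bidegLE x d r ≤ bidegLE x d s :=
  iSup_le fun k => bideg_le_bidegLE (by omega)

theorem bidegLE_le_orderLE {r : ℕ} : bidegLE x d r ≤ orderLE x d r :=
  iSup_le fun k => bideg_le_orderLE.trans (orderLE_mono (by omega))

theorem bidegLE_succ {r : ℕ} : bidegLE x d (r + 1) ≤ bidegLE x d r ⊔ bideg x d (r + 1) := by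
  refine iSup_le fun k => ?_
  rcases Nat.lt_or_ge k.1 (r + 1) with hk | hk
  · exact (bideg_le_bidegLE (by omega)).trans le_sup_left
  · have : k.1 = r + 1 := by omega
    rw [this]
    exact le_sup_right

namespace Fock

variable (h : Fock x d σ ρ v)

include h

/-- The component of bidegree (r, r) kills all degrees below r anyway. The remainder has order below
r and vanishes in degrees below r, hence is zero. This is how Capelli operators are recognized as
elements of PD^r(V). -/
theorem mem_bideg_of_eq_zero {r : ℕ} {T : A} (hT : T ∈ bidegLE x d r)
    (hv : ∀ j < r, ∀ u ∈ degPart x v j, T • u = 0) : T ∈ bideg x d r := by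
  rcases r with _ | r
  · have : bidegLE x d 0 ≤ bideg x d 0 := iSup_le fun k => by
      have : k.1 = 0 := by omega
      rw [this]
    exact this hT
  · obtain ⟨a, ha, b, hb, rfl⟩ := Submodule.mem_sup.1 (bidegLE_succ hT)
    have : a = 0 := by
      refine h.eq_zero_of_orderLE r a (bidegLE_le_orderLE ha) fun j hj u hu => ?_
      have h1 := hv j (by omega) u hu
      rwa [add_smul, h.bideg_eq_zero b hb j (by omega) u hu, add_zero] at h1
    rwa [this, zero_add]

omit [IsScalarTower ℂ A P] in
-- Moving x_i to the left of the derivations in T gives a term of bidegree k + 1; the commutator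
-- term has lost one derivation and regains it from d_j, so it has bidegree k.
theorem bideg_mul_x_d {k : ℕ} (i j : Idx n) {T : A} (hT : T ∈ bideg x d k) :
    T * (x i * d j) ∈ bidegLE x d (k + 1) := by
  induction hT using Submodule.mul_induction_on' with
  | mem_mul_mem f hf T hT =>
    have h1 : f * T * (x i * d j) = f * x i * (parityConj σ (par i) T * d j) +
          f * (coordComm σ x i T * d j) := by
      simp only [coordComm, LinearMap.sub_apply, LinearMap.mulRight_apply, LinearMap.comp_apply,
        LinearMap.mulLeft_apply, sub_mul, mul_sub, mul_assoc]
      abel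
    rw [h1]
    have hj : d j ∈ linSpan d := Submodule.subset_span ⟨j, rfl⟩
    refine Submodule.add_mem _ (bideg_le_bidegLE le_rfl ?_) ?_
    · refine Submodule.mul_mem_mul ?_ ?_
      · rw [pow_succ]
        exact Submodule.mul_mem_mul hf (Submodule.subset_span ⟨i, rfl⟩)
      · rw [pow_succ]
        exact Submodule.mul_mem_mul (h.parityConj_mem_pow h.parityConj_mem_linSpan _ _ T hT) hj
    · rcases k with _ | k
      · rw [pow_zero, Submodule.mem_one] at hT
        obtain ⟨c, rfl⟩ := hT
        rw [Algebra.algebraMap_eq_smul_one, map_smul, h.coordComm_one, smul_zero, zero_mul,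
          mul_zero]
        exact Submodule.zero_mem _
      · refine bideg_le_bidegLE (Nat.le_succ _) (Submodule.mul_mem_mul hf ?_)
        rw [pow_succ]
        exact Submodule.mul_mem_mul
          (h.coordComm_mem_pow h.parityConj_mem_linSpan i (h.coordComm_mem_linSpan i) k T hT) hj
  | add x _ y _ hx hy => rw [add_mul]; exact Submodule.add_mem _ hx hy

omit [IsScalarTower ℂ A P] in
/-- Products of `r` operators `x_i ∂_j` are sums of operators of bidegree `(k, k)`, `k ≤ r`. -/
theorem pow_le_bidegLE (r : ℕ) :
    Submodule.span ℂ (Set.range fun p : Idx n × Idx n => x p.1 * d p.2) ^ r ≤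
      bidegLE x d r := by
  induction r with
  | zero =>
    rw [pow_zero, Submodule.one_le]
    refine bideg_le_bidegLE le_rfl ?_
    rw [bideg, pow_zero, pow_zero, mul_one]
    exact Submodule.mem_one.2 ⟨1, map_one _⟩
  | succ r ih =>
    rw [pow_succ, Submodule.mul_le]
    intro T hT S hS
    have hT := ih hT
    refine (Submodule.span_le (p := (bidegLE x d (r + 1)).comap (LinearMap.mulLeft ℂ T))).2 ?_ hS
    rintro _ ⟨⟨i, j⟩, rfl⟩
    have : bidegLE x d r ≤ (bidegLE x d (r + 1)).comap (LinearMap.mulRight ℂ (x i * d j)) :=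
      iSup_le fun k T hT => bidegLE_mono (by omega) (h.bideg_mul_x_d i j hT)
    exact this hT

end Fock

end Order

/-! ### Eigenvectors of commuting idempotents -/

/-- A sum of N commuting idempotents has eigenvalues only among 0, …, N. For an r-eigenvector u, the
vector e_j u is an eigenvector of the remaining sum for r − 1, hence zero by induction; then u
itself is an r-eigenvector of the remaining sum. -/
theorem eq_zero_of_sum_idempotent {ι A P : Type*} [DecidableEq ι] [Ring A] [Algebra ℂ A]
    [AddCommGroup P] [Module ℂ P] [Module A P] [IsScalarTower ℂ A P] (e : ι → A)
    (he : ∀ i, e i * e i = e i) (hc : ∀ i j, e i * e j = e j * e i) (S : Finset ι) :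
    ∀ (r : ℂ) (u : P), (∑ i ∈ S, e i) • u = r • u → (∀ m ≤ S.card, r ≠ m) → u = 0 := by
  induction S using Finset.induction_on with
  | empty =>
    intro r u hu hr
    rw [Finset.sum_empty, zero_smul, eq_comm, smul_eq_zero] at hu
    exact hu.resolve_left fun h0 => hr 0 (Nat.zero_le _) (by simpa using h0)
  | insert j S hj ih =>
    intro r u hu hr
    rw [Finset.card_insert_of_notMem hj] at hr
    rw [Finset.sum_insert hj, add_smul] at hu
    have hcomm : (∑ i ∈ S, e i) * e j = e j * ∑ i ∈ S, e i := by
      rw [Finset.sum_mul, Finset.mul_sum]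
      exact Finset.sum_congr rfl fun i _ => hc i j
    have h1 : e j • u = 0 := by
      refine ih (r - 1) _ ?_ ?_
      · have := congrArg (e j • ·) hu
        simp only [smul_add] at this
        rw [← mul_smul, he, ← mul_smul (e j), ← hcomm, mul_smul, smul_comm (e j) r] at this
        rw [sub_smul, one_smul, ← this, add_sub_cancel_left]
      · intro m hm h
        exact hr (m + 1) (by omega) (by rw [sub_eq_iff_eq_add] at h; rw [h]; push_cast; ring)
    rw [h1, zero_add] at hu
    exact ih r u hu fun m hm => hr m (by omega)

/-- The last operator kills all but the last vector, which isolates the last coefficient of a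
relation. -/
theorem eq_zero_of_triangular {A P : Type*} [Ring A] [Algebra ℂ A]
    [AddCommGroup P] [Module ℂ P] [Module A P] [IsScalarTower ℂ A P] (w : ℕ → P) (T : ℕ → A)
    (N : ℕ) (h0 : ∀ i < N, ∀ l < i, T i • w l = 0) (h1 : ∀ i < N, T i • w i ≠ 0) (q : ℕ → ℂ)
    (hq : ∑ i ∈ Finset.range N, q i • w i = 0) : ∀ i < N, q i = 0 := by
  induction N with
  | zero => intro i hi; omega
  | succ N ih =>
    rw [Finset.sum_range_succ] at hq
    have h2 : q N = 0 := by
      have := congrArg (T N • ·) hq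
      simp only [smul_add, smul_zero, Finset.smul_sum] at this
      rw [Finset.sum_eq_zero, zero_add, smul_comm, smul_eq_zero] at this
      · exact this.resolve_right (h1 N (Nat.lt_succ_self N))
      · intro l hl
        rw [smul_comm, h0 N (Nat.lt_succ_self N) l (Finset.mem_range.1 hl), smul_zero]
    rw [h2, zero_smul, add_zero] at hq
    intro i hi
    rcases (Nat.lt_succ_iff.1 hi).lt_or_eq with h | rfl
    · exact ih (fun i hi => h0 i (by omega)) (fun i hi => h1 i (by omega)) hq i h
    · exact h2

/-! ### The odd variables and the invariants of sp(2n). -/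

section Fock

/-- The indices of the odd variables. -/
def oddIdx (n : ℕ) : Finset (Idx n) := Finset.univ.map ⟨Sum.inr, Sum.inr_injective⟩

theorem mem_oddIdx {n : ℕ} {i : Idx n} : i ∈ oddIdx n ↔ ∃ j, Sum.inr j = i := by
  simp [oddIdx]

theorem inl_notMem_oddIdx {n : ℕ} : (Sum.inl () : Idx n) ∉ oddIdx n := by
  simp [oddIdx]

theorem dualIdx_mem_oddIdx {n : ℕ} : ∀ i ∈ oddIdx n, dualIdx i ∈ oddIdx n := by
  intro i hi
  obtain ⟨j, rfl⟩ := mem_oddIdx.1 hi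
  exact mem_oddIdx.2 ⟨j.swap, rfl⟩

theorem univ_eq_cons {n : ℕ} :
    (Finset.univ : Finset (Idx n)) = Finset.cons (Sum.inl ()) (oddIdx n) inl_notMem_oddIdx := by
  ext i
  rcases i with _ | i
  · simp
  · simp [oddIdx]

theorem sdimOn_oddIdx {n : ℕ} : sdimOn (oddIdx n) = -(2 * n) := by
  simp [sdimOn, oddIdx, koszul, par]
  ring

theorem sdimOn_univ {n : ℕ} : sdimOn (Finset.univ : Finset (Idx n)) = 1 - 2 * n := by
  rw [sdimOn, univ_eq_cons, Finset.sum_cons]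
  have := sdimOn_oddIdx (n := n)
  rw [sdimOn] at this
  rw [this]
  simp [par, koszul]
  ring

variable {n : ℕ} {A P : Type*} [Ring A] [Algebra ℂ A] [AddCommGroup P] [Module ℂ P]
  [Module A P] [IsScalarTower ℂ A P] {x d : Idx n → A} {σ ρ : A} {v : P}

section Weyl

variable (h : WeylRel x d)

omit [Algebra ℂ A] in
theorem eulerOn_univ : eulerOn x d Finset.univ =
    x (Sum.inl ()) * d (Sum.inl ()) + eulerOn x d (oddIdx n) := by
  rw [eulerOn, univ_eq_cons, Finset.sum_cons]
  rfl

theorem quadOn_univ (x : Idx n → A) : quadOn x Finset.univ =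
    x (Sum.inl ()) * x (Sum.inl ()) + quadOn x (oddIdx n) := by
  rw [quadOn, univ_eq_cons, Finset.sum_cons]
  simp [dualIdx, dualSign, koszul, par, quadOn]

omit [Algebra ℂ A] in
theorem commute_eulerOn {z : A} (hx : ∀ j, Commute z (x (Sum.inr j)))
    (hd : ∀ j, Commute z (d (Sum.inr j))) : Commute z (eulerOn x d (oddIdx n)) := by
  refine Commute.sum_right _ _ _ fun i hi => ?_
  obtain ⟨j, rfl⟩ := mem_oddIdx.1 hi
  exact (hx j).mul_right (hd j)

theorem commute_quadOn {z : A} (hx : ∀ j, Commute z (x (Sum.inr j))) :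
    Commute z (quadOn x (oddIdx n)) := by
  refine Commute.sum_right _ _ _ fun i hi => ?_
  obtain ⟨j, rfl⟩ := mem_oddIdx.1 hi
  exact ((hx j).mul_right (hx j.swap)).smul_right _

include h

theorem WeylRel.commute_y_x (j : OddIdx n) : Commute (x (Sum.inl ())) (x (Sum.inr j)) := by
  have := h.x_x (Sum.inr j) (Sum.inl ())
  exact (by simpa [koszul, par] using this : _ * _ = _ * _)

theorem WeylRel.commute_y_d (j : OddIdx n) : Commute (x (Sum.inl ())) (d (Sum.inr j)) := by
  have := h.d_x (Sum.inr j) (Sum.inl ())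
  simp [koszul, par] at this
  exact this.symm

theorem WeylRel.commute_dy_d (j : OddIdx n) : Commute (d (Sum.inl ())) (d (Sum.inr j)) := by
  have := h.d_d (Sum.inr j) (Sum.inl ())
  exact (by simpa [koszul, par] using this : _ * _ = _ * _)

theorem WeylRel.commute_dy_x (j : OddIdx n) : Commute (d (Sum.inl ())) (x (Sum.inr j)) := by
  have := h.d_x (Sum.inl ()) (Sum.inr j)
  exact (by simpa [koszul, par] using this : _ * _ = _ * _)

theorem WeylRel.dy_y : d (Sum.inl ()) * x (Sum.inl ()) = x (Sum.inl ()) * d (Sum.inl ()) + 1 := by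
  have := h.d_x (Sum.inl ()) (Sum.inl ())
  simpa [koszul, par] using this

theorem WeylRel.dy_y_pow (a : ℕ) : d (Sum.inl ()) * x (Sum.inl ()) ^ a =
    x (Sum.inl ()) ^ a * d (Sum.inl ()) + (a : ℂ) • x (Sum.inl ()) ^ (a - 1) := by
  induction a with
  | zero => simp
  | succ a ih =>
    rw [pow_succ, ← mul_assoc, ih, add_mul, mul_assoc, h.dy_y, mul_add, mul_one, mul_assoc,
      add_assoc, Nat.add_sub_cancel]
    congr 1
    rcases a with _ | a
    · simp
    · rw [Nat.add_sub_cancel, smul_mul_assoc, ← pow_succ]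
      push_cast
      module

theorem WeylRel.idempotent (j : OddIdx n) : x (Sum.inr j) * d (Sum.inr j) *
    (x (Sum.inr j) * d (Sum.inr j)) = x (Sum.inr j) * d (Sum.inr j) := by
  have h1 := h.d_x (Sum.inr j) (Sum.inr j)
  have h2 := h.d_d (Sum.inr j) (Sum.inr j)
  have h3 : d (Sum.inr j) * d (Sum.inr j) = 0 := by
    simp only [koszul, par, Sum.elim_inr, and_self, if_true, neg_smul, one_smul] at h2
    have h4 : (2 : ℂ) • (d (Sum.inr j) * d (Sum.inr j)) = 0 := by
      rw [two_smul]
      nth_rewrite 1 [h2]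
      exact neg_add_cancel _
    exact (smul_eq_zero.1 h4).resolve_left two_ne_zero
  rw [mul_assoc, ← mul_assoc (d (Sum.inr j)), h1, if_pos rfl, one_smul, add_mul, smul_mul_assoc,
    mul_assoc (x (Sum.inr j)), h3, mul_zero, smul_zero, zero_add, one_mul]

theorem WeylRel.idempotent_comm (i j : OddIdx n) : x (Sum.inr i) * d (Sum.inr i) *
    (x (Sum.inr j) * d (Sum.inr j)) = x (Sum.inr j) * d (Sum.inr j) *
    (x (Sum.inr i) * d (Sum.inr i)) := by
  by_cases hij : i = j
  · rw [hij]
  have e1 : eulerOn x d {Sum.inr i} * x (Sum.inr j) = x (Sum.inr j) * eulerOn x d {Sum.inr i} := by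
    rw [eulerOn_mul_x h, if_neg, add_zero]
    simpa using Ne.symm hij
  have e2 : d (Sum.inr j) * eulerOn x d {Sum.inr i} = eulerOn x d {Sum.inr i} * d (Sum.inr j) := by
    rw [d_mul_eulerOn h, if_neg, add_zero]
    simpa using Ne.symm hij
  simp only [eulerOn, Finset.sum_singleton] at e1 e2
  rw [← mul_assoc, e1, mul_assoc, ← e2, mul_assoc]

/-- The degree in the odd variables is one of `0, …, 2n`. -/
theorem WeylRel.eq_zero_of_eulerOn {r : ℂ} {u : P} (hu : eulerOn x d (oddIdx n) • u = r • u)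
    (hr : ∀ m ≤ 2 * n, r ≠ m) : u = 0 := by
  refine eq_zero_of_sum_idempotent (fun j : OddIdx n => x (Sum.inr j) * d (Sum.inr j))
    h.idempotent h.idempotent_comm Finset.univ r u ?_ ?_
  · rw [← hu, eulerOn, oddIdx, Finset.sum_map]
    rfl
  · intro m hm
    refine hr m (hm.trans ?_)
    simp [two_mul]

end Weyl

namespace Fock

variable (h : Fock x d σ ρ v)

include h

omit [IsScalarTower ℂ A P] in
theorem commute_ρ_x (j : OddIdx n) : Commute ρ (x (Sum.inr j)) := h.ρ_x j

omit [IsScalarTower ℂ A P] in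
theorem commute_ρ_d (j : OddIdx n) : Commute ρ (d (Sum.inr j)) := h.ρ_d j

theorem euler_degPart (k : ℕ) : ∀ u ∈ degPart x v k,
    eulerOn x d Finset.univ • u = (k : ℂ) • u := by
  intro u hu
  refine degPart_le (fun k => Module.End.eigenspace
    (Algebra.lsmul ℂ ℂ P (eulerOn x d Finset.univ)) (k : ℂ)) ?_ ?_ k hu |> fun h' =>
      Module.End.mem_eigenspace_iff.1 h'
  · rw [Module.End.mem_eigenspace_iff]
    change eulerOn x d Finset.univ • v = _
    rw [eulerOn, Finset.sum_smul, Nat.cast_zero, zero_smul]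
    exact Finset.sum_eq_zero fun i _ => by rw [mul_smul, h.d_v, smul_zero]
  · intro k u _ hu i
    rw [Module.End.mem_eigenspace_iff] at hu ⊢
    change eulerOn x d Finset.univ • u = _ at hu
    change eulerOn x d Finset.univ • x i • u = _
    rw [← mul_smul, eulerOn_mul_x h.toWeylRel, if_pos (Finset.mem_univ i), add_smul, mul_smul, hu,
      smul_comm, Nat.cast_succ, add_smul, one_smul]

/-- P is the sum of its degree parts, which lie in eigenspaces of E for distinct eigenvalues, and
eigenspaces are independent. -/
theorem mem_span_of_euler {u : P} (hu : eulerOn x d Finset.univ • u = 0) :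
    u ∈ Submodule.span ℂ {v} := by
  have htop : ⨆ k, degPart x v k = ⊤ := by
    refine h.gen _ (Submodule.mem_iSup_of_mem 0 vacuum_mem_degPart) fun i u hu => ?_
    have : ⨆ k, degPart x v k ≤ (⨆ k, degPart x v k).comap (Algebra.lsmul ℂ ℂ P (x i)) :=
      iSup_le fun k u hu => Submodule.mem_iSup_of_mem (k + 1) (smul_mem_degPart i hu)
    exact this hu
  set T := Algebra.lsmul ℂ ℂ P (eulerOn x d Finset.univ)
  have hle : ⨆ k, degPart x v k ≤ degPart x v 0 ⊔ ⨆ r, ⨆ (_ : r ≠ (0 : ℂ)), T.eigenspace r := by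
    refine iSup_le fun k => ?_
    rcases k with _ | k
    · exact le_sup_left
    · refine le_trans ?_ le_sup_right
      refine le_iSup₂_of_le ((k + 1 : ℕ) : ℂ) (by exact_mod_cast Nat.succ_ne_zero k) ?_
      intro u hu
      exact Module.End.mem_eigenspace_iff.2 (h.euler_degPart _ u hu)
  obtain ⟨a, ha, b, hb, rfl⟩ := Submodule.mem_sup.1 (hle (htop ▸ Submodule.mem_top : u ∈ _))
  have hb0 : b ∈ T.eigenspace 0 := by
    rw [Module.End.mem_eigenspace_iff]
    have h1 := h.euler_degPart 0 a ha
    change eulerOn x d Finset.univ • b = _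
    rw [Nat.cast_zero, zero_smul] at h1
    rw [smul_add, h1, zero_add] at hu
    rw [hu, zero_smul]
  have := Submodule.disjoint_def.1 (T.eigenspaces_iSupIndep 0) b hb0 hb
  rw [this, add_zero]
  exact ha

/-- Vectors killed by the Casimir element of `sp(2n)` in the odd variables. -/
theorem odd_invariant (r : ℕ) : ∀ u : P, ρ • u = u →
    eulerOn x d (oddIdx n) • u = (r : ℂ) • u →
    quadOn x (oddIdx n) • quadOn d (oddIdx n) • u = ((r : ℂ) * (r - 2 * n - 2)) • u →
    u = 0 ∨ ∃ i ≤ n, r = 2 * i ∧ ∃ c : ℂ, u = c • quadOn x (oddIdx n) ^ i • v := by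
  induction r using Nat.strong_induction_on with
  | _ r ih =>
  intro u hρ hE hK
  set R := quadOn x (oddIdx n) with hR
  set L := quadOn d (oddIdx n) with hL
  set E := eulerOn x d (oddIdx n) with hE'
  -- There are only 2n odd variables. For r ≤ 2n the factor r − 2n − 2 is nonzero, so for r > 0 the
  -- vector u is recovered from R L u, and the induction goes from r to r − 2.
  by_cases hr : 2 * n < r
  · left
    refine h.eq_zero_of_eulerOn hE fun m hm h' => ?_
    have : r = m := by exact_mod_cast h'
    omega
  have hEL : E • L • u = ((r : ℂ) - 2) • L • u := by
    have := congrArg (· • u) (quadOn_mul_eulerOn h.toWeylRel (S := oddIdx n) dualIdx_mem_oddIdx)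
    simp only [add_smul, mul_smul, smul_assoc] at this
    rw [← hL, ← hE', hE, smul_comm] at this
    rw [sub_smul, this, add_sub_cancel_right]
  have hfac : (r : ℂ) ≠ 0 → ((r : ℂ) * (r - 2 * n - 2)) ≠ 0 := by
    intro hr0
    refine mul_ne_zero hr0 fun h' => ?_
    have h2 : (r : ℂ) = ((2 * n + 2 : ℕ) : ℂ) := by push_cast; linear_combination h'
    have : r = 2 * n + 2 := by exact_mod_cast h2
    omega
  rcases Nat.lt_or_ge r 2 with hr2 | hr2
  · rcases Nat.lt_or_ge r 1 with hr1 | hr1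
    -- Because u = ρu does not involve y, its total degree is also zero, so u is a multiple of the
    -- vacuum.
    · have hr0 : r = 0 := by omega
      subst hr0
      right
      refine ⟨0, Nat.zero_le _, rfl, ?_⟩
      have h0 : eulerOn x d Finset.univ • u = 0 := by
        rw [eulerOn_univ, add_smul, ← hE', hE, ← hρ, mul_smul, ← mul_smul (d _), h.d_ρ]
        simp
      obtain ⟨c, hc⟩ := Submodule.mem_span_singleton.1 (h.mem_span_of_euler h0)
      exact ⟨c, by rw [pow_zero, one_smul, hc]⟩
    -- Here L u would have odd degree −1, so it vanishes, and then so does u.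
    · have hr0 : r = 1 := by omega
      subst hr0
      left
      have h0 : L • u = 0 := by
        refine h.eq_zero_of_eulerOn hEL fun m hm h' => ?_
        have : ((m + 1 : ℕ) : ℂ) = 0 := by push_cast at h' ⊢; linear_combination -h'
        exact Nat.succ_ne_zero m (by exact_mod_cast this)
      rw [h0, smul_zero, eq_comm, smul_eq_zero] at hK
      exact hK.resolve_left (hfac (by norm_num))
  · have hcast : ((r - 2 : ℕ) : ℂ) = r - 2 := by push_cast [Nat.cast_sub hr2]; ring
    have hρL : ρ • L • u = L • u := by
      have : Commute ρ L := commute_quadOn h.commute_ρ_d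
      rw [← mul_smul, this.eq, mul_smul, hρ]
    -- From the sl(2) relation with superdimension −2n: r(r−2n−2) − 4(r−2) + 4n = (r−2)(r−2n−4).
    have hK' : R • L • L • u = (((r - 2 : ℕ) : ℂ) * (((r - 2 : ℕ) : ℂ) - 2 * n - 2)) • L • u := by
      have := congrArg (· • (L • u))
        (quadOn_mul_quadOn h.toWeylRel (S := oddIdx n) dualIdx_mem_oddIdx)
      simp only [add_smul, mul_smul, smul_assoc, one_smul] at this
      rw [← hL, ← hE', ← hR, hK, hEL, smul_comm, sdimOn_oddIdx, add_assoc, ← sub_eq_iff_eq_add]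
        at this
      rw [← this, hcast]
      simp only [smul_smul, ← add_smul, ← sub_smul]
      congr 1
      ring
    have hr0 : (r : ℂ) ≠ 0 := by
      have : r ≠ 0 := by omega
      exact_mod_cast this
    have hu : u = ((r : ℂ) * (r - 2 * n - 2))⁻¹ • R • L • u := by
      rw [hK, smul_smul, inv_mul_cancel₀ (hfac hr0), one_smul]
    rcases ih (r - 2) (by omega) (L • u) hρL (by rw [hEL, hcast]) hK' with h0 | ⟨i, hi, hri, c, hc⟩
    · left
      rw [hu, h0, smul_zero, smul_zero]
    · right
      refine ⟨i + 1, by omega, by omega, ((r : ℂ) * (r - 2 * n - 2))⁻¹ * c, ?_⟩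
      rw [hc] at hu
      rw [hu, smul_comm R c, smul_smul, pow_succ', mul_smul R (R ^ i)]

/-- Taylor expansion in the even variable. -/
theorem taylor (u : P) : ∃ N, ∀ M ≥ N, u = ∑ i ∈ Finset.range M, ((i.factorial : ℂ)⁻¹) •
    x (Sum.inl ()) ^ i • ρ • d (Sum.inl ()) ^ i • u := by
  set y := x (Sum.inl ())
  set D := d (Sum.inl ())
  -- The expansion is required for all sufficiently large M, so that two vectors with different
  -- bounds can be added.
  let N : Submodule ℂ P :=
    { carrier := {u | ∃ N, ∀ M ≥ N, u = ∑ i ∈ Finset.range M, ((i.factorial : ℂ)⁻¹) •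
        y ^ i • ρ • D ^ i • u}
      zero_mem' := ⟨0, by simp⟩
      add_mem' := by
        rintro a b ⟨N, hN⟩ ⟨N', hN'⟩
        refine ⟨max N N', fun M hM => ?_⟩
        simp only [smul_add, Finset.sum_add_distrib]
        rw [← hN M (le_trans (le_max_left _ _) hM), ← hN' M (le_trans (le_max_right _ _) hM)]
      smul_mem' := by
        rintro c a ⟨N, hN⟩
        refine ⟨N, fun M hM => ?_⟩
        conv_lhs => rw [hN M hM, Finset.smul_sum]
        refine Finset.sum_congr rfl fun i _ => ?_
        rw [smul_comm (D ^ i) c, smul_comm ρ c, smul_comm (y ^ i) c, smul_comm _ c] }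
  have hD : ∀ i, i ≠ 0 → D ^ i • v = 0 := by
    intro i hi
    obtain ⟨i, rfl⟩ := Nat.exists_eq_succ_of_ne_zero hi
    rw [pow_succ, mul_smul, h.d_v, smul_zero]
  have hDy : ∀ i : ℕ, D ^ i * y = y * D ^ i + (i : ℂ) • D ^ (i - 1) := by
    intro i
    induction i with
    | zero => simp
    | succ i ih =>
      rw [pow_succ', mul_assoc, ih, mul_add, ← mul_assoc, h.toWeylRel.dy_y, add_mul, one_mul,
        mul_smul_comm, Nat.add_sub_cancel, mul_assoc, add_assoc]
      congr 1
      rcases i with _ | i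
      · simp
      · rw [Nat.add_sub_cancel, ← pow_succ']
        push_cast
        module
  have htop : N = ⊤ := by
    refine h.gen N ⟨1, fun M hM => ?_⟩ ?_
    · rw [Finset.sum_eq_single 0]
      · simp [h.ρ_v]
      · intro i _ hi
        rw [hD i hi, smul_zero, smul_zero, smul_zero]
      · simp; omega
    · rintro (⟨⟩ | j) u ⟨N, hN⟩
      · refine ⟨N + 1, fun M hM => ?_⟩
        obtain ⟨M, rfl⟩ := Nat.exists_eq_succ_of_ne_zero (show M ≠ 0 by omega)
        rw [Finset.sum_range_succ']
        -- In D^i y = y D^i + i D^{i−1} the first term is killed by ρ; the factor i then turns 1/i!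
        -- into 1/(i−1)!, and the term i = 0 drops out.
        have e : ∀ i : ℕ, ρ • D ^ i • y • u = (i : ℂ) • ρ • D ^ (i - 1) • u := by
          intro i
          rw [← mul_smul (D ^ i), hDy, add_smul, mul_smul, smul_add, ← mul_smul ρ, h.ρ_y,
            zero_smul, zero_add, smul_assoc, smul_comm]
        change y • u = ∑ i ∈ Finset.range M, (((i + 1).factorial : ℂ)⁻¹) •
          y ^ (i + 1) • ρ • D ^ (i + 1) • y • u + (((0).factorial : ℂ)⁻¹) •
          y ^ 0 • ρ • D ^ 0 • y • u
        simp only [e]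
        conv_lhs => rw [hN M (by omega), Finset.smul_sum]
        simp only [Nat.cast_zero, zero_smul, smul_zero, add_zero]
        refine Finset.sum_congr rfl fun i _ => ?_
        rw [smul_comm y ((i.factorial : ℂ)⁻¹), ← mul_smul y (y ^ i), ← pow_succ',
          Nat.add_sub_cancel, smul_comm (y ^ (i + 1)) ((i + 1 : ℕ) : ℂ),
          smul_smul (((i + 1).factorial : ℂ)⁻¹), Nat.factorial_succ]
        congr 1
        have h1 : (i.factorial : ℂ) ≠ 0 := by exact_mod_cast i.factorial_ne_zero
        have h2 : ((i + 1 : ℕ) : ℂ) ≠ 0 := by exact_mod_cast Nat.succ_ne_zero i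
        push_cast at h2 ⊢
        field_simp
      · refine ⟨N, fun M hM => ?_⟩
        conv_lhs => rw [hN M hM, Finset.smul_sum]
        refine Finset.sum_congr rfl fun i _ => ?_
        have c1 : Commute (D ^ i) (x (Sum.inr j)) := (h.toWeylRel.commute_dy_x j).pow_left i
        have c2 : Commute (y ^ i) (x (Sum.inr j)) := (h.toWeylRel.commute_y_x j).pow_left i
        rw [← mul_smul (D ^ i), c1.eq, mul_smul, ← mul_smul ρ (x _), h.ρ_x, mul_smul,
          ← mul_smul (y ^ i) (x _), c2.eq, mul_smul, smul_comm]
  have : u ∈ N := htop ▸ Submodule.mem_top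
  exact this

/-- The eigenvalue of the odd degree on the Taylor coefficients. -/
theorem euler_taylor {r : ℂ} {u : P} (hu : eulerOn x d Finset.univ • u = r • u) (i : ℕ) :
    eulerOn x d (oddIdx n) • ρ • d (Sum.inl ()) ^ i • u =
      (r - i) • ρ • d (Sum.inl ()) ^ i • u := by
  have h1 : eulerOn x d Finset.univ • d (Sum.inl ()) ^ i • u =
      (r - i) • d (Sum.inl ()) ^ i • u := by
    induction i with
    | zero => simpa using hu
    | succ i ih =>
      have := congrArg (· • (d (Sum.inl ()) ^ i • u))
        (d_mul_eulerOn h.toWeylRel (S := Finset.univ) (Sum.inl ()))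
      simp only [Finset.mem_univ, if_true, add_smul, mul_smul] at this
      rw [ih, smul_comm, ← mul_smul (d _) (d _ ^ i), ← pow_succ'] at this
      rw [eq_comm, ← eq_sub_iff_add_eq] at this
      rw [this]
      push_cast
      rw [sub_add_eq_sub_sub, sub_smul _ (1 : ℂ), one_smul]
  have c : Commute ρ (eulerOn x d (oddIdx n)) := commute_eulerOn h.commute_ρ_x h.commute_ρ_d
  have h2 : ρ * eulerOn x d Finset.univ = ρ * eulerOn x d (oddIdx n) := by
    rw [eulerOn_univ, mul_add, ← mul_assoc, h.ρ_y, zero_mul, zero_add]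
  rw [← mul_smul, ← c.eq, ← h2, mul_smul, h1, smul_comm]

/-- The vectors of degree `k` that are invariant under `sp(2n)`. -/
theorem mem_span_of_invariant {k : ℕ} {u : P} (hE : eulerOn x d Finset.univ • u = (k : ℂ) • u)
    (hK : (quadOn x (oddIdx n) * quadOn d (oddIdx n) -
      eulerOn x d (oddIdx n) * eulerOn x d (oddIdx n) -
        (sdimOn (oddIdx n) - 2) • eulerOn x d (oddIdx n)) • u = 0) :
    u ∈ Submodule.span ℂ ((fun i => x (Sum.inl ()) ^ (k - 2 * i) • quadOn x (oddIdx n) ^ i • v) ''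
      {i | i ≤ n ∧ 2 * i ≤ k}) := by
  obtain ⟨N, hN⟩ := h.taylor u
  rw [hN N le_rfl]
  refine Submodule.sum_mem _ fun i _ => Submodule.smul_mem _ _ ?_
  -- The Taylor coefficient w is free of y, has odd degree k − i, and inherits the Casimir equation
  -- from u, so `odd_invariant` applies to it.
  set w := ρ • d (Sum.inl ()) ^ i • u with hw
  have hEw := h.euler_taylor hE i
  rw [← hw] at hEw
  by_cases hik : k < i
  · have : w = 0 := by
      refine h.eq_zero_of_eulerOn hEw fun m hm h' => ?_
      have : ((m + i : ℕ) : ℂ) = k := by push_cast; linear_combination -h'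
      have : m + i = k := by exact_mod_cast this
      omega
    rw [this, smul_zero]
    exact Submodule.zero_mem _
  have hcast : ((k - i : ℕ) : ℂ) = k - i := by rw [Nat.cast_sub (by omega)]
  rw [← hcast] at hEw
  have hρw : ρ • w = w := by
    -- Idempotency of ρ follows from the other properties: ρ² − ρ kills the vacuum and anything
    -- multiplied by y, and commutes with the odd coordinates.
    have hρρ : ρ * ρ = ρ := by
      refine sub_eq_zero.1 (h.faithful _ fun z => ?_)
      have := h.gen (LinearMap.ker (Algebra.lsmul ℂ ℂ P (ρ * ρ - ρ))) ?_ ?_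
      · have hz : z ∈ LinearMap.ker (Algebra.lsmul ℂ ℂ P (ρ * ρ - ρ)) := this ▸ Submodule.mem_top
        exact hz
      · change (ρ * ρ - ρ) • v = 0
        rw [sub_smul, mul_smul, h.ρ_v, h.ρ_v, sub_self]
      · intro j z hz
        change (ρ * ρ - ρ) • z = 0 at hz
        change (ρ * ρ - ρ) • x j • z = 0
        rcases j with _ | j
        · rw [← mul_smul, sub_mul, mul_assoc, h.ρ_y, mul_zero, sub_zero, zero_smul]
        · have c : Commute (ρ * ρ - ρ) (x (Sum.inr j)) :=
            ((h.commute_ρ_x j).mul_left (h.commute_ρ_x j)).sub_left (h.commute_ρ_x j)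
          rw [← mul_smul, c.eq, mul_smul, hz, smul_zero]
    rw [hw, ← mul_smul, hρρ]
  -- The sp(2n) Casimir operator involves only odd variables and their derivations, and both ρ and
  -- d_y commute with these.
  have hKw : (quadOn x (oddIdx n) * quadOn d (oddIdx n) -
      eulerOn x d (oddIdx n) * eulerOn x d (oddIdx n) -
        (sdimOn (oddIdx n) - 2) • eulerOn x d (oddIdx n)) • w = 0 := by
    have hc : ∀ z : A, (∀ j, Commute z (x (Sum.inr j))) → (∀ j, Commute z (d (Sum.inr j))) →
        Commute z (quadOn x (oddIdx n) * quadOn d (oddIdx n) -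
          eulerOn x d (oddIdx n) * eulerOn x d (oddIdx n) -
            (sdimOn (oddIdx n) - 2) • eulerOn x d (oddIdx n)) := fun z h1 h2 =>
      (((commute_quadOn h1).mul_right (commute_quadOn h2)).sub_right
        ((commute_eulerOn h1 h2).mul_right (commute_eulerOn h1 h2))).sub_right
        ((commute_eulerOn h1 h2).smul_right _)
    rw [hw, ← mul_smul, ← (hc ρ h.commute_ρ_x h.commute_ρ_d).eq, mul_smul, ← mul_smul _ (_ ^ i),
      ← ((hc _ h.toWeylRel.commute_dy_x h.toWeylRel.commute_dy_d).pow_left i).eq, mul_smul, hK,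
      smul_zero, smul_zero]
  have hKw' : quadOn x (oddIdx n) • quadOn d (oddIdx n) • w =
      (((k - i : ℕ) : ℂ) * (((k - i : ℕ) : ℂ) - 2 * n - 2)) • w := by
    rw [sub_smul, sub_smul, mul_smul, mul_smul, hEw, smul_assoc, smul_comm _ ((k - i : ℕ) : ℂ), hEw,
      sdimOn_oddIdx, sub_sub, sub_eq_zero] at hKw
    rw [hKw]
    simp only [smul_smul, ← add_smul]
    congr 1
    ring
  rcases h.odd_invariant (k - i) w hρw hEw hKw' with h0 | ⟨j, hj, hij, c, hc⟩
  · rw [h0, smul_zero]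
    exact Submodule.zero_mem _
  · rw [hc, smul_comm]
    refine Submodule.smul_mem _ _ (Submodule.subset_span ⟨j, ⟨hj, by omega⟩, ?_⟩)
    have : k - 2 * j = i := by omega
    simp only [this]

end Fock

end Fock

/-! ### The sl(2) action, the harmonic decomposition and the Casimir operator. -/

section Sl2

variable {n : ℕ} {A P : Type*} [Ring A] [Algebra ℂ A] [AddCommGroup P] [Module ℂ P]
  [Module A P] [IsScalarTower ℂ A P] {x d : Idx n → A} {σ ρ : A} {v : P}

/-- The operator by which the Casimir element of `osp(1|2n)` acts. -/
noncomputable def casimirOp (x d : Idx n → A) : A :=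
  quadOn x Finset.univ * quadOn d Finset.univ -
    eulerOn x d Finset.univ * eulerOn x d Finset.univ -
      (sdimOn (Finset.univ : Finset (Idx n)) - 2) • eulerOn x d Finset.univ

theorem WeylRel.euler_quad_pow (h : WeylRel x d) {S : Finset (Idx n)}
    (hS : ∀ i ∈ S, dualIdx i ∈ S) {m : ℂ} {u : P} (hu : eulerOn x d S • u = m • u) (j : ℕ) :
    eulerOn x d S • quadOn x S ^ j • u = (m + 2 * j) • quadOn x S ^ j • u := by
  induction j with
  | zero => simpa using hu
  | succ j ih =>
    rw [pow_succ', mul_smul, ← mul_smul (eulerOn x d S) (quadOn x S), eulerOn_mul_quadOn h hS,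
      add_smul, mul_smul, ih, smul_assoc, smul_comm _ (m + 2 * (j : ℂ)), ← add_smul]
    push_cast
    congr 1
    ring

/-- The lowest weight computation for sl(2): commuting ∇² past j + 1 factors R² adds up 4(m+2l) + 2
sdim for l = 0, …, j. -/
theorem WeylRel.quad_quad_pow (h : WeylRel x d) {S : Finset (Idx n)}
    (hS : ∀ i ∈ S, dualIdx i ∈ S) {m : ℂ} {u : P} (hu : eulerOn x d S • u = m • u)
    (hL : quadOn d S • u = 0) (j : ℕ) :
    quadOn d S • quadOn x S ^ (j + 1) • u =
      (2 * (j + 1) * (2 * m + sdimOn S + 2 * j)) • quadOn x S ^ j • u := by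
  induction j with
  | zero =>
    rw [zero_add, pow_one, ← mul_smul, quadOn_mul_quadOn h hS, add_smul, add_smul, mul_smul, hL,
      smul_zero, zero_add, smul_assoc, hu, smul_assoc, one_smul, smul_smul, ← add_smul, pow_zero,
      one_smul]
    congr 1
    push_cast
    ring
  | succ j ih =>
    rw [pow_succ', mul_smul, ← mul_smul (quadOn d S) (quadOn x S), quadOn_mul_quadOn h hS, add_smul,
      add_smul, mul_smul, ih, smul_assoc, h.euler_quad_pow hS hu, smul_assoc, one_smul, smul_comm _
      (2 * ((j : ℂ) + 1) * _), ← mul_smul (quadOn x S) (quadOn x S ^ j), ← pow_succ', smul_smul,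
      ← add_smul, ← add_smul]
    congr 1
    push_cast
    ring

theorem dualIdx_mem_univ : ∀ i ∈ (Finset.univ : Finset (Idx n)), dualIdx i ∈ Finset.univ :=
  fun _ _ => Finset.mem_univ _

/-- The eigenvalue of the Casimir operator on `R^{2j} H_m`. -/
theorem WeylRel.casimirOp_harmonic (h : WeylRel x d) {m : ℂ} {u : P}
    (hu : eulerOn x d Finset.univ • u = m • u) (hL : quadOn d Finset.univ • u = 0) (j : ℕ) :
    casimirOp x d • quadOn x Finset.univ ^ j • u =
      (m * (2 * n + 1 - m)) • quadOn x Finset.univ ^ j • u := by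
  have hE := h.euler_quad_pow dualIdx_mem_univ hu j
  rw [casimirOp, sub_smul, sub_smul, mul_smul, mul_smul, hE, smul_assoc, hE, smul_comm _
    (m + 2 * (j : ℂ)), hE, sdimOn_univ]
  rcases j with _ | j
  · simp only [pow_zero, one_smul, hL, smul_zero, smul_smul, zero_sub, ← neg_smul, ← sub_smul]
    congr 1
    push_cast
    ring
  · rw [h.quad_quad_pow dualIdx_mem_univ hu hL, smul_comm (quadOn x Finset.univ)
      (2 * ((j : ℂ) + 1) * _), ← mul_smul (quadOn x Finset.univ) (_ ^ j), ← pow_succ', smul_smul,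
      smul_smul, ← sub_smul, ← sub_smul, sdimOn_univ]
    congr 1
    push_cast
    ring

theorem quadOn_mem_degPart (S : Finset (Idx n)) {k : ℕ} {u : P} (hu : u ∈ degPart x v k) :
    quadOn x S • u ∈ degPart x v (k + 2) := by
  rw [quadOn, Finset.sum_smul]
  refine Submodule.sum_mem _ fun i _ => ?_
  rw [smul_assoc, mul_smul (x i)]
  exact Submodule.smul_mem _ _ (smul_mem_degPart i (smul_mem_degPart _ hu))

theorem quadOn_pow_mem_degPart (S : Finset (Idx n)) {k : ℕ} {u : P} (hu : u ∈ degPart x v k)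
    (j : ℕ) : quadOn x S ^ j • u ∈ degPart x v (k + 2 * j) := by
  induction j with
  | zero => simpa using hu
  | succ j ih =>
    rw [pow_succ', mul_smul]
    exact quadOn_mem_degPart S ih

theorem pow_mem_degPart (i : Idx n) {k : ℕ} {u : P} (hu : u ∈ degPart x v k) (a : ℕ) :
    x i ^ a • u ∈ degPart x v (k + a) := by
  induction a with
  | zero => simpa using hu
  | succ a ih =>
    rw [pow_succ', mul_smul]
    exact smul_mem_degPart i ih

/-- The harmonic vectors of degree `m`. -/
noncomputable def harmonicPart (x d : Idx n → A) (v : P) (m : ℕ) : Submodule ℂ P :=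
  degPart x v m ⊓ LinearMap.ker (Algebra.lsmul ℂ ℂ P (quadOn d Finset.univ))

/-- The vectors `R^{2j} u` with `u` harmonic of degree `k - 2j`. -/
def harmonicProducts (x d : Idx n → A) (v : P) (k : ℕ) : Set P :=
  {w | ∃ j, 2 * j ≤ k ∧ ∃ u ∈ harmonicPart x d v (k - 2 * j), w = quadOn x Finset.univ ^ j • u}

namespace Fock

variable (h : Fock x d σ ρ v)

include h

theorem quadOn_d_degPart (S : Finset (Idx n)) (k : ℕ) {u : P} (hu : u ∈ degPart x v (k + 2)) :
    quadOn d S • u ∈ degPart x v k := by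
  rw [quadOn, Finset.sum_smul]
  refine Submodule.sum_mem _ fun i _ => ?_
  rw [smul_assoc, mul_smul (d i)]
  exact Submodule.smul_mem _ _ (h.d_degPart _ _ _ (h.d_degPart _ _ _ hu))

theorem quadOn_d_degPart_eq_zero (S : Finset (Idx n)) {k : ℕ} (hk : k < 2) {u : P}
    (hu : u ∈ degPart x v k) : quadOn d S • u = 0 := by
  rw [quadOn, Finset.sum_smul]
  refine Finset.sum_eq_zero fun i _ => ?_
  rw [smul_assoc, mul_smul (d i)]
  rcases k with _ | k
  · rw [h.d_degPart_zero _ hu, smul_zero, smul_zero]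
  · have hk0 : k = 0 := by omega
    subst hk0
    rw [h.d_degPart_zero _ (h.d_degPart _ _ _ hu), smul_zero]

/-- The harmonic decomposition. -/
theorem degPart_le_harmonic (k : ℕ) :
    degPart x v k ≤ Submodule.span ℂ (harmonicProducts x d v k) := by
  induction k using Nat.strong_induction_on with
  | _ k ih =>
  intro u hu
  have hharm : ∀ w ∈ degPart x v k, quadOn d Finset.univ • w = 0 →
      w ∈ Submodule.span ℂ (harmonicProducts x d v k) := fun w hw hL =>
    Submodule.subset_span ⟨0, Nat.zero_le _, w, ⟨hw, hL⟩, by rw [pow_zero, one_smul]⟩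
  rcases Nat.lt_or_ge k 2 with hk | hk
  · exact hharm u hu (h.quadOn_d_degPart_eq_zero _ hk hu)
  · obtain ⟨k, rfl⟩ := Nat.exists_eq_add_of_le' hk
    -- Every ∇²u in degree k is also ∇²w for some w that is already decomposed; then u − w is
    -- harmonic.
    have hlift : Submodule.span ℂ (harmonicProducts x d v k) ≤
        (Submodule.span ℂ (harmonicProducts x d v (k + 2)) ⊓ degPart x v (k + 2)).map
          (Algebra.lsmul ℂ ℂ P (quadOn d Finset.univ)) := by
      rw [Submodule.span_le]
      rintro _ ⟨j, hj, w, ⟨hw, hL⟩, rfl⟩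
      change quadOn d Finset.univ • w = 0 at hL
      have h1 := h.toWeylRel.quad_quad_pow dualIdx_mem_univ (h.euler_degPart _ _ hw) hL j
      rw [sdimOn_univ] at h1
      set c : ℂ := 2 * (j + 1) * (2 * ((k - 2 * j : ℕ) : ℂ) + (1 - 2 * n) + 2 * j) with hc
      -- The last factor is an odd integer, because the superdimension 1 − 2n is odd.
      have hc0 : c ≠ 0 := by
        have e : c = ((2 * (j + 1) * (2 * ((k - 2 * j : ℕ) : ℤ) + (1 - 2 * n) + 2 * j) : ℤ) : ℂ) := by
          rw [hc]; push_cast; ring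
        rw [e]
        refine Int.cast_ne_zero.2 (mul_ne_zero (by omega) (by omega))
      have e1 : k + 2 - 2 * (j + 1) = k - 2 * j := by omega
      refine ⟨c⁻¹ • quadOn x Finset.univ ^ (j + 1) • w, ⟨?_, ?_⟩, ?_⟩
      · refine Submodule.smul_mem _ _ (Submodule.subset_span ⟨j + 1, by omega, w, ?_, rfl⟩)
        rw [e1]
        exact ⟨hw, hL⟩
      · refine Submodule.smul_mem _ _ ?_
        have := quadOn_pow_mem_degPart Finset.univ hw (j + 1)
        rwa [show k - 2 * j + 2 * (j + 1) = k + 2 by omega] at this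
      · change quadOn d Finset.univ • c⁻¹ • quadOn x Finset.univ ^ (j + 1) • w = _
        rw [smul_comm, h1, smul_smul, inv_mul_cancel₀ hc0, one_smul]
    obtain ⟨w, ⟨hw1, hw2⟩, hw3⟩ := hlift (ih k (by omega) (h.quadOn_d_degPart Finset.univ k hu))
    change quadOn d Finset.univ • w = quadOn d Finset.univ • u at hw3
    have := hharm (u - w) (Submodule.sub_mem _ hu hw2) (by rw [smul_sub, hw3, sub_self])
    have h2 := Submodule.add_mem _ this hw1
    rwa [sub_add_cancel] at h2

/-- On a harmonic vector ∂_y² equals minus the odd Laplacian, so all Taylor coefficients in y are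
determined by the first two. These have odd degrees m and m − 1, both above 2n, and vanish. -/
theorem harmonic_eq_zero {m : ℕ} (hm : 2 * n + 2 ≤ m) {u : P} (hu : u ∈ harmonicPart x d v m) :
    u = 0 := by
  obtain ⟨hu, hL⟩ := hu
  change quadOn d Finset.univ • u = 0 at hL
  have hE := h.euler_degPart m u hu
  have hzero : ∀ i, ρ • d (Sum.inl ()) ^ i • u = 0 := by
    intro i
    induction i using Nat.strong_induction_on with
    | _ i ih =>
    rcases Nat.lt_or_ge i 2 with hi | hi
    · refine h.eq_zero_of_eulerOn (h.euler_taylor hE i) fun k hk h' => ?_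
      have : (m : ℂ) = ((k + i : ℕ) : ℂ) := by push_cast; linear_combination h'
      have : m = k + i := by exact_mod_cast this
      omega
    · obtain ⟨i, rfl⟩ := Nat.exists_eq_add_of_le' hi
      have h1 : d (Sum.inl ()) ^ 2 • u = -(quadOn d (oddIdx n) • u) := by
        rw [quadOn_univ, add_smul, ← pow_two] at hL
        exact eq_neg_of_add_eq_zero_left hL
      have c1 : Commute (d (Sum.inl ()) ^ i) (quadOn d (oddIdx n)) :=
        commute_quadOn fun j => (h.toWeylRel.commute_dy_d j).pow_left i
      have c2 : Commute ρ (quadOn d (oddIdx n)) := commute_quadOn h.commute_ρ_d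
      rw [pow_add, mul_smul, h1, smul_neg, ← mul_smul (_ ^ i), c1.eq, mul_smul, smul_neg,
        ← mul_smul ρ, c2.eq, mul_smul, ih i (by omega), smul_zero, neg_zero]
  obtain ⟨N, hN⟩ := h.taylor u
  rw [hN N le_rfl]
  exact Finset.sum_eq_zero fun i _ => by rw [hzero, smul_zero, smul_zero]

/-! ### The vectors `y^a R'^l` -/

theorem d_y_pow (a l : ℕ) : d (Sum.inl ()) • x (Sum.inl ()) ^ a • quadOn x (oddIdx n) ^ l • v =
    (a : ℂ) • x (Sum.inl ()) ^ (a - 1) • quadOn x (oddIdx n) ^ l • v := by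
  have c : Commute (d (Sum.inl ())) (quadOn x (oddIdx n) ^ l) :=
    (commute_quadOn h.toWeylRel.commute_dy_x).pow_right l
  rw [← mul_smul, h.toWeylRel.dy_y_pow, add_smul, mul_smul, ← mul_smul (d _), c.eq, mul_smul,
    h.d_v, smul_zero, smul_zero, zero_add, smul_assoc]

omit [IsScalarTower ℂ A P] in
theorem euler_odd_v : eulerOn x d (oddIdx n) • v = (0 : ℂ) • v := by
  rw [eulerOn, Finset.sum_smul, zero_smul]
  exact Finset.sum_eq_zero fun i _ => by rw [mul_smul, h.d_v, smul_zero]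

theorem quad_odd_v : quadOn d (oddIdx n) • v = 0 :=
  h.quadOn_d_degPart_eq_zero _ two_pos vacuum_mem_degPart

omit [IsScalarTower ℂ A P] in
theorem commute_quad_y_pow (a : ℕ) : Commute (quadOn d (oddIdx n)) (x (Sum.inl ()) ^ a) :=
  ((commute_quadOn h.toWeylRel.commute_y_d).pow_left a).symm

/-- The case m = 0, sdim = −2n of `WeylRel.quad_quad_pow`. At l = 0 the coefficient vanishes, so the
truncated exponent l − 1 is harmless. -/
theorem quad_y_pow (a l : ℕ) :
    quadOn d (oddIdx n) • x (Sum.inl ()) ^ a • quadOn x (oddIdx n) ^ l • v =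
      (4 * l * (l - 1 - n) : ℂ) • x (Sum.inl ()) ^ a • quadOn x (oddIdx n) ^ (l - 1) • v := by
  rw [← mul_smul, (h.commute_quad_y_pow a).eq, mul_smul]
  rcases l with _ | l
  · rw [pow_zero, one_smul, h.quad_odd_v]
    simp
  · rw [h.toWeylRel.quad_quad_pow dualIdx_mem_oddIdx h.euler_odd_v h.quad_odd_v, smul_comm,
      sdimOn_oddIdx, Nat.add_sub_cancel]
    congr 1
    push_cast
    ring

omit h in
theorem mem_degPart_y_pow (a l : ℕ) :
    x (Sum.inl ()) ^ a • quadOn x (oddIdx n) ^ l • v ∈ degPart x v (a + 2 * l) := by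
  have := pow_mem_degPart (Sum.inl ()) (quadOn_pow_mem_degPart (oddIdx n)
    (vacuum_mem_degPart (x := x) (v := v)) l) a
  rwa [zero_add, add_comm] at this

/-- C is tridiagonal on these vectors: expanding (y² + R')(∂_y² + ∇'²) gives one raising, one
lowering and two diagonal terms, and E is diagonal. Only the coefficient that raises the power of R'
matters later, so α is left unspecified. Wherever an exponent is truncated its coefficient is zero.
-/
theorem casimirOp_y_pow (a l : ℕ) : ∃ α : ℂ,
    casimirOp x d • x (Sum.inl ()) ^ a • quadOn x (oddIdx n) ^ l • v =
      α • x (Sum.inl ()) ^ a • quadOn x (oddIdx n) ^ l • v +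
        (4 * l * (l - 1 - n) : ℂ) • x (Sum.inl ()) ^ (a + 2) • quadOn x (oddIdx n) ^ (l - 1) • v +
        (a * (a - 1 : ℕ) : ℂ) • x (Sum.inl ()) ^ (a - 2) • quadOn x (oddIdx n) ^ (l + 1) • v := by
  have hE := h.euler_degPart _ _ (mem_degPart_y_pow a l)
  have cR : ∀ b, Commute (quadOn x (oddIdx n)) (x (Sum.inl ()) ^ b) := fun b =>
    ((commute_quadOn h.toWeylRel.commute_y_x).pow_left b).symm
  have hL : quadOn d Finset.univ • x (Sum.inl ()) ^ a • quadOn x (oddIdx n) ^ l • v =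
      (a * (a - 1 : ℕ) : ℂ) • x (Sum.inl ()) ^ (a - 2) • quadOn x (oddIdx n) ^ l • v +
      (4 * l * (l - 1 - n) : ℂ) • x (Sum.inl ()) ^ a • quadOn x (oddIdx n) ^ (l - 1) • v := by
    rw [quadOn_univ, add_smul, mul_smul, h.d_y_pow, smul_comm, h.d_y_pow, smul_smul, h.quad_y_pow,
      Nat.sub_sub]
  have h1 : (a * (a - 1 : ℕ) : ℂ) • x (Sum.inl ()) • x (Sum.inl ()) • x (Sum.inl ()) ^ (a - 2) •
      quadOn x (oddIdx n) ^ l • v =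
      (a * (a - 1 : ℕ) : ℂ) • x (Sum.inl ()) ^ a • quadOn x (oddIdx n) ^ l • v := by
    rcases a with _ | _ | a
    · simp
    · simp
    · rw [show a + 1 + 1 - 2 = a by omega, pow_succ' _ (a + 1), pow_succ' _ a,
        mul_smul (x _) (x _ * _), mul_smul (x _) (_ ^ a)]
  have h2 : (4 * l * (l - 1 - n) : ℂ) • quadOn x (oddIdx n) • x (Sum.inl ()) ^ a •
      quadOn x (oddIdx n) ^ (l - 1) • v =
      (4 * l * (l - 1 - n) : ℂ) • x (Sum.inl ()) ^ a • quadOn x (oddIdx n) ^ l • v := by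
    rw [← mul_smul (quadOn x (oddIdx n)), (cR a).eq, mul_smul (_ ^ a)]
    rcases l with _ | l
    · simp
    · rw [Nat.add_sub_cancel, pow_succ', mul_smul (quadOn x (oddIdx n))]
  have h3 : quadOn x (oddIdx n) • x (Sum.inl ()) ^ (a - 2) • quadOn x (oddIdx n) ^ l • v =
      x (Sum.inl ()) ^ (a - 2) • quadOn x (oddIdx n) ^ (l + 1) • v := by
    rw [← mul_smul (quadOn x (oddIdx n)), (cR _).eq, mul_smul, pow_succ', mul_smul]
  refine ⟨a * (a - 1 : ℕ) + 4 * l * (l - 1 - n) - ((a + 2 * l : ℕ) : ℂ) * ((a + 2 * l : ℕ) : ℂ) -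
    (sdimOn (Finset.univ : Finset (Idx n)) - 2) * ((a + 2 * l : ℕ) : ℂ), ?_⟩
  rw [casimirOp, sub_smul, sub_smul, mul_smul, mul_smul, smul_assoc, hE, smul_comm _
    ((a + 2 * l : ℕ) : ℂ), hE, hL, quadOn_univ, add_smul, mul_smul, smul_add, smul_add, smul_add,
    smul_comm (x _) (_ : ℂ), smul_comm (x _) (_ : ℂ), smul_comm (x _) (_ : ℂ),
    smul_comm (x _) (_ : ℂ), h1, smul_comm (quadOn x (oddIdx n)) (_ : ℂ),
    smul_comm (quadOn x (oddIdx n)) (_ : ℂ), h2, h3,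
    ← mul_smul (x _) (_ ^ a), ← pow_succ', ← mul_smul (x _) (_ ^ (a + 1)), ← pow_succ']
  generalize x (Sum.inl ()) ^ a • quadOn x (oddIdx n) ^ l • v = w₁
  generalize x (Sum.inl ()) ^ (a - 2) • quadOn x (oddIdx n) ^ (l + 1) • v = w₂
  generalize x (Sum.inl ()) ^ (a + 1 + 1) • quadOn x (oddIdx n) ^ (l - 1) • v = w₃
  module

/-- The leading term of `C^i y^k`. -/
theorem casimirOp_pow (k i : ℕ) (hi : 2 * i ≤ k) :
    casimirOp x d ^ i • x (Sum.inl ()) ^ k • v - (k.descFactorial (2 * i) : ℂ) •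
      x (Sum.inl ()) ^ (k - 2 * i) • quadOn x (oddIdx n) ^ i • v ∈
    Submodule.span ℂ ((fun l => x (Sum.inl ()) ^ (k - 2 * l) • quadOn x (oddIdx n) ^ l • v) ''
      {l | l < i ∧ 2 * l ≤ k}) := by
  induction i with
  | zero => simp
  | succ i ih =>
    set F := fun i => Submodule.span ℂ
      ((fun l => x (Sum.inl ()) ^ (k - 2 * l) • quadOn x (oddIdx n) ^ l • v) ''
      {l | l < i ∧ 2 * l ≤ k})
    have hmem : ∀ {i l a : ℕ}, l < i → a + 2 * l = k →
        x (Sum.inl ()) ^ a • quadOn x (oddIdx n) ^ l • v ∈ F i := by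
      intro i l a hl hk
      refine Submodule.subset_span ⟨l, ⟨hl, by omega⟩, ?_⟩
      have : k - 2 * l = a := by omega
      simp only [this]
    -- One application of C raises the power of R' by at most one; the subtracted term is the
    -- raising part.
    have hstep : ∀ {l : ℕ}, l ≤ i → 2 * l ≤ k →
        casimirOp x d • x (Sum.inl ()) ^ (k - 2 * l) • quadOn x (oddIdx n) ^ l • v -
        ((k - 2 * l : ℕ) * (k - 2 * l - 1 : ℕ) : ℂ) • x (Sum.inl ()) ^ (k - 2 * l - 2) •
          quadOn x (oddIdx n) ^ (l + 1) • v ∈ F (i + 1) := by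
      intro l hl hlk
      obtain ⟨α, hα⟩ := h.casimirOp_y_pow (k - 2 * l) l
      rw [hα, add_sub_cancel_right]
      refine Submodule.add_mem _ (Submodule.smul_mem _ _ (hmem (by omega) (by omega))) ?_
      rcases l with _ | l
      · simp
      · exact Submodule.smul_mem _ _ (hmem (by omega) (by omega))
    have hF : F i ≤ (F (i + 1)).comap (Algebra.lsmul ℂ ℂ P (casimirOp x d)) := by
      rw [Submodule.span_le]
      rintro _ ⟨l, ⟨hl, hlk⟩, rfl⟩
      have h1 := Submodule.add_mem _ (hstep hl.le hlk) (Submodule.smul_mem (F (i + 1))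
        ((k - 2 * l : ℕ) * (k - 2 * l - 1 : ℕ) : ℂ)
        (hmem (i := i + 1) (l := l + 1) (a := k - 2 * l - 2) (by omega) (by omega)))
      rw [sub_add_cancel] at h1
      exact h1
    have h1 := hF (ih (by omega))
    change casimirOp x d • (_ - _) ∈ F (i + 1) at h1
    have h2 := Submodule.smul_mem _ (k.descFactorial (2 * i) : ℂ) (hstep (l := i) le_rfl (by omega))
    have h3 := Submodule.add_mem _ h1 h2
    rw [smul_sub, ← mul_smul (casimirOp x d) (_ ^ i), ← pow_succ', smul_sub,
      smul_comm _ (k.descFactorial (2 * i) : ℂ), sub_add_sub_cancel,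
      smul_smul (k.descFactorial (2 * i) : ℂ)] at h3
    have e1 : k - 2 * i - 2 = k - 2 * (i + 1) := by omega
    -- Each raising step differentiates y twice, which supplies the next two factors of the
    -- descending factorial.
    have e2 : (k.descFactorial (2 * i) : ℂ) * ((k - 2 * i : ℕ) * (k - 2 * i - 1 : ℕ)) =
        (k.descFactorial (2 * (i + 1)) : ℂ) := by
      rw [show 2 * (i + 1) = 2 * i + 1 + 1 by ring, Nat.descFactorial_succ, Nat.descFactorial_succ,
        Nat.sub_sub k]
      push_cast
      ring
    rw [e1, e2] at h3
    exact h3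

theorem y_pow_ne_zero (a : ℕ) : x (Sum.inl ()) ^ a • v ≠ 0 := by
  induction a with
  | zero => rw [pow_zero, one_smul]; exact h.v_ne
  | succ a ih =>
    intro h0
    have h1 := h.d_y_pow (a + 1) 0
    rw [pow_zero, one_smul, h0, smul_zero, Nat.add_sub_cancel, eq_comm, smul_eq_zero] at h1
    exact ih (h1.resolve_left (by exact_mod_cast Nat.succ_ne_zero a))

/-- Each odd Laplacian lowers the power of R' by one with factor 4l(l−1−n), which is nonzero for 1 ≤
l ≤ n. The powers of the odd Laplacian therefore detect the powers of R' in triangular fashion. -/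
theorem quad_pow_y_pow (a i : ℕ) : ∀ l,
    (l < i → quadOn d (oddIdx n) ^ i • x (Sum.inl ()) ^ a • quadOn x (oddIdx n) ^ l • v = 0) ∧
    (l = i → i ≤ n →
      quadOn d (oddIdx n) ^ i • x (Sum.inl ()) ^ a • quadOn x (oddIdx n) ^ l • v ≠ 0) := by
  induction i with
  | zero =>
    refine fun l => ⟨fun hl => by omega, ?_⟩
    rintro rfl -
    rw [pow_zero, pow_zero, one_smul, one_smul]
    exact h.y_pow_ne_zero a
  | succ i ih =>
    intro l
    rw [pow_succ, mul_smul, h.quad_y_pow, smul_comm]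
    constructor
    · intro hl
      rcases l with _ | l
      · simp
      · rw [Nat.add_sub_cancel, (ih l).1 (by omega), smul_zero]
    · rintro rfl hi
      refine smul_ne_zero ?_ ((ih i).2 rfl (by omega))
      have h1 : ((i + 1 : ℕ) : ℂ) - 1 - n = -((n - i : ℕ) : ℂ) := by
        rw [Nat.cast_sub (by omega)]; push_cast; ring
      rw [h1]
      refine mul_ne_zero (mul_ne_zero (by norm_num) (by exact_mod_cast Nat.succ_ne_zero i))
        (neg_ne_zero.2 ?_)
      have : n - i ≠ 0 := by omega
      exact_mod_cast this

/-- The vectors `C^i y^k` for `i ≤ n` are linearly independent if `k ≥ 2n`. -/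
theorem casimirOp_independent {k : ℕ} (hk : 2 * n ≤ k) (q : ℕ → ℂ)
    (hq : ∑ i ∈ Finset.range (n + 1), q i • casimirOp x d ^ i • x (Sum.inl ()) ^ k • v = 0) :
    ∀ i < n + 1, q i = 0 := by
  -- For j ≥ i the j-th power of the odd Laplacian kills every lower term of C^i y^k and sees only
  -- the leading one.
  have key : ∀ i, i < n + 1 → ∀ j, quadOn d (oddIdx n) ^ j • casimirOp x d ^ i •
      x (Sum.inl ()) ^ k • v = quadOn d (oddIdx n) ^ j • (k.descFactorial (2 * i) : ℂ) •
      x (Sum.inl ()) ^ (k - 2 * i) • quadOn x (oddIdx n) ^ i • v ∨ j < i := by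
    intro i hi j
    by_cases hji : j < i
    · exact Or.inr hji
    left
    have h1 := h.casimirOp_pow k i (by omega)
    have h2 : Submodule.span ℂ ((fun l => x (Sum.inl ()) ^ (k - 2 * l) •
        quadOn x (oddIdx n) ^ l • v) '' {l | l < i ∧ 2 * l ≤ k}) ≤
        LinearMap.ker (Algebra.lsmul ℂ ℂ P (quadOn d (oddIdx n) ^ j)) := by
      rw [Submodule.span_le]
      rintro _ ⟨l, ⟨hl, _⟩, rfl⟩
      exact (h.quad_pow_y_pow (k - 2 * l) j l).1 (by omega)
    have h3 : quadOn d (oddIdx n) ^ j • (casimirOp x d ^ i • x (Sum.inl ()) ^ k • v -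
        (k.descFactorial (2 * i) : ℂ) • x (Sum.inl ()) ^ (k - 2 * i) •
          quadOn x (oddIdx n) ^ i • v) = 0 := h2 h1
    rwa [smul_sub, sub_eq_zero] at h3
  refine eq_zero_of_triangular (fun i => casimirOp x d ^ i • x (Sum.inl ()) ^ k • v)
    (fun i => quadOn d (oddIdx n) ^ i) (n + 1) ?_ ?_ q hq
  · intro i hi l hl
    rcases key l (by omega) i with h1 | h1
    · simp only [h1]
      rw [smul_comm, (h.quad_pow_y_pow _ i l).1 hl, smul_zero]
    · omega
  · intro i hi
    rcases key i hi i with h1 | h1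
    · simp only [h1]
      rw [smul_comm]
      refine smul_ne_zero ?_ ((h.quad_pow_y_pow _ i i).2 rfl (by omega))
      have : k.descFactorial (2 * i) ≠ 0 := by
        rw [Ne, Nat.descFactorial_eq_zero_iff_lt]
        omega
      exact_mod_cast this
    · omega

end Fock

/-! ### Cyclicity -/

/-- The vectors of degree `r` in the odd variables. -/
noncomputable def oddPart (x : Idx n → A) (v : P) : ℕ → Submodule ℂ P
  | 0 => Submodule.span ℂ {v}
  | r + 1 => ⨆ j : OddIdx n, (oddPart x v r).map (Algebra.lsmul ℂ ℂ P (x (Sum.inr j)))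

theorem oddPart_le (N : ℕ → Submodule ℂ P) (h0 : v ∈ N 0)
    (hN : ∀ r, ∀ u ∈ oddPart x v r, u ∈ N r → ∀ j, x (Sum.inr j) • u ∈ N (r + 1)) (r : ℕ) :
    oddPart x v r ≤ N r := by
  induction r with
  | zero => exact (Submodule.span_singleton_le_iff_mem _ _).2 h0
  | succ r ih =>
    refine iSup_le fun j => ?_
    rw [Submodule.map_le_iff_le_comap]
    exact fun u hu => hN r u hu (ih hu) j

theorem smul_mem_oddPart {r : ℕ} (j : OddIdx n) {u : P} (hu : u ∈ oddPart x v r) :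
    x (Sum.inr j) • u ∈ oddPart x v (r + 1) :=
  Submodule.mem_iSup_of_mem j ⟨u, hu, rfl⟩

namespace Fock

variable (h : Fock x d σ ρ v)

include h

theorem dy_oddPart (r : ℕ) : ∀ u ∈ oddPart x v r, d (Sum.inl ()) • u = 0 := by
  refine oddPart_le (fun _ => LinearMap.ker (Algebra.lsmul ℂ ℂ P (d (Sum.inl ())))) (h.d_v _)
    (fun r u _ hu j => ?_) r
  change d (Sum.inl ()) • u = 0 at hu
  change d (Sum.inl ()) • x (Sum.inr j) • u = 0
  rw [← mul_smul, (h.toWeylRel.commute_dy_x j).eq, mul_smul, hu, smul_zero]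

theorem d_oddPart (i : OddIdx n) (r : ℕ) : ∀ u ∈ oddPart x v r, d (Sum.inr i) • u ∈
    (if r = 0 then ⊥ else oddPart x v (r - 1) : Submodule ℂ P) := by
  refine oddPart_le (fun r => (if r = 0 then ⊥ else oddPart x v (r - 1) : Submodule ℂ P).comap
    (Algebra.lsmul ℂ ℂ P (d (Sum.inr i)))) ?_ (fun r u hu hu' j => ?_) r
  · change d (Sum.inr i) • v ∈ (if 0 = 0 then ⊥ else oddPart x v (0 - 1) : Submodule ℂ P)
    rw [h.d_v]
    exact Submodule.zero_mem _
  · change d (Sum.inr i) • u ∈ (if r = 0 then ⊥ else oddPart x v (r - 1) : Submodule ℂ P) at hu'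
    change d (Sum.inr i) • x (Sum.inr j) • u ∈
      (if r + 1 = 0 then ⊥ else oddPart x v (r + 1 - 1) : Submodule ℂ P)
    rw [if_neg (Nat.succ_ne_zero r), Nat.add_sub_cancel, h.d_x_smul]
    refine Submodule.add_mem _ (Submodule.smul_mem _ _ ?_) (Submodule.smul_mem _ _ hu)
    rcases r with _ | r
    · rw [if_pos rfl, Submodule.mem_bot] at hu'
      rw [hu', smul_zero]
      exact Submodule.zero_mem _
    · rw [if_neg (Nat.succ_ne_zero r), Nat.add_sub_cancel] at hu'
      exact smul_mem_oddPart j hu'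

/-- The vectors of degree `k` are generated by `y^k` under the odd part of `osp(1|2n)`. -/
theorem degPart_le_of_odd_stable {k : ℕ} (N : Submodule ℂ P) (hv : x (Sum.inl ()) ^ k • v ∈ N)
    (hN : ∀ j : OddIdx n, ∀ u ∈ N, ospOp x d (Sum.inl ()) (Sum.inr j) • u ∈ N) :
    degPart x v k ≤ N := by
  -- Induction on the odd degree r, trading one factor y for one odd variable at a time.
  have key : ∀ r ≤ k, ∀ u ∈ oddPart x v r, x (Sum.inl ()) ^ (k - r) • u ∈ N := by
    intro r
    induction r using Nat.strong_induction_on with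
    | _ r ih =>
    intro hr u hu
    rcases r with _ | r
    · obtain ⟨c, rfl⟩ := Submodule.mem_span_singleton.1 hu
      rw [smul_comm]
      exact N.smul_mem _ hv
    · have : oddPart x v (r + 1) ≤ N.comap (Algebra.lsmul ℂ ℂ P (x (Sum.inl ()) ^ (k - (r + 1)))) := by
        refine iSup_le fun j => ?_
        rintro _ ⟨w, hw, rfl⟩
        change x (Sum.inl ()) ^ (k - (r + 1)) • x (Sum.inr j) • w ∈ N
        obtain ⟨b, hb⟩ : ∃ b, k = b + (r + 1) := ⟨k - (r + 1), by omega⟩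
        have h1 := ih r (Nat.lt_succ_self r) (by omega) w hw
        have e1 : k - r = b + 1 := by omega
        have e2 : k - (r + 1) = b := by omega
        rw [e1] at h1
        rw [e2]
        -- The generator is y ∂_{j'} ∓ x_j ∂_y. Its first term leads to odd degree r − 1, already in
        -- N; the second gives (b+1) y^b x_j w up to sign, and b + 1 is invertible.
        have h2 := hN j.swap _ h1
        have h3 : x (Sum.inl ()) • d (Sum.inr j.swap) • x (Sum.inl ()) ^ (b + 1) • w ∈ N := by
          have c : Commute (d (Sum.inr j.swap)) (x (Sum.inl ()) ^ (b + 1)) :=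
            ((h.toWeylRel.commute_y_d j.swap).pow_left (b + 1)).symm
          rw [← mul_smul (d _), c.eq, mul_smul, ← mul_smul (x _) (x _ ^ _), ← pow_succ']
          have h4 := h.d_oddPart j.swap r w hw
          rcases r with _ | r
          · rw [if_pos rfl, Submodule.mem_bot] at h4
            rw [h4, smul_zero]
            exact N.zero_mem
          · rw [if_neg (Nat.succ_ne_zero r), Nat.add_sub_cancel] at h4
            have h5 := ih r (by omega) (by omega) _ h4
            rwa [show k - r = b + 1 + 1 by omega] at h5
        have h6 : dualIdx (Sum.inr j.swap : Idx n) = Sum.inr j := by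
          rcases j with j | j <;> rfl
        have h7 := N.sub_mem h3 h2
        rw [ospOp, sub_smul, mul_smul, sub_sub_cancel, h6, smul_assoc, mul_smul] at h7
        have h8 := N.smul_mem (ospSign (Sum.inl () : Idx n) (Sum.inr j.swap)) h7
        rw [smul_smul, ospSign_mul_self, one_smul] at h8
        have h9 : d (dualIdx (Sum.inl () : Idx n)) • x (Sum.inl ()) ^ (b + 1) • w =
            ((b + 1 : ℕ) : ℂ) • x (Sum.inl ()) ^ b • w := by
          change d (Sum.inl ()) • x (Sum.inl ()) ^ (b + 1) • w = _
          rw [← mul_smul, h.toWeylRel.dy_y_pow, add_smul, mul_smul, h.dy_oddPart r w hw, smul_zero,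
            zero_add, smul_assoc, Nat.add_sub_cancel]
        have c2 : Commute (x (Sum.inr j)) (x (Sum.inl ()) ^ b) :=
          ((h.toWeylRel.commute_y_x j).pow_left b).symm
        rw [h9, smul_comm, ← mul_smul (x (Sum.inr j)), c2.eq, mul_smul] at h8
        have h10 : ((b + 1 : ℕ) : ℂ) ≠ 0 := by exact_mod_cast Nat.succ_ne_zero b
        have h11 := N.smul_mem (((b + 1 : ℕ) : ℂ)⁻¹) h8
        rwa [smul_smul, inv_mul_cancel₀ h10, one_smul] at h11
      exact this hu
  have hspan : ∀ k, degPart x v k ≤ Submodule.span ℂ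
      {w | ∃ r ≤ k, ∃ u ∈ oddPart x v r, w = x (Sum.inl ()) ^ (k - r) • u} := by
    refine degPart_le _ (Submodule.subset_span
      ⟨0, le_rfl, v, Submodule.mem_span_singleton_self v, by simp⟩) ?_
    intro k u _ hu i
    have : Submodule.span ℂ {w | ∃ r ≤ k, ∃ u ∈ oddPart x v r, w = x (Sum.inl ()) ^ (k - r) • u} ≤
        (Submodule.span ℂ {w | ∃ r ≤ k + 1, ∃ u ∈ oddPart x v r,
          w = x (Sum.inl ()) ^ (k + 1 - r) • u}).comap (Algebra.lsmul ℂ ℂ P (x i)) := by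
      rw [Submodule.span_le]
      rintro _ ⟨r, hr, w, hw, rfl⟩
      refine Submodule.subset_span ?_
      rcases i with ⟨⟩ | j
      · refine ⟨r, by omega, w, hw, ?_⟩
        change x (Sum.inl ()) • x (Sum.inl ()) ^ (k - r) • w = _
        rw [← mul_smul, ← pow_succ', show k - r + 1 = k + 1 - r by omega]
      · refine ⟨r + 1, by omega, x (Sum.inr j) • w, smul_mem_oddPart j hw, ?_⟩
        change x (Sum.inr j) • x (Sum.inl ()) ^ (k - r) • w = _
        have c2 : Commute (x (Sum.inr j)) (x (Sum.inl ()) ^ (k - r)) :=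
          ((h.toWeylRel.commute_y_x j).pow_left (k - r)).symm
        rw [← mul_smul, c2.eq, mul_smul, show k + 1 - (r + 1) = k - r by omega]
    exact this hu
  refine (hspan k).trans (Submodule.span_le.2 ?_)
  rintro _ ⟨r, hr, u, hu, rfl⟩
  exact key r hr u hu

end Fock

end Sl2

/-- If `Φ` is injective on the span of a linearly independent family `g`, and maps it into the span
of a family of the same size, then it maps it onto the latter. -/
theorem span_le_map_span {ι V W : Type*} [Fintype ι] [AddCommGroup V] [Module ℂ V]
    [AddCommGroup W] [Module ℂ W] (Φ : V →ₗ[ℂ] W) {g : ι → V} (hg : LinearIndependent ℂ g)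
    {e : ι → W} (he : ∀ i, Φ (g i) ∈ Submodule.span ℂ (Set.range e))
    (hΦ : ∀ T ∈ Submodule.span ℂ (Set.range g), Φ T = 0 → T = 0) :
    Submodule.span ℂ (Set.range e) ≤ (Submodule.span ℂ (Set.range g)).map Φ := by
  have h1 : LinearIndependent ℂ (Φ ∘ g) := hg.map (Submodule.disjoint_def.2 hΦ)
  have := FiniteDimensional.span_of_finite ℂ (Set.finite_range e)
  have h2 : Submodule.span ℂ (Set.range (Φ ∘ g)) = Submodule.span ℂ (Set.range e) := by
    refine Submodule.eq_of_le_of_finrank_le (Submodule.span_le.2 ?_) ?_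
    · rintro _ ⟨i, rfl⟩
      exact he i
    · rw [finrank_span_eq_card h1]
      exact finrank_range_le_card e
  rw [← h2, Set.range_comp, Submodule.map_span]

theorem aeval_smul_of_eigenvector {A P : Type*} [Ring A] [Algebra ℂ A] [AddCommGroup P]
    [Module ℂ P] [Module A P] [IsScalarTower ℂ A P] {T : A} {w : P} {c : ℂ} (hw : T • w = c • w)
    (p : ℂ[X]) : Polynomial.aeval T p • w = p.eval c • w := by
  induction p using Polynomial.induction_on' with
  | add p q hp hq => rw [map_add, add_smul, hp, hq, Polynomial.eval_add, add_smul]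
  | monomial a r =>
    have h1 : T ^ a • w = c ^ a • w := by
      induction a with
      | zero => simp
      | succ a ih => rw [pow_succ', mul_smul, ih, smul_comm, hw, smul_smul, pow_succ]
    rw [Polynomial.aeval_monomial, Polynomial.eval_monomial, ← Algebra.smul_def, smul_assoc, h1,
      smul_smul]

/-- The exponents `(a, i)` of the products `C^i E^a` of order at most `b`. -/
def exponents (n b : ℕ) : Finset (ℕ × ℕ) :=
  {p ∈ Finset.range (b + 1) ×ˢ Finset.range (n + 1) | p.1 + 2 * p.2 ≤ b}

theorem mem_exponents {n b : ℕ} {p : ℕ × ℕ} :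
    p ∈ exponents n b ↔ p.1 + 2 * p.2 ≤ b ∧ p.2 ≤ n := by
  simp only [exponents, Finset.mem_filter, Finset.mem_product, Finset.mem_range]
  omega

/-! ### The operators that commute with gosp(1|2n). -/

section Invariants

variable {n : ℕ} {A P : Type*} [Ring A] [Algebra ℂ A] [AddCommGroup P] [Module ℂ P]
  [Module A P] [IsScalarTower ℂ A P] {x d : Idx n → A} {σ ρ : A} {v : P}

/-- The span of the operators `x_i d_j`. -/
noncomputable def glSpan (x d : Idx n → A) : Submodule ℂ A :=
  Submodule.span ℂ (Set.range fun p : Idx n × Idx n => x p.1 * d p.2)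

theorem x_mul_d_mem_glSpan (i j : Idx n) : x i * d j ∈ glSpan x d :=
  Submodule.subset_span ⟨(i, j), rfl⟩

theorem ospOp_mem_glSpan (i j : Idx n) : ospOp x d i j ∈ glSpan x d :=
  Submodule.sub_mem _ (x_mul_d_mem_glSpan i j) (Submodule.smul_mem _ _ (x_mul_d_mem_glSpan _ _))

theorem eulerOn_mem_glSpan (S : Finset (Idx n)) : eulerOn x d S ∈ glSpan x d :=
  Submodule.sum_mem _ fun _ _ => x_mul_d_mem_glSpan _ _

theorem WeylRel.casimirOp_eq (h : WeylRel x d) :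
    casimirOp x d = -(1 / 2 : ℂ) • ∑ i : Idx n, ∑ j : Idx n,
      koszul (par j) (par j) • (ospOp x d i j * ospOp x d j i) :=
  (sum_ospOp_mul_ospOp h dualIdx_mem_univ).symm

theorem WeylRel.casimirOp_mem_glSpan (h : WeylRel x d) : casimirOp x d ∈ glSpan x d ^ 2 := by
  rw [h.casimirOp_eq, pow_two]
  exact Submodule.smul_mem _ _ (Submodule.sum_mem _ fun i _ => Submodule.sum_mem _ fun j _ =>
    Submodule.smul_mem _ _ (Submodule.mul_mem_mul (ospOp_mem_glSpan i j) (ospOp_mem_glSpan j i)))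

/-- The product `C^i E^a`. -/
noncomputable def casimirMonomial (x d : Idx n → A) (p : ℕ × ℕ) : A :=
  casimirOp x d ^ p.2 * eulerOn x d Finset.univ ^ p.1

/-- The span of the products `C^i E^a` of order at most `b`. -/
noncomputable def casimirSpan (x d : Idx n → A) (b : ℕ) : Submodule ℂ A :=
  Submodule.span ℂ (casimirMonomial x d '' exponents n b)

/-- The operators that commute with `gosp(1|2n)`. -/
noncomputable def commutant (x d : Idx n → A) : Subalgebra ℂ A :=
  Subalgebra.centralizer ℂ
    (insert (eulerOn x d Finset.univ) (Set.range fun p : Idx n × Idx n => ospOp x d p.1 p.2))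

theorem mem_commutant {T : A} : T ∈ commutant x d ↔
    eulerOn x d Finset.univ * T = T * eulerOn x d Finset.univ ∧
      ∀ i j, ospOp x d i j * T = T * ospOp x d i j := by
  rw [commutant, Subalgebra.mem_centralizer_iff, Set.forall_mem_insert, Set.forall_mem_range,
    Prod.forall]

theorem WeylRel.commute_eulerOn_ospOp (h : WeylRel x d) (i j : Idx n) :
    Commute (eulerOn x d Finset.univ) (ospOp x d i j) := by
  have h1 : ∀ i j, Commute (eulerOn x d Finset.univ) (x i * d j) := by
    intro i j
    have e1 := eulerOn_mul_x h (S := Finset.univ) i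
    have e2 := d_mul_eulerOn h (S := Finset.univ) j
    rw [if_pos (Finset.mem_univ _)] at e1 e2
    change _ * (_ * _) = _ * _ * _
    rw [← mul_assoc, e1, mul_assoc (x i) (d j), e2, add_mul, mul_add, mul_assoc]
  exact (h1 i j).sub_right ((h1 _ _).smul_right _)

theorem WeylRel.eulerOn_mem_commutant (h : WeylRel x d) :
    eulerOn x d Finset.univ ∈ commutant x d :=
  mem_commutant.2 ⟨rfl, fun i j => (h.commute_eulerOn_ospOp i j).eq.symm⟩

/-- The hypothesis `hC` is supplied on P(V) by `commute_casimirOp`, from the centrality of the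
Casimir element in the enveloping algebra. -/
theorem WeylRel.casimirOp_mem_commutant (h : WeylRel x d)
    (hC : ∀ i j, Commute (casimirOp x d) (ospOp x d i j)) : casimirOp x d ∈ commutant x d := by
  refine mem_commutant.2 ⟨?_, fun i j => (hC i j).eq.symm⟩
  rw [h.casimirOp_eq]
  exact (((Commute.sum_right _ _ _ fun i _ => Commute.sum_right _ _ _ fun j _ =>
    ((h.commute_eulerOn_ospOp i j).mul_right (h.commute_eulerOn_ospOp j i)).smul_right _)).smul_right
      _).eq

theorem WeylRel.casimirMonomial_mem_commutant (h : WeylRel x d)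
    (hC : ∀ i j, Commute (casimirOp x d) (ospOp x d i j)) (p : ℕ × ℕ) :
    casimirMonomial x d p ∈ commutant x d :=
  mul_mem (pow_mem (h.casimirOp_mem_commutant hC) _) (pow_mem h.eulerOn_mem_commutant _)

theorem WeylRel.casimirSpan_le_commutant (h : WeylRel x d)
    (hC : ∀ i j, Commute (casimirOp x d) (ospOp x d i j)) (b : ℕ) :
    casimirSpan x d b ≤ Subalgebra.toSubmodule (commutant x d) := by
  rw [casimirSpan, Submodule.span_le]
  rintro _ ⟨p, _, rfl⟩
  exact h.casimirMonomial_mem_commutant hC p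

namespace Fock

variable (h : Fock x d σ ρ v)

include h

omit [IsScalarTower ℂ A P] in
-- C is quadratic and E linear in the operators x_i d_j, so C^iE^a is a combination of products of
-- 2i + a of them.
theorem casimirSpan_le_bidegLE (b : ℕ) : casimirSpan x d b ≤ bidegLE x d b := by
  rw [casimirSpan, Submodule.span_le]
  rintro _ ⟨p, hp, rfl⟩
  have hp := (mem_exponents.1 (Finset.mem_coe.1 hp)).1
  have h1 := Submodule.pow_mem_pow _ h.toWeylRel.casimirOp_mem_glSpan p.2
  have h2 := Submodule.pow_mem_pow _ (eulerOn_mem_glSpan (x := x) (d := d) Finset.univ) p.1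
  have h3 := Submodule.mul_mem_mul h1 h2
  rw [← pow_mul, ← pow_add] at h3
  exact bidegLE_mono (by omega) (h.pow_le_bidegLE _ h3)

theorem eulerOn_y_pow (k : ℕ) : eulerOn x d Finset.univ • x (Sum.inl ()) ^ k • v =
    (k : ℂ) • x (Sum.inl ()) ^ k • v := by
  have := h.euler_degPart _ _ (mem_degPart_y_pow (x := x) (v := v) k 0)
  simpa using this

theorem ospOp_y_pow (i j : OddIdx n) (k : ℕ) :
    ospOp x d (Sum.inr i) (Sum.inr j) • x (Sum.inl ()) ^ k • v = 0 := by
  have h1 : ∀ j : OddIdx n, d (Sum.inr j) • x (Sum.inl ()) ^ k • v = 0 := by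
    intro j
    rw [← mul_smul, ((h.toWeylRel.commute_y_d j).pow_left k).eq.symm, mul_smul, h.d_v, smul_zero]
  have h2 : dualIdx (Sum.inr i : Idx n) = Sum.inr i.swap := rfl
  rw [ospOp, sub_smul, mul_smul, h1, smul_zero, smul_assoc, mul_smul (x _), h2, h1, smul_zero,
    smul_zero, sub_zero]

/-- An operator that commutes with `E` and with `sp(2n)` maps `y^k` to an `sp(2n)`-invariant. -/
theorem smul_y_pow_mem {T : A}
    (hE : eulerOn x d Finset.univ * T = T * eulerOn x d Finset.univ)
    (hT : ∀ i j : OddIdx n, ospOp x d (Sum.inr i) (Sum.inr j) * T =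
      T * ospOp x d (Sum.inr i) (Sum.inr j)) (k : ℕ) :
    T • x (Sum.inl ()) ^ k • v ∈ Submodule.span ℂ
      ((fun i => x (Sum.inl ()) ^ (k - 2 * i) • quadOn x (oddIdx n) ^ i • v) ''
        {i | i ≤ n ∧ 2 * i ≤ k}) := by
  refine h.mem_span_of_invariant ?_ ?_
  · rw [← mul_smul, hE, mul_smul, h.eulerOn_y_pow, smul_comm]
  -- Written as a sum of F_{ij}F_{ji} over odd indices, the sp(2n) Casimir operator kills T y^k: the
  -- factor F_{ji} passes through T and annihilates y^k.
  · rw [← sum_ospOp_mul_ospOp h.toWeylRel dualIdx_mem_oddIdx, smul_assoc, Finset.sum_smul]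
    rw [Finset.sum_eq_zero, smul_zero]
    intro i hi
    rw [Finset.sum_smul]
    refine Finset.sum_eq_zero fun j hj => ?_
    obtain ⟨i, rfl⟩ := mem_oddIdx.1 hi
    obtain ⟨j, rfl⟩ := mem_oddIdx.1 hj
    rw [smul_assoc, mul_smul (ospOp x d (Sum.inr i) (Sum.inr j)), ← mul_smul _ T, hT, mul_smul T,
      h.ospOp_y_pow, smul_zero, smul_zero, smul_zero]

/-- An operator that commutes up to scalars with the odd part of `osp(1|2n)` is determined on
vectors of degree `k` by its value on `y^k`. -/
theorem eq_zero_of_y_pow {T : A} {c : ℂ}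
    (hT : ∀ j : OddIdx n, T * ospOp x d (Sum.inl ()) (Sum.inr j) =
      c • (ospOp x d (Sum.inl ()) (Sum.inr j) * T)) {k : ℕ}
    (hk : T • x (Sum.inl ()) ^ k • v = 0) : ∀ u ∈ degPart x v k, T • u = 0 := by
  intro u hu
  refine h.degPart_le_of_odd_stable (LinearMap.ker (Algebra.lsmul ℂ ℂ P T)) hk (fun j u hu => ?_) hu
  change T • u = 0 at hu
  change T • ospOp x d (Sum.inl ()) (Sum.inr j) • u = 0
  rw [← mul_smul, hT, smul_assoc, mul_smul (ospOp x d (Sum.inl ()) (Sum.inr j)), hu, smul_zero,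
    smul_zero]

theorem commutant_eq_zero {T : A} (hT : T ∈ commutant x d) {k : ℕ}
    (hk : T • x (Sum.inl ()) ^ k • v = 0) : ∀ u ∈ degPart x v k, T • u = 0 :=
  h.eq_zero_of_y_pow (c := 1) (fun j => by rw [one_smul, (mem_commutant.1 hT).2]) hk

/-- On y^K the operator E is the scalar K, so a linear relation becomes a relation among the C^i y^K
with coefficients polynomial in K. By `casimirOp_independent` these polynomials vanish at all
integers K ≥ 2n, hence identically. -/
theorem casimirMonomial_linearIndependent (b : ℕ) :
    LinearIndepOn ℂ (casimirMonomial x d) (exponents n b : Set (ℕ × ℕ)) := by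
  rw [linearIndepOn_finset_iff]
  intro f hf
  let q : ℕ → ℂ[X] := fun i =>
    ∑ p ∈ exponents n b, if p.2 = i then Polynomial.monomial p.1 (f p) else 0
  have h1 : ∀ K, 2 * n ≤ K → ∀ i < n + 1, (q i).eval (K : ℂ) = 0 := by
    intro K hK
    refine h.casimirOp_independent hK _ ?_
    have h2 : ∀ p : ℕ × ℕ, casimirMonomial x d p • x (Sum.inl ()) ^ K • v =
        (K : ℂ) ^ p.1 • casimirOp x d ^ p.2 • x (Sum.inl ()) ^ K • v := by
      intro p
      have h3 := aeval_smul_of_eigenvector (h.eulerOn_y_pow K) (Polynomial.X ^ p.1)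
      rw [map_pow, Polynomial.aeval_X, Polynomial.eval_pow, Polynomial.eval_X] at h3
      rw [casimirMonomial, mul_smul, h3, smul_comm]
    have h4 := congrArg (fun T : A => T • x (Sum.inl ()) ^ K • v) hf
    simp only [Finset.sum_smul, zero_smul, smul_assoc, h2] at h4
    rw [← h4]
    have h5 : ∀ i, (q i).eval (K : ℂ) =
        ∑ p ∈ exponents n b, if p.2 = i then f p * (K : ℂ) ^ p.1 else 0 := by
      intro i
      rw [Polynomial.eval_finsetSum]
      refine Finset.sum_congr rfl fun p _ => ?_
      split_ifs
      · rw [Polynomial.eval_monomial]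
      · rw [Polynomial.eval_zero]
    simp only [h5, Finset.sum_smul]
    rw [Finset.sum_comm]
    refine Finset.sum_congr rfl fun p hp => ?_
    have hp := (mem_exponents.1 hp).2
    rw [Finset.sum_eq_single p.2, if_pos rfl, mul_smul]
    · intro i _ hi
      rw [if_neg hi.symm, zero_smul]
    · intro hp'
      exact absurd (Finset.mem_range.2 (by omega)) hp'
  have h2 : ∀ i < n + 1, q i = 0 := by
    intro i hi
    refine Polynomial.eq_zero_of_infinite_isRoot _ (Set.Infinite.mono ?_
      ((Set.Ici_infinite (2 * n)).image (Nat.cast_injective (R := ℂ)).injOn))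
    rintro _ ⟨K, hK, rfl⟩
    exact h1 K hK i hi
  intro p hp
  have h3 := congrArg (fun g => Polynomial.coeff g p.1) (h2 p.2 (by
    have := (mem_exponents.1 hp).2
    omega))
  simp only [q, Polynomial.finsetSum_coeff, Polynomial.coeff_zero] at h3
  rw [Finset.sum_eq_single p, if_pos rfl, Polynomial.coeff_monomial, if_pos rfl] at h3
  · exact h3
  · intro r _ hr
    split_ifs with h4
    · rw [Polynomial.coeff_monomial, if_neg]
      intro h5
      exact hr (Prod.ext h5 h4)
    · rw [Polynomial.coeff_zero]
  · exact fun hp' => absurd hp hp'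

omit h in
variable (x v) in
/-- The values of an operator on `y^k` for `k ≤ b`. -/
noncomputable def yValues (b : ℕ) : A →ₗ[ℂ] (ℕ → P) :=
  ∑ k ∈ Finset.range (b + 1), LinearMap.single ℂ (fun _ => P) k ∘ₗ
    (Algebra.lsmul ℂ ℂ P).toLinearMap.flip (x (Sum.inl ()) ^ k • v)

omit h in
theorem yValues_apply {b k : ℕ} (hk : k ≤ b) (T : A) :
    yValues x v b T k = T • x (Sum.inl ()) ^ k • v := by
  rw [yValues, LinearMap.sum_apply, Finset.sum_apply, Finset.sum_eq_single k]
  · simp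
  · intro j _ hj
    simp [hj.symm]
  · intro hk'
    exact absurd (Finset.mem_range.2 (by omega)) hk'

variable (x v) in
omit h in
/-- The `sp(2n)`-invariant of degree `a + 2i`, placed in this degree. -/
noncomputable def invariantVector (p : ℕ × ℕ) : ℕ → P :=
  Pi.single (p.1 + 2 * p.2) (x (Sum.inl ()) ^ p.1 • quadOn x (oddIdx n) ^ p.2 • v)

omit h [IsScalarTower ℂ A P] in
theorem single_mem_span {b k : ℕ} (hk : k ≤ b) {u : P} (hu : u ∈ Submodule.span ℂ
      ((fun i => x (Sum.inl ()) ^ (k - 2 * i) • quadOn x (oddIdx n) ^ i • v) ''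
        {i | i ≤ n ∧ 2 * i ≤ k})) :
    (Pi.single k u : ℕ → P) ∈ Submodule.span ℂ (invariantVector x v '' exponents n b) := by
  have : Submodule.span ℂ
      ((fun i => x (Sum.inl ()) ^ (k - 2 * i) • quadOn x (oddIdx n) ^ i • v) ''
        {i | i ≤ n ∧ 2 * i ≤ k}) ≤ (Submodule.span ℂ (invariantVector x v '' exponents n b)).comap
          (LinearMap.single ℂ (fun _ => P) k) := by
    rw [Submodule.span_le]
    rintro _ ⟨i, ⟨hi, hik⟩, rfl⟩
    refine Submodule.subset_span ⟨(k - 2 * i, i), ?_, ?_⟩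
    · exact mem_exponents.2 ⟨by simp only; omega, hi⟩
    · have e : k - 2 * i + 2 * i = k := by omega
      simp only [invariantVector, e]
      rfl
  exact this hu

theorem yValues_mem (b : ℕ) {T : A} (hT : T ∈ commutant x d) :
    yValues x v b T ∈ Submodule.span ℂ (invariantVector x v '' exponents n b) := by
  rw [yValues, LinearMap.sum_apply]
  refine Submodule.sum_mem _ fun k hk => single_mem_span (by have := Finset.mem_range.1 hk; omega) ?_
  obtain ⟨h1, h2⟩ := mem_commutant.1 hT
  exact h.smul_y_pow_mem h1 (fun i j => h2 _ _) k

/-- Vanishing on y^k propagates to all of degree k by cyclicity, and vanishing in degrees at most b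
is enough for an operator of order at most b. -/
theorem eq_zero_of_yValues {b : ℕ} {T : A} (hT : T ∈ commutant x d) (hb : T ∈ orderLE x d b)
    (h0 : yValues x v b T = 0) : T = 0 := by
  refine h.eq_zero_of_orderLE b T hb fun k hk => h.commutant_eq_zero hT ?_
  rw [← yValues_apply hk, h0]
  rfl

variable (hC : ∀ i j, Commute (casimirOp x d) (ospOp x d i j))

include hC

/-- The dimension count: the independent family C^iE^a is mapped injectively by `yValues` into the
span of a family with the same index set, hence onto it. -/
theorem span_invariantVector_le (b : ℕ) :
    Submodule.span ℂ (invariantVector x v '' exponents n b) ≤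
      (casimirSpan x d b).map (yValues x v b) := by
  rw [casimirSpan, Set.image_eq_range, Set.image_eq_range]
  refine span_le_map_span _ (h.casimirMonomial_linearIndependent b) ?_ ?_
  · rintro ⟨p, hp⟩
    rw [← Set.image_eq_range]
    exact h.yValues_mem b (h.toWeylRel.casimirMonomial_mem_commutant hC p)
  · intro T hT
    rw [← Set.image_eq_range] at hT
    exact h.eq_zero_of_yValues (h.toWeylRel.casimirSpan_le_commutant hC b hT)
      (bidegLE_le_orderLE (h.casimirSpan_le_bidegLE b hT))

/-- The differential operators that commute with `gosp(1|2n)` are polynomials in `C` and `E`. -/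
theorem mem_casimirSpan {b : ℕ} {T : A} (hT : T ∈ commutant x d) (hb : T ∈ orderLE x d b) :
    T ∈ casimirSpan x d b := by
  obtain ⟨S, hS, hST⟩ := h.span_invariantVector_le hC b (h.yValues_mem b hT)
  have h1 : T - S = 0 := h.eq_zero_of_yValues (b := b)
    (sub_mem hT (h.toWeylRel.casimirSpan_le_commutant hC b hS))
    (Submodule.sub_mem _ hb (bidegLE_le_orderLE (h.casimirSpan_le_bidegLE b hS)))
    (by rw [map_sub, hST, sub_self])
  rwa [sub_eq_zero.1 h1]

/-- The Capelli operators. -/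
theorem exists_capelli {k m : ℕ} (hm : m ≤ k) (hmk : m % 2 = k % 2) :
    ∃ T ∈ bideg x d k, T ∈ casimirSpan x d k ∧ ∀ j m', m' + 2 * j = k →
      ∀ u ∈ harmonicPart x d v m', T • quadOn x Finset.univ ^ j • u =
        if m' = m then quadOn x Finset.univ ^ j • u else 0 := by
  let c : ℕ → ℂ := fun m => m * (2 * n + 1 - m)
  -- The harmonic degrees that can occur in degree k. The only coincidence among the eigenvalues is
  -- between m and 2n + 1 − m, which have opposite parity, so they are distinct on `s`.
  let s : Finset ℕ := {i ∈ Finset.range (k + 1) | i % 2 = k % 2}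
  have hs : ∀ i, i ∈ s ↔ i ≤ k ∧ i % 2 = k % 2 := by
    intro i
    simp only [s, Finset.mem_filter, Finset.mem_range]
    omega
  have hc : Set.InjOn c s := by
    intro i hi j hj hij
    have hi := (hs i).1 hi
    have hj := (hs j).1 hj
    by_contra hne
    have h1 : ((i : ℂ) - j) * (2 * n + 1 - i - j) = 0 := by
      simp only [c] at hij
      linear_combination hij
    rcases mul_eq_zero.1 h1 with h2 | h2
    · exact hne (by exact_mod_cast sub_eq_zero.1 h2)
    · have h3 : ((2 * n + 1 : ℕ) : ℂ) = ((i + j : ℕ) : ℂ) := by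
        push_cast
        linear_combination h2
      have h4 : 2 * n + 1 = i + j := by exact_mod_cast h3
      omega
  -- In degree k this polynomial in C is the wanted projection, but it need not have bidegree (k,
  -- k).
  set L := Polynomial.aeval (casimirOp x d) (Lagrange.basis s c m) with hL
  have hLc : L ∈ commutant x d := by
    have h1 : L ∈ Algebra.adjoin ℂ {casimirOp x d} :=
      Polynomial.aeval_mem_adjoin_singleton ℂ _
    exact Algebra.adjoin_le (by simpa using h.toWeylRel.casimirOp_mem_commutant hC) h1
  obtain ⟨hL1, hL2⟩ := mem_commutant.1 hLc
  -- T is chosen with the value of L on y^k and the value 0 on all lower powers of y; by cyclicity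
  -- it agrees with L in degree k and kills all lower degrees.
  obtain ⟨T, hT, hTL⟩ := h.span_invariantVector_le hC k
    (single_mem_span le_rfl (h.smul_y_pow_mem hL1 (fun i j => hL2 _ _) k))
  have hTc : T ∈ commutant x d := h.toWeylRel.casimirSpan_le_commutant hC k hT
  have hT0 : ∀ j < k, ∀ u ∈ degPart x v j, T • u = 0 := by
    intro j hj
    refine h.commutant_eq_zero hTc ?_
    rw [← yValues_apply hj.le, hTL, Pi.single_eq_of_ne hj.ne]
  have hTk : ∀ u ∈ degPart x v k, T • u = L • u := by
    intro u hu
    have h1 := h.commutant_eq_zero (sub_mem hTc hLc) (k := k) (by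
      rw [sub_smul, ← yValues_apply le_rfl, hTL, Pi.single_eq_same, sub_self]) u hu
    rwa [sub_smul, sub_eq_zero] at h1
  refine ⟨T, h.mem_bideg_of_eq_zero (h.casimirSpan_le_bidegLE k hT) hT0, hT, ?_⟩
  rintro j m' hjm u ⟨hu, hLu⟩
  have hu' := quadOn_pow_mem_degPart Finset.univ hu j
  rw [hjm] at hu'
  rw [hTk _ hu', hL, aeval_smul_of_eigenvector
    (h.toWeylRel.casimirOp_harmonic (h.euler_degPart _ _ hu) hLu j)]
  have hm's : m' ∈ s := (hs m').2 (by omega)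
  have hms : m ∈ s := (hs m).2 ⟨hm, hmk⟩
  split_ifs with h1
  · subst h1
    have := Lagrange.eval_basis_self hc hms
    simp only [c] at this
    rw [this, one_smul]
  · have := Lagrange.eval_basis_of_ne (v := c) (Ne.symm h1) hm's
    simp only [c] at this
    rw [this, zero_smul]

omit hC in
/-- An element of `PD^k(V)` is determined by its action on the summands of `P^k(V)`. -/
theorem eq_of_harmonic {k : ℕ} {T T' : A} (hT : T ∈ bideg x d k) (hT' : T' ∈ bideg x d k)
    (h0 : ∀ j m, m + 2 * j = k → k / 2 ≤ j + n → ∀ u ∈ harmonicPart x d v m,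
      T • quadOn x Finset.univ ^ j • u = T' • quadOn x Finset.univ ^ j • u) : T = T' := by
  refine sub_eq_zero.1 (h.eq_zero_of_bideg (Submodule.sub_mem _ hT hT') fun u hu => ?_)
  rw [sub_smul, sub_eq_zero]
  have h1 : Submodule.span ℂ (harmonicProducts x d v k) ≤
      LinearMap.eqLocus (Algebra.lsmul ℂ ℂ P T) (Algebra.lsmul ℂ ℂ P T') := by
    rw [Submodule.span_le]
    rintro _ ⟨j, hj, w, hw, rfl⟩
    change T • quadOn x Finset.univ ^ j • w = T' • quadOn x Finset.univ ^ j • w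
    by_cases hjn : k / 2 ≤ j + n
    · exact h0 j (k - 2 * j) (by omega) hjn w hw
    -- Outside the index range the harmonic degree k − 2j is at least 2n + 2, so the summand is
    -- zero.
    · rw [h.harmonic_eq_zero (by omega) hw, smul_zero, smul_zero, smul_zero]
  exact h1 (h.degPart_le_harmonic k hu)

omit hC in
theorem parity_fixes_invariant {k : ℕ} {u : P} (hu : u ∈ Submodule.span ℂ
      ((fun i => x (Sum.inl ()) ^ (k - 2 * i) • quadOn x (oddIdx n) ^ i • v) ''
        {i | i ≤ n ∧ 2 * i ≤ k})) : σ • u = u := by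
  have h1 : Submodule.span ℂ
      ((fun i => x (Sum.inl ()) ^ (k - 2 * i) • quadOn x (oddIdx n) ^ i • v) ''
        {i | i ≤ n ∧ 2 * i ≤ k}) ≤ LinearMap.eqLocus (Algebra.lsmul ℂ ℂ P σ) LinearMap.id := by
    rw [Submodule.span_le]
    rintro _ ⟨i, -, rfl⟩
    have c1 : Commute σ (x (Sum.inl ())) := by
      have := h.σ_x (Sum.inl ())
      rwa [show par (Sum.inl () : Idx n) = 0 from rfl, koszul_zero_right, one_smul] at this
    have c2 : Commute σ (quadOn x (oddIdx n)) := by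
      refine Commute.sum_right _ _ _ fun i _ => Commute.smul_right ?_ _
      change σ * (x i * x (dualIdx i)) = x i * x (dualIdx i) * σ
      rw [← mul_assoc, h.σ_x, smul_mul_assoc, mul_assoc, h.σ_x, mul_smul_comm, smul_smul,
        par_dualIdx, koszul_mul_self, one_smul, mul_assoc]
    change σ • x (Sum.inl ()) ^ (k - 2 * i) • quadOn x (oddIdx n) ^ i • v = _
    rw [← mul_smul, (c1.pow_right _).eq, mul_smul, ← mul_smul σ, (c2.pow_right _).eq, mul_smul,
      h.σ_v]
    rfl
  exact h1 hu

omit hC in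
/-- There are no odd differential operators that commute up to sign with `gosp(1|2n)`. -/
theorem odd_eq_zero {b : ℕ} {T : A} (hb : T ∈ orderLE x d b) (hσ : σ * T = koszul 1 1 • (T * σ))
    (hE : eulerOn x d Finset.univ * T = T * eulerOn x d Finset.univ)
    (hT : ∀ i j : OddIdx n, ospOp x d (Sum.inr i) (Sum.inr j) * T =
      T * ospOp x d (Sum.inr i) (Sum.inr j)) {c : ℂ}
    (hQ : ∀ j : OddIdx n, T * ospOp x d (Sum.inl ()) (Sum.inr j) =
      c • (ospOp x d (Sum.inl ()) (Sum.inr j) * T)) : T = 0 := by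
  refine h.eq_zero_of_orderLE b T hb fun k _ => h.eq_zero_of_y_pow hQ ?_
  -- T y^k is even as an sp(2n)-invariant and odd because T is odd, so it equals its own negative.
  have h1 := h.parity_fixes_invariant (h.smul_y_pow_mem hE hT k)
  have h2 : σ • x (Sum.inl ()) ^ k • v = x (Sum.inl ()) ^ k • v :=
    h.parity_fixes_invariant (k := k) (Submodule.subset_span ⟨0, ⟨by omega, by omega⟩, by simp⟩)
  rw [← mul_smul, hσ, koszul_one_one, neg_smul, one_smul, neg_smul, mul_smul, h2] at h1
  have h3 : (2 : ℂ) • T • x (Sum.inl ()) ^ k • v = 0 := by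
    rw [two_smul]
    nth_rewrite 1 [← h1]
    exact neg_add_cancel _
  exact (smul_eq_zero.1 h3).resolve_left two_ne_zero

end Fock

end Invariants

/-! ### The Casimir element is central -/

section Central

variable {n : ℕ}

theorem ospSign_mul_ospSign (i j b : Idx n) :
    ospSign i j * ospSign j b = koszul (par j + par b) (par i + par j) * ospSign i b := by
  have e1 := koszul_mul_self (par i) (par b)
  have e2 := dualSign_mul_self j
  simp only [ospSign, koszul_add_left, koszul_add_right, koszul_comm (par b) (par i),
    koszul_comm (par j) (par i), koszul_comm (par b) (par j)]
  linear_combination (koszul (par i) (par j) * koszul (par j) (par j) * koszul (par j) (par b) *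
    koszul (par b) (par b) * dualSign i * dualSign b) * (e2 - e1)

theorem ospMatrix_eq (i j : Idx n) : ospMatrix i j =
    Matrix.single i j 1 - ospSign i j • Matrix.single (dualIdx j) (dualIdx i) 1 := rfl

theorem mul_single_eq (X : Mat n) (i j : Idx n) :
    X * Matrix.single i j (1 : ℂ) = ∑ a, X a i • Matrix.single a j (1 : ℂ) := by
  ext c e
  rw [Matrix.sum_apply, Finset.sum_eq_single c]
  · by_cases he : j = e
    · subst he
      simp
    · rw [Matrix.mul_single_apply_of_ne _ _ _ _ _ (Ne.symm he)]
      simp [he]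
  · intro b _ hb
    simp [hb]
  · simp

theorem single_mul_eq (X : Mat n) (i j : Idx n) :
    Matrix.single i j (1 : ℂ) * X = ∑ b, X j b • Matrix.single i b (1 : ℂ) := by
  ext c e
  rw [Matrix.sum_apply, Finset.sum_eq_single e]
  · by_cases he : i = c
    · subst he
      simp
    · rw [Matrix.single_mul_apply_of_ne _ _ _ _ _ (Ne.symm he)]
      simp [he]
  · intro b _ hb
    simp [hb]
  · simp

theorem comp_ospMatrix (i j : Idx n) :
    comp n (par i + par j) (ospMatrix i j) = ospMatrix i j := by
  ext a b
  rw [comp_apply]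
  split_ifs with h
  · rfl
  · rw [ospMatrix_eq, Matrix.sub_apply, Matrix.smul_apply, Matrix.single_apply_of_ne,
      Matrix.single_apply_of_ne, smul_zero, sub_zero]
    · rintro ⟨rfl, rfl⟩
      exact h (by rw [par_dualIdx, par_dualIdx, add_comm])
    · rintro ⟨rfl, rfl⟩
      exact h rfl

/-- F_{ij} transforms under osp exactly as the matrix unit E_{ij} does: since X^† = −X, the map E ↦
E − E^† is equivariant. -/
theorem superBracket_ospMatrix {q : ZMod 2} {X : Mat n} (hX : comp n q X = X) (hX' : X ∈ osp n)
    (i j : Idx n) : superBracket X (ospMatrix i j) =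
      ∑ a, X a i • ospMatrix a j - koszul q (par i + par j) • ∑ b, X j b • ospMatrix i b := by
  have hd := fun i j => (mem_osp_iff X).1 hX' i j
  have hq : ∀ i j, X i j = 0 ∨ q = par i + par j := by
    intro i j
    by_cases h : par i + par j = q
    · exact Or.inr h.symm
    · left
      rw [← hX, comp_apply, if_neg h]
  -- The symmetry of the entries of X converts its left action on the adjoint unit into an action on
  -- the index j; `ospSign_mul_ospSign` matches the signs.
  have h1 : ospSign i j • (X * Matrix.single (dualIdx j) (dualIdx i) (1 : ℂ)) =
      -(koszul q (par i + par j) • ∑ b, X j b • ospSign i b •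
        Matrix.single (dualIdx b) (dualIdx i) (1 : ℂ)) := by
    rw [mul_single_eq, ← sum_dualIdx_of_mem dualIdx_mem_univ, Finset.smul_sum, Finset.smul_sum,
      ← Finset.sum_neg_distrib]
    refine Finset.sum_congr rfl fun b _ => ?_
    rw [hd j b, smul_smul, smul_smul, smul_smul, ← neg_smul]
    congr 1
    have h2 := ospSign_mul_ospSign i j b
    rcases hq j b with h0 | h0
    · simp [h0]
    · rw [h0]
      change ospSign i j * -(ospSign j b * X j b) = _
      linear_combination -X j b * h2
  have h3 : ospSign i j • (Matrix.single (dualIdx j) (dualIdx i) (1 : ℂ) * X) =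
      -(koszul q (par i + par j) • ∑ a, X a i • ospSign a j •
        Matrix.single (dualIdx j) (dualIdx a) (1 : ℂ)) := by
    rw [single_mul_eq, ← sum_dualIdx_of_mem dualIdx_mem_univ, Finset.smul_sum, Finset.smul_sum,
      ← Finset.sum_neg_distrib]
    refine Finset.sum_congr rfl fun a _ => ?_
    rw [hd a i, smul_smul, smul_smul, smul_smul, ← neg_smul]
    congr 1
    have h2 := ospSign_mul_ospSign a i j
    rcases hq a i with h0 | h0
    · simp [h0]
    · rw [h0]
      change ospSign i j * -(ospSign a i * X a i) = _
      rw [koszul_comm] at h2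
      linear_combination -X a i * h2
  have h4 := koszul_mul_self q (par i + par j)
  rw [superBracket_eq hX (comp_ospMatrix i j)]
  simp only [ospMatrix_eq, mul_sub, sub_mul, mul_smul_comm, smul_mul_assoc, smul_sub, h1, h3,
    Finset.sum_sub_distrib]
  rw [mul_single_eq, single_mul_eq, smul_neg, smul_smul, h4, one_smul]
  abel

/-- An element that acts on the `F_{ij}` by the super commutator with a matrix commutes with the
Casimir tensor. -/
theorem commute_casimir {A : Type*} [Ring A] [Algebra ℂ A] (F : Idx n → Idx n → A) {T : A}
    {q : ZMod 2} {X : Mat n} (hX : comp n q X = X)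
    (hT : ∀ i j, T * F i j = koszul q (par i + par j) • (F i j * T) + (∑ a, X a i • F a j -
      koszul q (par i + par j) • ∑ b, X j b • F i b)) :
    Commute T (∑ i, ∑ j, koszul (par j) (par j) • (F i j * F j i)) := by
  have h1 : ∀ i j, T * (F i j * F j i) = F i j * F j i * T +
      ((koszul q (par i + par j) • ∑ a, X a j • (F i j * F a i) - ∑ b, X i b • (F i j * F j b)) +
      (∑ a, X a i • (F a j * F j i) -
        koszul q (par i + par j) • ∑ b, X j b • (F i b * F j i))) := by
    intro i j
    rw [← mul_assoc, hT, add_mul, smul_mul_assoc, mul_assoc (F i j) T, hT j i, add_comm (par j)]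
    simp only [mul_add, mul_sub, sub_mul, Finset.mul_sum, Finset.sum_mul, mul_smul_comm,
      smul_mul_assoc, smul_add, smul_sub, smul_smul, koszul_mul_self, one_smul, one_mul,
      Finset.smul_sum, ← mul_assoc]
    abel
  -- The four commutator terms cancel in two pairs by renaming summation indices: here the outer
  -- indices, next the contracted ones, where signs agree because X has only entries of parity q.
  have h2 : ∑ i, ∑ j, koszul (par j) (par j) • ∑ b, X i b • (F i j * F j b) =
      ∑ i, ∑ j, koszul (par j) (par j) • ∑ a, X a i • (F a j * F j i) := by
    simp only [Finset.smul_sum]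
    rw [Finset.sum_comm]
    conv_rhs => rw [Finset.sum_comm]
    exact Finset.sum_congr rfl fun j _ => Finset.sum_comm
  have h3 : ∀ i, ∑ j, koszul (par j) (par j) • koszul q (par i + par j) •
        ∑ a, X a j • (F i j * F a i) =
      ∑ j, koszul (par j) (par j) • koszul q (par i + par j) • ∑ b, X j b • (F i b * F j i) := by
    intro i
    simp only [Finset.smul_sum]
    rw [Finset.sum_comm]
    refine Finset.sum_congr rfl fun a _ => Finset.sum_congr rfl fun j _ => ?_
    rw [smul_smul, smul_smul, smul_smul, smul_smul]
    congr 1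
    by_cases h : par a + par j = q
    · subst h
      have e1 := koszul_mul_self (par j) (par j)
      have e2 := koszul_mul_self (par a) (par a)
      simp only [koszul_add_left, koszul_add_right, koszul_comm (par j) (par a)]
      linear_combination (koszul (par a) (par i) * koszul (par j) (par i) *
        koszul (par a) (par j) * X a j) * (e1 - e2)
    · have : X a j = 0 := by rw [← hX, comp_apply, if_neg h]
      rw [this, mul_zero, mul_zero]
  change T * _ = _ * T
  simp only [Finset.mul_sum, Finset.sum_mul, mul_smul_comm, smul_mul_assoc, h1, smul_add, smul_sub,
    Finset.sum_add_distrib, Finset.sum_sub_distrib]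
  rw [h2]
  simp only [h3]
  abel

end Central

/-! ### Central elements of the enveloping algebra and their action. -/

section Env

variable {n : ℕ}

theorem envι_mul_envι {p q : ZMod 2} {x y : Gosp n} (hx : x ∈ gospPart n p)
    (hy : y ∈ gospPart n q) : envι n x * envι n y =
      koszul p q • (envι n y * envι n x) + envι n (gospBracket x y) := by
  have := RingQuot.mkAlgHom_rel ℂ (EnvRel.bracket p q x y hx hy)
  rw [map_add, map_smul, map_mul, map_mul] at this
  exact this

theorem envAction_envι (x : Gosp n) : envAction n (envι n x) = gospAction n x := by
  have : envAction n (RingQuot.mkAlgHom ℂ (EnvRel n) (TensorAlgebra.ι ℂ x)) =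
      TensorAlgebra.lift ℂ (gospAction n) (TensorAlgebra.ι ℂ x) :=
    RingQuot.liftAlgHom_mkAlgHom_apply ..
  exact this.trans (TensorAlgebra.lift_ι_apply ..)

theorem ospGen_mem_gospPart (i j : Idx n) :
    ((0, ospGen i j) : Gosp n) ∈ gospPart n (par i + par j) := ⟨fun _ => rfl, comp_ospMatrix i j⟩

theorem one_zero_mem_gospPart : ((1, 0) : Gosp n) ∈ gospPart n 0 :=
  ⟨fun h => absurd h (by decide), map_zero _⟩

theorem gospBracket_one_zero (x : Gosp n) : gospBracket ((1, 0) : Gosp n) x = 0 := by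
  refine Prod.ext rfl (Subtype.ext ?_)
  change superBracket (0 : Mat n) _ = 0
  simp [superBracket]

theorem gospBracket_ospGen {q : ZMod 2} {x : Gosp n} (hx : x ∈ gospPart n q) (i j : Idx n) :
    gospBracket x (0, ospGen i j) = ∑ a, (x.2 : Mat n) a i • ((0, ospGen a j) : Gosp n) -
      koszul q (par i + par j) • ∑ b, (x.2 : Mat n) j b • ((0, ospGen i b) : Gosp n) := by
  refine Prod.ext ?_ (Subtype.ext ?_)
  · simp [gospBracket, Prod.fst_sum]
  · simp only [gospBracket, Prod.snd_sub, Prod.snd_sum, Prod.smul_snd, AddSubgroupClass.coe_sub,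
      AddSubmonoidClass.coe_finsetSum, Submodule.coe_smul]
    exact superBracket_ospMatrix hx.2 x.2.2 i j

theorem commute_envZ {q : ZMod 2} {x : Gosp n} (hx : x ∈ gospPart n q) :
    Commute (envZ n) (envι n x) := by
  have := envι_mul_envι (one_zero_mem_gospPart (n := n)) hx
  rwa [koszul_zero_left, one_smul, gospBracket_one_zero, map_zero, add_zero] at this

/-- The bracket with x acts on the F_{ij} through the matrix of x, which is the situation of
`commute_casimir`. -/
theorem commute_envC {q : ZMod 2} {x : Gosp n} (hx : x ∈ gospPart n q) :
    Commute (envC n) (envι n x) := by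
  refine Commute.symm (Commute.smul_right ?_ _)
  refine commute_casimir (fun i j => envι n (0, ospGen i j)) hx.2 fun i j => ?_
  rw [envι_mul_envι hx (ospGen_mem_gospPart i j), gospBracket_ospGen hx, map_sub, map_sum, map_smul,
    map_sum]
  simp only [map_smul]

theorem envι_mem_envPart {p : ZMod 2} {x : Gosp n} (hx : x ∈ gospPart n p) :
    envι n x ∈ envPart n p :=
  Submodule.subset_span ⟨[(p, x)], by simpa using hx, by simp, by simp⟩

theorem one_mem_envPart : (1 : Env n) ∈ envPart n 0 :=
  Submodule.subset_span ⟨[], by simp, by simp, by simp⟩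

theorem mul_mem_envPart {p q : ZMod 2} {a b : Env n} (ha : a ∈ envPart n p)
    (hb : b ∈ envPart n q) : a * b ∈ envPart n (p + q) := by
  have h1 : envPart n p * envPart n q ≤ envPart n (p + q) := by
    rw [envPart, envPart, Submodule.span_mul_span, Submodule.span_le]
    rintro _ ⟨_, ⟨l, hl, rfl, rfl⟩, _, ⟨m, hm, rfl, rfl⟩, rfl⟩
    refine Submodule.subset_span ⟨l ++ m, ?_, by simp, by simp⟩
    intro a ha
    rcases List.mem_append.1 ha with ha | ha
    · exact hl a ha
    · exact hm a ha
  exact h1 (Submodule.mul_mem_mul ha hb)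

theorem envPart_induction {p : ZMod 2} (N : ZMod 2 → Submodule ℂ (Env n)) (h1 : (1 : Env n) ∈ N 0)
    (hN : ∀ q r, ∀ x ∈ gospPart n q, ∀ u ∈ N r, envι n x * u ∈ N (q + r)) :
    envPart n p ≤ N p := by
  rw [envPart, Submodule.span_le]
  rintro _ ⟨l, hl, rfl, rfl⟩
  induction l with
  | nil => exact h1
  | cons a l ih =>
    rw [List.map_cons, List.map_cons, List.prod_cons, List.sum_cons]
    exact hN _ _ _ (hl a List.mem_cons_self) _ (ih fun b hb => hl b (List.mem_cons_of_mem a hb))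

theorem mem_envCenterPart_zero {z : Env n} (hz : z ∈ envPart n 0)
    (h : ∀ q, ∀ x ∈ gospPart n q, Commute z (envι n x)) : z ∈ envCenterPart n 0 := by
  refine ⟨hz, fun q w hw => ?_⟩
  rw [koszul_zero_left, one_smul]
  have : envPart n q ≤ Subalgebra.toSubmodule (Subalgebra.centralizer ℂ {z}) := by
    refine envPart_induction (fun _ => Subalgebra.toSubmodule (Subalgebra.centralizer ℂ {z}))
      (Subalgebra.one_mem _) fun q r x hx u hu => Subalgebra.mul_mem _ ?_ hu
    exact Subalgebra.mem_centralizer_iff ℂ |>.2 (by simpa using (h q x hx).eq)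
  exact (Subalgebra.mem_centralizer_iff ℂ).1 (this hw) z rfl

theorem envC_mem_envPart : envC n ∈ envPart n 0 := by
  refine Submodule.smul_mem _ _ (Submodule.sum_mem _ fun i _ => Submodule.sum_mem _ fun j _ =>
    Submodule.smul_mem _ _ ?_)
  have := mul_mem_envPart (envι_mem_envPart (ospGen_mem_gospPart i j))
    (envι_mem_envPart (ospGen_mem_gospPart j i))
  rwa [add_comm (par j), CharTwo.add_self_eq_zero] at this

theorem pow_mem_envPart {z : Env n} (hz : z ∈ envPart n 0) (k : ℕ) : z ^ k ∈ envPart n 0 := by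
  induction k with
  | zero => rw [pow_zero]; exact one_mem_envPart
  | succ k ih => rw [pow_succ]; simpa using mul_mem_envPart ih hz

theorem envC_pow_mul_envZ_pow_mem (a b : ℕ) : envC n ^ a * envZ n ^ b ∈ envCenterPart n 0 := by
  refine mem_envCenterPart_zero ?_ fun q x hx =>
    ((commute_envC hx).pow_left a).mul_left ((commute_envZ hx).pow_left b)
  have hZ : envZ n ∈ envPart n 0 := envι_mem_envPart one_zero_mem_gospPart
  have := mul_mem_envPart (pow_mem_envPart envC_mem_envPart a) (pow_mem_envPart hZ b)
  rwa [add_zero] at this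

theorem casimirSet_subset_envCenter (d n : ℕ) :
    casimirSet d n ⊆ (envCenter n : Set (Env n)) := by
  rintro _ ⟨μ, -, rfl⟩
  exact Submodule.mem_iSup_of_mem 0 (envC_pow_mul_envZ_pow_mem _ _)

theorem mulOp_der_mem_polyDiff (i j : Idx n) : mulOp i * der j ∈ polyDiff n :=
  mul_mem (Algebra.subset_adjoin (Or.inl ⟨i, rfl⟩)) (Algebra.subset_adjoin (Or.inr ⟨j, rfl⟩))

theorem gospAction_mem_polyDiff (x : Gosp n) : gospAction n x ∈ polyDiff n := by
  have h1 : euler n ∈ polyDiff n := sum_mem fun i _ => mulOp_der_mem_polyDiff i i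
  have h2 : glAction n (x.2 : Mat n) ∈ polyDiff n := by
    change ∑ i, ∑ j, (x.2 : Mat n) i j • (mulOp i * der j) ∈ polyDiff n
    exact Subalgebra.sum_mem _ fun i _ =>
      Subalgebra.sum_mem _ fun j _ => Subalgebra.smul_mem _ (mulOp_der_mem_polyDiff i j) _
  exact Subalgebra.add_mem _ (Subalgebra.smul_mem _ h1 _) h2

theorem mulOp_der_mem_polyPart (i j : Idx n) {q : ZMod 2} {u : SPoly n} (hu : u ∈ polyPart n q) :
    mulOp i (der j u) ∈ polyPart n (par i + par j + q) := by
  rw [add_assoc]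
  exact mulOp_mem_polyPart i (der_mem_polyPart j hu)

theorem gospAction_mem_polyPart {p q : ZMod 2} {x : Gosp n} (hx : x ∈ gospPart n p) {u : SPoly n}
    (hu : u ∈ polyPart n q) : gospAction n x u ∈ polyPart n (p + q) := by
  have h1 : x.1 • euler n u ∈ polyPart n (p + q) := by
    rcases zmod_two_cases p with rfl | rfl
    · refine Submodule.smul_mem _ _ ?_
      rw [euler, LinearMap.sum_apply]
      refine Submodule.sum_mem _ fun i _ => ?_
      have := mulOp_der_mem_polyPart i i hu
      rwa [CharTwo.add_self_eq_zero] at this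
    · rw [hx.1 rfl, zero_smul]
      exact Submodule.zero_mem _
  have h2 : glAction n (x.2 : Mat n) u ∈ polyPart n (p + q) := by
    have : glAction n (x.2 : Mat n) u =
        ∑ i, ∑ j, (x.2 : Mat n) i j • mulOp i (der j u) := by
      simp [glAction, LinearMap.sum_apply]
    rw [this]
    refine Submodule.sum_mem _ fun i _ => Submodule.sum_mem _ fun j _ => ?_
    by_cases h : par i + par j = p
    · subst h
      exact Submodule.smul_mem _ _ (mulOp_der_mem_polyPart i j hu)
    · have h0 : (x.2 : Mat n) i j = 0 := by rw [← hx.2, comp_apply, if_neg h]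
      rw [h0, zero_smul]
      exact Submodule.zero_mem _
  exact Submodule.add_mem _ h1 h2

theorem envAction_mem_invariantPart {p : ZMod 2} {z : Env n} (hz : z ∈ envCenterPart n p) :
    envAction n z ∈ invariantPart n p := by
  obtain ⟨hz1, hz2⟩ := hz
  refine ⟨?_, fun q u hu => ?_, fun q x hx => ?_⟩
  · refine envPart_induction (fun _ => (Subalgebra.toSubmodule (polyDiff n)).comap
      (envAction n).toLinearMap) ?_ (fun q r x hx u hu => ?_) hz1
    · change envAction n 1 ∈ polyDiff n
      rw [map_one]
      exact one_mem _
    · change envAction n u ∈ polyDiff n at hu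
      change envAction n (envι n x * u) ∈ polyDiff n
      rw [map_mul, envAction_envι]
      exact mul_mem (gospAction_mem_polyDiff x) hu
  · let N : ZMod 2 → Submodule ℂ (Env n) := fun r =>
      (polyPart n (r + q)).comap ((envAction n).toLinearMap.flip u)
    refine envPart_induction N ?_ (fun q' r x hx w hw => ?_) hz1
    · change envAction n 1 u ∈ polyPart n (0 + q)
      rw [map_one, zero_add]
      exact hu
    · change envAction n w u ∈ polyPart n (r + q) at hw
      change envAction n (envι n x * w) u ∈ polyPart n (q' + r + q)
      rw [map_mul, envAction_envι, add_assoc]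
      exact gospAction_mem_polyPart hx hw
  · have := congrArg (envAction n) (hz2 q _ (envι_mem_envPart hx))
    rwa [map_smul, map_mul, map_mul, envAction_envι] at this

theorem map_envCenter_le (n : ℕ) :
    (envCenter n).map (envAction n).toLinearMap ≤ invariants n := by
  rw [envCenter, Submodule.map_iSup]
  refine iSup_mono fun p => ?_
  rintro _ ⟨z, hz, rfl⟩
  exact envAction_mem_invariantPart hz

end Env

/-! ### The Fock representation on superpolynomials -/

section Concrete

/-- Each pair i, i + n occurs twice in the symmetric sum, and anticommutation makes both occurrences
equal to x_{i+n}x_i. -/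
theorem quadOn_univ_eq {n : ℕ} {A : Type*} [Ring A] [Algebra ℂ A] {x : Idx n → A}
    (hx : ∀ i k, x k * x i = koszul (par i) (par k) • (x i * x k)) :
    quadOn x Finset.univ = x (Sum.inl ()) ^ 2 +
      2 • ∑ i : Fin n, x (Sum.inr (Sum.inr i)) * x (Sum.inr (Sum.inl i)) := by
  rw [quadOn, Fintype.sum_sum_type, Fintype.sum_sum_type, two_nsmul]
  have h1 : ∀ i : Fin n, x (Sum.inr (Sum.inr i)) * x (Sum.inr (Sum.inl i)) =
      -(x (Sum.inr (Sum.inl i)) * x (Sum.inr (Sum.inr i))) := by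
    intro i
    simpa [koszul, par] using hx (Sum.inr (Sum.inl i)) (Sum.inr (Sum.inr i))
  congr 1
  · simp [koszul, par, dualSign, dualIdx, pow_two]
  · congr 1 <;> refine Finset.sum_congr rfl fun i _ => ?_
    · rw [h1]
      simp [koszul, par, dualSign, dualIdx]
    · simp [koszul, par, dualSign, dualIdx]

theorem rSq_eq (n : ℕ) : rSq n = quadOn mulOp Finset.univ :=
  (quadOn_univ_eq (x := mulOp) mulOp_mulOp).symm

theorem laplace_eq (n : ℕ) : laplace n = quadOn der Finset.univ :=
  (quadOn_univ_eq (x := der) der_der).symm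

/-- The operator on `P(V)` that sets `y` to zero. -/
noncomputable def setYZero (n : ℕ) : Module.End ℂ (SPoly n) :=
  LinearMap.rTensor (ExteriorAlgebra ℂ (OddIdx n → ℂ))
    (LinearMap.toSpanSingleton ℂ ℂ[X] 1 ∘ₗ Polynomial.lcoeff ℂ 0)

theorem spoly_one_ne_zero (n : ℕ) : (1 : SPoly n) ≠ 0 := by
  intro h
  have := congrArg (Algebra.TensorProduct.lift (Polynomial.aeval (0 : ℂ))
    (ExteriorAlgebra.algebraMapInv (R := ℂ) (M := OddIdx n → ℂ)) fun _ _ => Commute.all _ _) h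
  rw [map_one, map_zero] at this
  exact one_ne_zero this

theorem fock (n : ℕ) :
    Fock (P := SPoly n) (mulOp (n := n)) der (parityOp n) (setYZero n) 1 where
  toWeylRel := weylRel n
  σ_x := parityOp_mulOp
  σ_d := parityOp_der
  σ_σ := parityOp_parityOp
  σ_v := parityOp_one
  d_v := der_one
  ρ_y := TensorProduct.ext' fun f w => by simp [setYZero, mulOp, coord]
  ρ_x := fun j => TensorProduct.ext' fun f w => by
    simp [setYZero, mulOp, coord]
  d_ρ := TensorProduct.ext' fun f w => by simp [setYZero, der]
  ρ_d := fun j => TensorProduct.ext' fun f w => by simp [setYZero, der]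
  ρ_v := by
    rw [Algebra.TensorProduct.one_def]
    change setYZero n (1 ⊗ₜ 1) = 1 ⊗ₜ 1
    simp [setYZero]
  v_ne := spoly_one_ne_zero n
  gen := eq_top_of_mulOp
  faithful := fun _ h => LinearMap.ext h

theorem pow_span_range_le {ι B : Type*} [Ring B] [Algebra ℂ B] {c : ι → B}
    (N : ℕ → Submodule ℂ B) (h0 : 1 ∈ N 0) (hN : ∀ k, ∀ u ∈ N k, ∀ i, c i * u ∈ N (k + 1))
    (k : ℕ) : Submodule.span ℂ (Set.range c) ^ k ≤ N k := by
  induction k with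
  | zero =>
    rw [pow_zero, Submodule.one_le]
    exact h0
  | succ k ih =>
    rw [pow_succ', Submodule.mul_le]
    intro m hm u hu
    have h1 : Submodule.span ℂ (Set.range c) ≤ (N (k + 1)).comap (LinearMap.mulRight ℂ u) := by
      rw [Submodule.span_le]
      rintro _ ⟨i, rfl⟩
      exact hN k u (ih hu) i
    exact h1 hm

theorem one_mem_pow_span_range {ι B : Type*} [Ring B] [Algebra ℂ B] (c : ι → B) :
    1 ∈ Submodule.span ℂ (Set.range c) ^ 0 :=
  Submodule.one_le.1 (pow_zero _).ge

theorem mul_mem_pow_span_range {ι B : Type*} [Ring B] [Algebra ℂ B] {c : ι → B} {k : ℕ} {u : B}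
    (hu : u ∈ Submodule.span ℂ (Set.range c) ^ k) (i : ι) :
    c i * u ∈ Submodule.span ℂ (Set.range c) ^ (k + 1) := by
  rw [pow_succ']
  exact Submodule.mul_mem_mul (Submodule.subset_span ⟨i, rfl⟩) hu

theorem polyDeg_eq (n k : ℕ) : polyDeg n k = degPart (P := SPoly n) (mulOp (n := n)) 1 k :=
  le_antisymm
    (pow_span_range_le (fun k => degPart (P := SPoly n) (mulOp (n := n)) 1 k) vacuum_mem_degPart
      (fun _ _ hu i => smul_mem_degPart (x := mulOp) i hu) k)
    (degPart_le (polyDeg n) (one_mem_pow_span_range coord)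
      (fun _ _ _ hu i => mul_mem_pow_span_range hu i) k)

theorem polyDiffDeg_eq (n k : ℕ) : polyDiffDeg n k = bideg mulOp der k := by
  have h1 : (polyDeg n k).map (LinearMap.mul ℂ (SPoly n)) = linSpan mulOp ^ k := by
    have h2 := Submodule.map_pow (Submodule.span ℂ (Set.range (coord (n := n))))
      (Algebra.lmul ℂ (SPoly n)) k
    rw [Submodule.map_span, ← Set.range_comp] at h2
    exact h2
  rw [polyDiffDeg, h1]
  rfl

theorem harmonic_eq (n k : ℕ) : harmonic n k = harmonicPart (P := SPoly n) (mulOp (n := n)) der 1 k := by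
  rw [harmonic, polyDeg_eq, laplace_eq]
  rfl

theorem glAction_single {n : ℕ} (i j : Idx n) :
    glAction n (Matrix.single i j 1) = mulOp i * der j := by
  change ∑ a, ∑ b, (Matrix.single i j (1 : ℂ) : Mat n) a b • (mulOp a * der b) = _
  rw [Finset.sum_eq_single i, Finset.sum_eq_single j]
  · simp
  · intro b _ hb
    simp [hb.symm]
  · simp
  · intro a _ ha
    simp [ha.symm]
  · simp

theorem gospAction_ospGen {n : ℕ} (i j : Idx n) :
    gospAction n (0, ospGen i j) = ospOp mulOp der i j := by
  change (0 : ℂ) • euler n + glAction n (ospMatrix i j) = _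
  rw [zero_smul, zero_add, ospMatrix_eq, map_sub, map_smul, glAction_single, glAction_single]
  rfl

theorem envAction_envZ (n : ℕ) : envAction n (envZ n) = eulerOn mulOp der Finset.univ := by
  rw [envZ, envAction_envι]
  change (1 : ℂ) • euler n + glAction n ((0 : osp n) : Mat n) = _
  rw [ZeroMemClass.coe_zero, map_zero, one_smul, add_zero]
  rfl

theorem envAction_envC (n : ℕ) : envAction n (envC n) = casimirOp mulOp der := by
  rw [(weylRel n).casimirOp_eq, envC]
  simp only [map_smul, map_sum, map_mul, envAction_envι, gospAction_ospGen]

/-- Carried over from the enveloping algebra by the action, which avoids a computation in the Weyl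
superalgebra. -/
theorem commute_casimirOp {n : ℕ} (i j : Idx n) :
    Commute (casimirOp (mulOp (n := n)) der) (ospOp mulOp der i j) := by
  have := (commute_envC (ospGen_mem_gospPart i j)).map (envAction n)
  rwa [envAction_envC, envAction_envι, gospAction_ospGen] at this

theorem casimirSpan_le_span {n b c : ℕ} (hb : b ≤ c) :
    casimirSpan (mulOp (n := n)) der b ≤ Submodule.span ℂ (envAction n '' casimirSet c n) := by
  rw [casimirSpan, Submodule.span_le]
  rintro _ ⟨p, hp, rfl⟩
  obtain ⟨h1, h2⟩ := mem_exponents.1 (Finset.mem_coe.1 hp)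
  -- C^iE^a corresponds to μ = (a + i, i), for which μ₁ − μ₂ = a and |μ| = a + 2i.
  refine Submodule.subset_span ⟨_, ⟨(p.1 + p.2, p.2), ⟨?_, ?_, h2⟩, rfl⟩, ?_⟩
  · exact Nat.le_add_left _ _
  · change p.1 + p.2 + p.2 ≤ c
    omega
  · rw [map_mul, map_pow, map_pow, envAction_envC, envAction_envZ]
    change _ * _ ^ (p.1 + p.2 - p.2) = _
    rw [Nat.add_sub_cancel]
    rfl

theorem casimirSpan_le_map {n b : ℕ} : casimirSpan (mulOp (n := n)) der b ≤
    (envCenter n).map (envAction n).toLinearMap := by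
  refine (casimirSpan_le_span le_rfl).trans (Submodule.span_le.2 ?_)
  rintro _ ⟨z, hz, rfl⟩
  exact ⟨z, casimirSet_subset_envCenter b n hz, rfl⟩

theorem parityOp_comm {n : ℕ} {p : ZMod 2} {D : Module.End ℂ (SPoly n)}
    (hD : ∀ q : ZMod 2, ∀ u ∈ polyPart n q, D u ∈ polyPart n (p + q)) :
    parityOp n * D = koszul 1 p • (D * parityOp n) := by
  refine LinearMap.ext fun u => ?_
  have key : ∀ q, ∀ u ∈ polyPart n q, parityOp n (D u) = koszul 1 p • D (parityOp n u) := by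
    intro q u hu
    rw [parityOp_eq_of_mem (hD q u hu), parityOp_eq_of_mem hu, map_smul, smul_smul,
      koszul_add_right]
  obtain ⟨a, ha, b, hb, rfl⟩ :=
    Submodule.mem_sup.1 (polyPart_sup (n := n) ▸ Submodule.mem_top : u ∈ _)
  change parityOp n (D (a + b)) = koszul 1 p • D (parityOp n (a + b))
  rw [map_add, map_add, key 0 a ha, key 1 b hb, map_add, map_add, smul_add]

theorem invariantPart_zero_le (n : ℕ) :
    invariantPart n 0 ≤ (envCenter n).map (envAction n).toLinearMap := by
  rintro D ⟨hD, -, hD'⟩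
  obtain ⟨b, hb⟩ := (weylRel n).exists_mem_orderLE hD
  refine casimirSpan_le_map ((fock n).mem_casimirSpan (commute_casimirOp (n := n)) (b := b) ?_ hb)
  refine mem_commutant.2 ⟨?_, fun i j => ?_⟩
  · have := hD' 0 _ one_zero_mem_gospPart
    rw [koszul_zero_left, one_smul, ← envAction_envι] at this
    change D * envAction n (envZ n) = envAction n (envZ n) * D at this
    rw [envAction_envZ] at this
    exact this.symm
  · have := hD' _ _ (ospGen_mem_gospPart i j)
    rw [koszul_zero_left, one_smul, gospAction_ospGen] at this
    exact this.symm

/-- An odd invariant commutes honestly with E and sp(2n) and anticommutes with the odd generators,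
as `odd_eq_zero` requires. -/
theorem invariantPart_one (n : ℕ) {D : Module.End ℂ (SPoly n)} (hD : D ∈ invariantPart n 1) :
    D = 0 := by
  obtain ⟨hD, hD1, hD'⟩ := hD
  obtain ⟨b, hb⟩ := (weylRel n).exists_mem_orderLE hD
  refine (fock n).odd_eq_zero (c := koszul 1 1) hb (parityOp_comm hD1) ?_ (fun i j => ?_)
    fun j => ?_
  · have := hD' 0 _ one_zero_mem_gospPart
    rw [koszul_zero_right, one_smul, ← envAction_envι] at this
    change D * envAction n (envZ n) = envAction n (envZ n) * D at this
    rw [envAction_envZ] at this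
    exact this.symm
  · have := hD' _ _ (ospGen_mem_gospPart (Sum.inr i) (Sum.inr j))
    change D * _ = koszul 1 (1 + 1) • _ at this
    rw [one_add_one_zmod_two, koszul_zero_right, one_smul, gospAction_ospGen] at this
    exact this.symm
  · have := hD' _ _ (ospGen_mem_gospPart (Sum.inl ()) (Sum.inr j))
    change D * _ = koszul 1 (0 + 1) • _ at this
    rwa [zero_add, gospAction_ospGen] at this

theorem map_envCenter (n : ℕ) :
    (envCenter n).map (envAction n).toLinearMap = invariants n := by
  refine le_antisymm (map_envCenter_le n) (iSup_le fun p => ?_)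
  rcases zmod_two_cases p with rfl | rfl
  · exact invariantPart_zero_le n
  · intro D hD
    rw [invariantPart_one n hD]
    exact Submodule.zero_mem _

theorem summand_eq {n : ℕ} (ν : ℕ × ℕ) {u : SPoly n} : u ∈ summand n ν ↔
    ∃ w ∈ harmonicPart (P := SPoly n) (mulOp (n := n)) der 1 (ν.1 - ν.2),
      (quadOn mulOp Finset.univ ^ ν.2 : Module.End ℂ (SPoly n)) w = u := by
  rw [summand, harmonic_eq, rSq_eq]
  exact Submodule.mem_map

theorem isCapelli_unique {n : ℕ} {ν : ℕ × ℕ} {D D' : Module.End ℂ (SPoly n)}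
    (hD : IsCapelli n ν D) (hD' : IsCapelli n ν D') : D = D' := by
  obtain ⟨h1, h2, h3⟩ := hD
  obtain ⟨h1', h2', h3'⟩ := hD'
  rw [polyDiffDeg_eq] at h1 h1'
  -- The summand R^{2j}H_m is V_ν' for ν' = (m + j, j).
  have key : ∀ j m, m + 2 * j = ν.1 + ν.2 → (ν.1 + ν.2) / 2 ≤ j + n →
      ∀ u ∈ summand n (m + j, j), D u = D' u := by
    intro j m hjm hj u hu
    by_cases hν : (m + j, j) = ν
    · rw [hν] at hu
      rw [h2 _ hu, h2' _ hu]
    · have hs : (m + j, j) ∈ starIndex n (ν.1 + ν.2) := by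
        refine ⟨Nat.le_add_left _ _, ?_, hj⟩
        change m + j + j = _
        omega
      rw [h3 _ hs hν _ hu, h3' _ hs hν _ hu]
  refine (fock n).eq_of_harmonic h1 h1' fun j m hjm hj u hu =>
    key j m hjm hj _ ((summand_eq _).2 ⟨u, ?_, rfl⟩)
  rwa [Nat.add_sub_cancel]

theorem exists_isCapelli {n : ℕ} {ν : ℕ × ℕ} (hν : ν.2 ≤ ν.1) :
    ∃ D ∈ casimirSpan (mulOp (n := n)) der (ν.1 + ν.2), IsCapelli n ν D := by
  obtain ⟨T, hT, hT', h⟩ := (fock n).exists_capelli (commute_casimirOp (n := n))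
    (k := ν.1 + ν.2) (m := ν.1 - ν.2) (by omega) (by omega)
  refine ⟨T, hT', ?_, fun u hu => ?_, fun ν' hν' hne u hu => ?_⟩
  · rwa [polyDiffDeg_eq]
  · obtain ⟨w, hw, rfl⟩ := (summand_eq ν).1 hu
    exact (h ν.2 (ν.1 - ν.2) (by omega) w hw).trans (if_pos rfl)
  · obtain ⟨w, hw, rfl⟩ := (summand_eq ν').1 hu
    obtain ⟨h1, h2, -⟩ := hν'
    refine (h ν'.2 (ν'.1 - ν'.2) (by omega) w hw).trans (if_neg fun h3 => hne ?_)
    exact Prod.ext (by omega) (by omega)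

end Concrete

end CapelliOsp

/-! ### The theorem. -/

theorem theorem2p4 (n : ℕ) :
    (∀ d : ℕ, CapelliOsp.casimirSet d n ⊆ (CapelliOsp.envCenter n : Set (CapelliOsp.Env n))) ∧
    (∀ d : ℕ, ∀ ν ∈ CapelliOsp.lambdaStar d n,
      (∃! D : Module.End ℂ (CapelliOsp.SPoly n), CapelliOsp.IsCapelli n ν D) ∧
      ∀ D : Module.End ℂ (CapelliOsp.SPoly n), CapelliOsp.IsCapelli n ν D →
        D ∈ CapelliOsp.invariants n ∧
        D ∈ Submodule.span ℂ (CapelliOsp.envAction n '' CapelliOsp.casimirSet d n)) ∧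
    (CapelliOsp.envCenter n).map (CapelliOsp.envAction n).toLinearMap =
      CapelliOsp.invariants n := by
  refine ⟨fun d => CapelliOsp.casimirSet_subset_envCenter d n, ?_, CapelliOsp.map_envCenter n⟩
  rintro d ν ⟨k, hk, h1, h2, -⟩
  obtain ⟨D, hD, hD'⟩ := CapelliOsp.exists_isCapelli (n := n) h1
  refine ⟨⟨D, hD', fun D₂ h => CapelliOsp.isCapelli_unique h hD'⟩, fun D₂ h => ?_⟩
  rw [CapelliOsp.isCapelli_unique h hD']
  exact ⟨CapelliOsp.map_envCenter_le n (CapelliOsp.casimirSpan_le_map hD),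
    CapelliOsp.casimirSpan_le_span (by omega) hD⟩
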